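/- Let $F$ be a nonarchimedean local field of characteristic $0$ and odd residue characteristic, $E/F$ the unramified quadratic extension with $\mathrm{Gal}(E/F)=\langle\theta\rangle$, $\bar F$ an algebraic closure of $F$, $\varpi$ a uniformizer of $F$, and $\xi\in\mathcal O_E^\times$ a unit with $\mathrm{Tr}_{E/F}(\xi)=0$. Let $J$ be the antidiagonal $3\times 3$ permutation matrix and $\sigma(g)=Jg^{-t}J^{-1}$. Write $\bar g$ for the effect of $\theta$ on $E\otimes_F R$ applied to the entries. For $F$-algebras $R$ put $$G(R)=\{g\in \mathrm{GL}_3(E\otimes_F R): J\bar g^{-t}J^{-1}=g\},\qquad \mathcal S(R)=\{g\in G(R): g=\sigma(g)^{-1}\},$$ $$G_1(R)=\mathrm{SO}_3(R)=\{g\in\mathrm{GL}_3(R):\sigma(g)=g,\ \det g=1\}.$$ The group $G_1$ acts on $\mathcal S$ by $g^{-1}\gamma g$. Let $G_\gamma$ be the centralizer of $\gamma$ in $G$ and $G_{1\gamma}=G_1\cap G_\gamma$. For $\gamma\in\mathcal S(F)$ let $[\gamma]_{\rm st}$ be the set of elements of $\mathcal S(F)$ in the $G_1(\bar F)$-orbit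 of $\gamma$ (the stable orbit), and let its rational orbit be its $G_1(F)$-orbit. Put $\mathfrak D(F,G_{1\gamma},G_1)=\ker[H^1(F,G_{1\gamma})\to H^1(F,G_1)]$. For nonzero $\nu\in F$ let $$T_\nu(F)=\left\{\begin{pmatrix}x&0&y\\0&z&0\\ \nu y&0&x\end{pmatrix}\in G(F): x,y,z\in E\right\}.$$ Write $\mathrm U_{1,L/K}$ for the norm-one group of a quadratic extension $L/K$. A torus over $F$ is of type - I if it is isomorphic to $\mathrm{Res}_{E/F}\mathbb G_m\times \mathrm U_{1,E/F}$; - II if it is isomorphic to $\mathrm U_{1,E/F}\times\mathrm U_{1,E/F}\times\mathrm U_{1,E/F}$; - III if it is isomorphic to $\mathrm{Res}_{K/F}\mathrm U_{1,EK/K}\times \mathrm U_{1,E/F}$ for some quadratic extension $K/F$ with $K\not\cong E$; - IV if it is isomorphic to $\mathrm{Res}_{K/F}\mathrm U_{1,EK/K}$ for some cubic extension $K/F$. Let $\gamma\in\mathcal S(F)$ be regular semisimple as an element of $G(F)$ (that is, with pairwise distinct eigenvalues). (1) If $G_\gamma$ is of type I, II or III, then $[\gamma]_{\rm st}$ meets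 $T_\nu(F)$ for some $\nu\in\{1,\xi^2,\varpi,\xi^2\varpi\}$. (2) The Galois cohomology of the commutative group $G_{1\gamma}$ is $$H^1(F,G_{1\gamma})\cong\begin{cases}(\mathbb Z/2\mathbb Z)^2&\text{if }G_\gamma\text{ is of type I},\\(\mathbb Z/2\mathbb Z)^4&\text{if }G_\gamma\text{ is of type II},\\(\mathbb Z/2\mathbb Z)^2&\text{if }G_\gamma\text{ is of type III},\\0&\text{if }G_\gamma\text{ is of type IV}.\end{cases}$$ (3) If $G_\gamma$ is of type IV, then $\mathfrak D(F,G_{1\gamma},G_1)=0$ and $[\gamma]_{\rm st}$ is the rational orbit of $\gamma$. -/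

import Mathlib

open scoped Matrix
open scoped TensorProduct ValuativeRel

universe u

noncomputable section

namespace SymmSpace

/-! ### The involutions of `GL₃` -/

section Ring

variable {A B : Type*} [CommRing A] [CommRing B]

/-- The antidiagonal matrix `J₃`. -/
def J (A : Type*) [CommRing A] : GL (Fin 3) A where
  val := !![0, 0, 1; 0, 1, 0; 1, 0, 0]
  inv := !![0, 0, 1; 0, 1, 0; 1, 0, 0]
  val_inv := by ext i j; fin_cases i <;> fin_cases j <;> simp [Matrix.mul_apply, Fin.sum_univ_three]
  inv_val := by ext i j; fin_cases i <;> fin_cases j <;> simp [Matrix.mul_apply, Fin.sum_univ_three]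

/-- The inverse transpose `g ↦ g⁻ᵗ`. -/
def invTranspose (A : Type*) [CommRing A] : GL (Fin 3) A →* GL (Fin 3) A where
  toFun g :=
    { val := (g⁻¹).valᵀ
      inv := g.valᵀ
      val_inv := by rw [← Matrix.transpose_mul, ← Units.val_mul, mul_inv_cancel]; simp
      inv_val := by rw [← Matrix.transpose_mul, ← Units.val_mul, inv_mul_cancel]; simp }
  map_one' := by ext1; simp
  map_mul' g h := by ext1; simp [mul_inv_rev]

/-- The involution `σ(g) = J g⁻ᵗ J⁻¹`. -/
def sigma (A : Type*) [CommRing A] : GL (Fin 3) A →* GL (Fin 3) A :=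
  (MulAut.conj (J A)).toMonoidHom.comp (invTranspose A)

lemma map_J (f : A →+* B) : Matrix.GeneralLinearGroup.map f (J A) = J B := by
  ext i j; fin_cases i <;> fin_cases j <;> simp [J, Matrix.GeneralLinearGroup.map]

lemma map_invTranspose (f : A →+* B) (g : GL (Fin 3) A) :
    Matrix.GeneralLinearGroup.map f (invTranspose A g) =
      invTranspose B (Matrix.GeneralLinearGroup.map f g) := by
  have : Matrix.GeneralLinearGroup.map f g⁻¹ = (Matrix.GeneralLinearGroup.map f g)⁻¹ := map_inv _ _
  ext i j
  simp only [invTranspose, MonoidHom.coe_mk, OneHom.coe_mk, ← this]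
  simp [Matrix.GeneralLinearGroup.map]

lemma map_sigma (f : A →+* B) (g : GL (Fin 3) A) :
    Matrix.GeneralLinearGroup.map f (sigma A g) =
      sigma B (Matrix.GeneralLinearGroup.map f g) := by
  simp [sigma, map_J, map_invTranspose]

/-- The elements `g` of `GL₃(A)` with `J ḡ⁻ᵗ J⁻¹ = g`, where the bar is a given ring
endomorphism `c` of `A`. -/
def unitary (c : A →+* A) : Subgroup (GL (Fin 3) A) where
  carrier := {g | sigma A (Matrix.GeneralLinearGroup.map c g) = g}
  mul_mem' {a b} ha hb := by
    simp only [Set.mem_ofPred_eq, map_mul] at *; rw [ha, hb]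
  one_mem' := by simp
  inv_mem' {a} ha := by
    simp only [Set.mem_ofPred_eq, map_inv] at *; rw [ha]

/-- The symmetric space: the elements `g` of the unitary group with `g = σ(g)⁻¹`. -/
def symm (c : A →+* A) : Set (GL (Fin 3) A) :=
  {g | g ∈ unitary c ∧ g = (sigma A g)⁻¹}

/-- The special orthogonal group `SO₃(A) = {g | σ(g) = g, det g = 1}`. -/
def specialOrthogonal (A : Type*) [CommRing A] : Subgroup (GL (Fin 3) A) where
  carrier := {g | sigma A g = g ∧ Matrix.GeneralLinearGroup.det g = 1}
  mul_mem' {a b} ha hb := by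
    simp only [Set.mem_ofPred_eq, map_mul] at *; rw [ha.1, ha.2, hb.1, hb.2]; simp
  one_mem' := by simp
  inv_mem' {a} ha := by
    simp only [Set.mem_ofPred_eq, map_inv] at *; rw [ha.1, ha.2]; simp

/-- A matrix in `GL₃` of a field is regular semisimple if its eigenvalues in an algebraic closure
are pairwise distinct. -/
def IsRegularSemisimple {K : Type*} [Field K] (g : GL (Fin 3) K) : Prop :=
  g.val.charpoly.Separable

end Ring

/-! ### Algebraic groups over `F`, given by their functors of points -/

section Functors

variable {F : Type u} [Field F] {E : Type u} [Field E] [Algebra F E]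

/-- The ring homomorphism `K ⊗ R → K ⊗ S` induced by `R → S`. -/
abbrev tensorMap (K : Type u) [CommRing K] [Algebra F K] {R S : Type u} [CommRing R] [Algebra F R]
    [CommRing S] [Algebra F S] (f : R →ₐ[F] S) : K ⊗[F] R →ₐ[F] K ⊗[F] S :=
  Algebra.TensorProduct.map (AlgHom.id F K) f

/-- The involution `θ ⊗ id` of `E ⊗ R`. -/
def conj (θ : E ≃ₐ[F] E) (R : Type u) [CommRing R] [Algebra F R] : E ⊗[F] R →ₐ[F] E ⊗[F] R :=
  Algebra.TensorProduct.map (θ : E →ₐ[F] E) (AlgHom.id F R)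

/-- The image in `GL₃(E ⊗ R)` of a matrix with entries in `E`. -/
def baseChange (R : Type u) [CommRing R] [Algebra F R] : GL (Fin 3) E →* GL (Fin 3) (E ⊗[F] R) :=
  Matrix.GeneralLinearGroup.map
    (Algebra.TensorProduct.includeLeft : E →ₐ[F] E ⊗[F] R).toRingHom

variable (F E) in
/-- The embedding `GL₃(R) → GL₃(E ⊗ R)`. -/
def embed (R : Type u) [CommRing R] [Algebra F R] : GL (Fin 3) R →* GL (Fin 3) (E ⊗[F] R) :=
  Matrix.GeneralLinearGroup.map
    (Algebra.TensorProduct.includeRight : R →ₐ[F] E ⊗[F] R).toRingHom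

/-- The group `U_{1,E/F}` of elements of norm one: `U_{1,E/F}(R) = {x ∈ (E ⊗ R)ˣ | x x̄ = 1}`. -/
def U1 (θ : E ≃ₐ[F] E) (R : Type u) [CommRing R] [Algebra F R] : Subgroup (E ⊗[F] R)ˣ where
  carrier := {x | x * Units.map (conj θ R).toMonoidHom x = 1}
  mul_mem' {a b} ha hb := by
    simp only [Set.mem_ofPred_eq, map_mul] at *
    rw [mul_mul_mul_comm, ha, hb, one_mul]
  one_mem' := by simp
  inv_mem' {a} ha := by
    simp only [Set.mem_ofPred_eq, map_inv] at *
    rw [← mul_inv, ha, inv_one]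

/-- The unitary group `G = U₃`, with `G(R) = {g ∈ GL₃(E ⊗ R) | J ḡ⁻ᵗ J⁻¹ = g}`. -/
def U3 (θ : E ≃ₐ[F] E) (R : Type u) [CommRing R] [Algebra F R] :
    Subgroup (GL (Fin 3) (E ⊗[F] R)) :=
  unitary (conj θ R).toRingHom

/-- The centralizer `G_γ` in `G` of `γ ∈ GL₃(E)`. -/
def centralizer (θ : E ≃ₐ[F] E) (γ : GL (Fin 3) E) (R : Type u) [CommRing R] [Algebra F R] :
    Subgroup (GL (Fin 3) (E ⊗[F] R)) :=
  U3 θ R ⊓ Subgroup.centralizer {baseChange R γ}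

variable (F) in
/-- The stabilizer `G_{1γ} = G₁ ∩ G_γ` of `γ ∈ GL₃(E)` in `G₁ = SO₃`. -/
def stabilizer (γ : GL (Fin 3) E) (R : Type u) [CommRing R] [Algebra F R] :
    Subgroup (GL (Fin 3) R) :=
  specialOrthogonal R ⊓ (Subgroup.centralizer {baseChange R γ}).comap (embed F E R)

/-! Functoriality in `R` -/

variable {R S : Type u} [CommRing R] [Algebra F R] [CommRing S] [Algebra F S]

lemma conj_tensorMap (θ : E ≃ₐ[F] E) (f : R →ₐ[F] S) :
    (conj θ S).comp (tensorMap E f) = (tensorMap E f).comp (conj θ R) := by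
  refine Algebra.TensorProduct.ext (by ext; simp [conj]) (by ext; simp [conj])

lemma map_baseChange (f : R →ₐ[F] S) (g : GL (Fin 3) E) :
    Matrix.GeneralLinearGroup.map (tensorMap E f).toRingHom (baseChange R g) =
      baseChange S g := by
  ext i j; simp [baseChange, Matrix.GeneralLinearGroup.map]

lemma map_embed (f : R →ₐ[F] S) (g : GL (Fin 3) R) :
    Matrix.GeneralLinearGroup.map (tensorMap E f).toRingHom (embed F E R g) =
      embed F E S (Matrix.GeneralLinearGroup.map f.toRingHom g) := by
  ext i j; simp [embed, Matrix.GeneralLinearGroup.map]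

/-- The map `U_{1,E/F}(R) → U_{1,E/F}(S)` induced by `R → S`. -/
def U1Map (θ : E ≃ₐ[F] E) (f : R →ₐ[F] S) : U1 θ R →* U1 θ S :=
  ((Units.map (tensorMap E f).toMonoidHom).comp (U1 θ R).subtype).codRestrict (U1 θ S)
    fun x => by
      have h := congrArg (Units.map (tensorMap E f).toMonoidHom) x.2
      rw [map_mul, map_one] at h
      refine Eq.trans (congrArg₂ _ rfl ?_) h
      ext
      exact DFunLike.congr_fun (conj_tensorMap θ f) (x.1.val)

/-- The map `G_γ(R) → G_γ(S)` induced by `R → S`. -/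
def centralizerMap (θ : E ≃ₐ[F] E) (γ : GL (Fin 3) E) (f : R →ₐ[F] S) :
    centralizer θ γ R →* centralizer θ γ S :=
  ((Matrix.GeneralLinearGroup.map (tensorMap E f).toRingHom).comp
    (centralizer θ γ R).subtype).codRestrict (centralizer θ γ S)
    fun x => by
      obtain ⟨x, hx, hc⟩ := x
      refine ⟨?_, ?_⟩
      · change sigma _ (Matrix.GeneralLinearGroup.map _
          (Matrix.GeneralLinearGroup.map (tensorMap E f).toRingHom x)) =
          Matrix.GeneralLinearGroup.map (tensorMap E f).toRingHom x
        have hx' : sigma _ (Matrix.GeneralLinearGroup.map (conj θ R).toRingHom x) = x := hx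
        conv_rhs => rw [← hx', map_sigma]
        congr 1
        ext i j
        exact DFunLike.congr_fun (conj_tensorMap θ f) _
      · change _ ∈ Subgroup.centralizer _
        have hc' := Subgroup.mem_centralizer_singleton_iff.1 hc
        rw [Subgroup.mem_centralizer_singleton_iff]
        have h := congrArg (Matrix.GeneralLinearGroup.map (tensorMap E f).toRingHom) hc'
        rw [map_mul, map_mul, map_baseChange] at h
        exact h

lemma map_mem_specialOrthogonal (f : R →ₐ[F] S) {g : GL (Fin 3) R}
    (hg : g ∈ specialOrthogonal R) :
    Matrix.GeneralLinearGroup.map f.toRingHom g ∈ specialOrthogonal S := by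
  refine ⟨?_, ?_⟩
  · rw [← map_sigma, hg.1]
  · have h := hg.2
    rw [Units.ext_iff, Matrix.GeneralLinearGroup.val_det_apply] at h ⊢
    change (f.toRingHom.mapMatrix g.val).det = 1
    rw [← RingHom.map_det, h]
    simp

lemma map_mem_stabilizer (γ : GL (Fin 3) E) (f : R →ₐ[F] S) {g : GL (Fin 3) R}
    (hg : g ∈ stabilizer F γ R) :
    Matrix.GeneralLinearGroup.map f.toRingHom g ∈ stabilizer F γ S := by
  refine ⟨map_mem_specialOrthogonal f hg.1, ?_⟩
  have hc' := Subgroup.mem_centralizer_singleton_iff.1 hg.2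
  change _ ∈ Subgroup.centralizer _
  rw [Subgroup.mem_centralizer_singleton_iff]
  have h := congrArg (Matrix.GeneralLinearGroup.map (tensorMap E f).toRingHom) hc'
  rw [map_mul, map_mul, map_baseChange, map_embed] at h
  exact h

end Functors

/-! ### Galois cohomology -/

section Cohomology

variable (Γ : Type*) [Group Γ] [TopologicalSpace Γ]
variable (A : Type*) [Group A] [MulDistribMulAction Γ A]
variable {B : Type*} [Group B] [MulDistribMulAction Γ B]

/-- Continuous 1-cocycles of a topological group `Γ` in a discrete group `A`:
`a(st) = a(s) · s(a(t))`. -/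
structure Cocycle where
  toFun : Γ → A
  locallyConstant : IsLocallyConstant toFun
  map_mul : ∀ s t, toFun (s * t) = toFun s * s • toFun t

/-- Two cocycles are cohomologous if `b(s) = g⁻¹ · a(s) · s(g)` for some `g`. -/
def cohomologous : Setoid (Cocycle Γ A) where
  r a b := ∃ g : A, ∀ s, b.toFun s = g⁻¹ * a.toFun s * s • g
  iseqv :=
    { refl := fun a => ⟨1, fun s => by simp⟩
      symm := fun {a b} ⟨g, h⟩ => ⟨g⁻¹, fun s => by simp [h, mul_assoc]⟩
      trans := fun {a b c} ⟨g, h⟩ ⟨k, h'⟩ => ⟨g * k, fun s => by simp [h, h', mul_assoc]⟩ }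

/-- The pointed set `H¹(Γ, A)`. -/
def H1 : Type _ := Quotient (cohomologous Γ A)

/-- The neutral element of `H¹(Γ, A)`. -/
instance : One (H1 Γ A) where
  one := Quotient.mk _ ⟨fun _ => 1, IsLocallyConstant.const 1, fun s t => by simp⟩

/-- If `A` is commutative, cohomology classes are multiplied by multiplying cocycles pointwise. -/
instance [IsMulCommutative A] : Mul (H1 Γ A) where
  mul := Quotient.map₂
    (fun a b => ⟨fun s => a.toFun s * b.toFun s, a.locallyConstant.mul b.locallyConstant,
      fun s t => by
        rw [a.map_mul, b.map_mul, smul_mul', mul_assoc, mul_assoc,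
          ← mul_assoc (s • (a.toFun t)), ← mul_assoc (b.toFun s),
          mul_comm' (s • (a.toFun t)) (b.toFun s)]⟩)
    (by
      rintro a a' ⟨g, hg⟩ b b' ⟨k, hk⟩
      refine ⟨g * k, fun s => ?_⟩
      simp only [hg, hk, smul_mul', mul_inv_rev]
      have e : ∀ x y : A, x * y = y * x := mul_comm'
      have e' : ∀ x y z : A, x * (y * z) = y * (x * z) := fun x y z => by
        rw [← mul_assoc, e x y, mul_assoc]
      simp only [mul_assoc, e, e'])

/-- `A` is commutative and `H¹(Γ, A) ≅ (ℤ/2ℤ)ᵏ` as groups. -/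
def H1IsElementaryTwo (k : ℕ) : Prop :=
  ∃ _ : IsMulCommutative A, Nonempty (H1 Γ A ≃* Multiplicative (Fin k → ZMod 2))

variable {A} in
/-- The map on `H¹` induced by an equivariant homomorphism. -/
def H1.map (φ : A →* B) (hφ : ∀ (s : Γ) (a : A), φ (s • a) = s • φ a) : H1 Γ A → H1 Γ B :=
  Quotient.map
    (fun a => ⟨fun s => φ (a.toFun s), a.locallyConstant.comp _, fun s t => by
      rw [a.map_mul, _root_.map_mul, hφ]⟩)
    (by
      rintro a b ⟨g, hg⟩
      refine ⟨φ g, fun s => ?_⟩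
      simp only [hg, _root_.map_mul, map_inv, hφ])

end Cohomology

section GaloisAction

variable {F : Type u} [Field F] {E : Type u} [Field E] [Algebra F E]
variable (Fbar : Type u) [Field Fbar] [Algebra F Fbar]

/-- The Galois group acts on `G₁(F̄)` entrywise. -/
instance : MulDistribMulAction (Fbar ≃ₐ[F] Fbar) (specialOrthogonal Fbar) where
  smul s g := ⟨Matrix.GeneralLinearGroup.map (s : Fbar →ₐ[F] Fbar).toRingHom g,
    map_mem_specialOrthogonal _ g.2⟩
  one_smul _ := rfl
  mul_smul _ _ _ := rfl
  smul_one _ := Subtype.ext (map_one _)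
  smul_mul _ _ _ := Subtype.ext (map_mul _ _ _)

/-- The Galois group acts on `G_{1γ}(F̄)` entrywise. -/
instance (γ : GL (Fin 3) E) : MulDistribMulAction (Fbar ≃ₐ[F] Fbar) (stabilizer F γ Fbar) where
  smul s g := ⟨Matrix.GeneralLinearGroup.map (s : Fbar →ₐ[F] Fbar).toRingHom g,
    map_mem_stabilizer γ _ g.2⟩
  one_smul _ := rfl
  mul_smul _ _ _ := rfl
  smul_one _ := Subtype.ext (map_one _)
  smul_mul _ _ _ := Subtype.ext (map_mul _ _ _)

/-- The inclusion `G_{1γ}(F̄) → G₁(F̄)`. -/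
def stabilizerInclusion (γ : GL (Fin 3) E) : stabilizer F γ Fbar →* specialOrthogonal Fbar :=
  Subgroup.inclusion inf_le_left

/-- `𝔇(F, G_{1γ}, G₁) = ker[H¹(F, G_{1γ}) → H¹(F, G₁)]`. -/
def frakD (γ : GL (Fin 3) E) : Set (H1 (Fbar ≃ₐ[F] Fbar) (stabilizer F γ Fbar)) :=
  {x | H1.map (Fbar ≃ₐ[F] Fbar) (stabilizerInclusion Fbar γ) (fun _ _ => rfl) x = 1}

end GaloisAction

/-! ### Orbits, tori and their types -/

section Orbits

variable {F E : Type u} [Field F] [Field E] [Algebra F E] (θ : E ≃ₐ[F] E)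

/-- The set `𝒮(F)`. -/
abbrev symmPoints : Set (GL (Fin 3) E) := symm (θ : E →+* E)

/-- The rational orbit of `γ`: the elements of `𝒮(F)` of the form `g⁻¹ γ g`, `g ∈ G₁(F)`. -/
def rationalOrbit (γ : GL (Fin 3) E) : Set (GL (Fin 3) E) :=
  {γ' | γ' ∈ symmPoints θ ∧ ∃ g ∈ specialOrthogonal F,
    (Matrix.GeneralLinearGroup.map (algebraMap F E) g)⁻¹ * γ *
      Matrix.GeneralLinearGroup.map (algebraMap F E) g = γ'}

/-- The stable class `[γ]_st`: the elements of `𝒮(F)` of the form `g⁻¹ γ g` with `g ∈ G₁(F̄)`,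
the product being taken in `GL₃(E ⊗ F̄)`. -/
def stableClass (Fbar : Type u) [Field Fbar] [Algebra F Fbar] (γ : GL (Fin 3) E) :
    Set (GL (Fin 3) E) :=
  {γ' | γ' ∈ symmPoints θ ∧ ∃ g ∈ specialOrthogonal Fbar,
    (embed F E Fbar g)⁻¹ * baseChange Fbar γ * embed F E Fbar g = baseChange Fbar γ'}

/-- The set `T_ν(F)`, for nonzero `ν` in (the image of) `F`. For such `ν` the group of all matrices
of this shape in `G` is connected, so it is its own neutral component. -/
def T (ν : E) : Set (GL (Fin 3) E) :=
  {g | g ∈ unitary (θ : E →+* E) ∧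
    ∃ x y z : E, g.val = !![x, 0, y; 0, z, 0; ν * y, 0, x]}

/-! The four types of maximal tori. An isomorphism of algebraic groups over `F` is a family of
isomorphisms of the groups of `R`-points, natural in the commutative `F`-algebra `R`. -/

/-- Type I: `G_γ ≅ Res_{E/F} 𝔾_m × U_{1,E/F}`. -/
def IsTypeI (γ : GL (Fin 3) E) : Prop :=
  ∃ e : ∀ (R : Type u) [CommRing R] [Algebra F R],
      centralizer θ γ R ≃* (E ⊗[F] R)ˣ × U1 θ R,
    ∀ (R S : Type u) [CommRing R] [Algebra F R] [CommRing S] [Algebra F S] (f : R →ₐ[F] S)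
      (g : centralizer θ γ R),
      e S (centralizerMap θ γ f g) =
        (Units.map (tensorMap E f).toMonoidHom (e R g).1, U1Map θ f (e R g).2)

/-- Type II: `G_γ ≅ U_{1,E/F} × U_{1,E/F} × U_{1,E/F}`. -/
def IsTypeII (γ : GL (Fin 3) E) : Prop :=
  ∃ e : ∀ (R : Type u) [CommRing R] [Algebra F R],
      centralizer θ γ R ≃* U1 θ R × U1 θ R × U1 θ R,
    ∀ (R S : Type u) [CommRing R] [Algebra F R] [CommRing S] [Algebra F S] (f : R →ₐ[F] S)
      (g : centralizer θ γ R),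
      e S (centralizerMap θ γ f g) =
        (U1Map θ f (e R g).1, U1Map θ f (e R g).2.1, U1Map θ f (e R g).2.2)

/-- Type III: `G_γ ≅ Res_{K/F} U_{1,EK/K} × U_{1,E/F}` for a quadratic extension `K/F` not
isomorphic to `E`. Here `EK = E ⊗ K`, so `U_{1,EK/K}` is the base change of `U_{1,E/F}` to `K` and
the group of `R`-points of its restriction of scalars is `U_{1,E/F}(K ⊗ R)`. -/
def IsTypeIII (γ : GL (Fin 3) E) : Prop :=
  ∃ (K : Type u) (_ : Field K) (_ : Algebra F K),
    Module.finrank F K = 2 ∧ IsEmpty (K ≃ₐ[F] E) ∧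
    ∃ e : ∀ (R : Type u) [CommRing R] [Algebra F R],
        centralizer θ γ R ≃* U1 θ (K ⊗[F] R) × U1 θ R,
      ∀ (R S : Type u) [CommRing R] [Algebra F R] [CommRing S] [Algebra F S] (f : R →ₐ[F] S)
        (g : centralizer θ γ R),
        e S (centralizerMap θ γ f g) =
          (U1Map θ (tensorMap K f) (e R g).1, U1Map θ f (e R g).2)

/-- Type IV: `G_γ ≅ Res_{K/F} U_{1,EK/K}` for a cubic extension `K/F`. Again `EK = E ⊗ K`, so the
group of `R`-points of the right-hand side is `U_{1,E/F}(K ⊗ R)`. -/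
def IsTypeIV (γ : GL (Fin 3) E) : Prop :=
  ∃ (K : Type u) (_ : Field K) (_ : Algebra F K), Module.finrank F K = 3 ∧
    ∃ e : ∀ (R : Type u) [CommRing R] [Algebra F R],
        centralizer θ γ R ≃* U1 θ (K ⊗[F] R),
      ∀ (R S : Type u) [CommRing R] [Algebra F R] [CommRing S] [Algebra F S] (f : R →ₐ[F] S)
        (g : centralizer θ γ R),
        e S (centralizerMap θ γ f g) = U1Map θ (tensorMap K f) (e R g)

end Orbits

end SymmSpace

end

/-!
A Cayley transform `τ = ξ (1 + cγ) / (1 - cγ)`, with `c` of norm one, turns `γ` into a matrix over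
`F` which is symmetric about the antidiagonal and has distinct eigenvalues. The torus of invertible
matrices commuting with `τ` satisfies Hilbert 90, and `G_{1γ}` is the group of its elements `g` with
`g² = 1` and `det g = 1`. Hence `H¹(F, G_{1γ})` is computed by square classes: the squares have
index `m²` in the rational points of the torus, where `m` is the number of rational points of order
dividing two, and index `4` in `Fˣ`, so that `H¹` is elementary abelian of order `m² / 4`. The same
`m` counts the elements of order dividing two in `G_γ(F)`, so it is read off the type.

If `m > 2`, the torus contains an involution other than `±1`, which forces a rational eigenvalue
of `τ`. Then `τ` has the characteristic polynomial of a symmetric matrix in the shape of `T_ν`, and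
symmetric matrices with the same separable characteristic polynomial are conjugate under
`SO₃(F̄)`. In type IV the vanishing of `H¹` lets a conjugating element descend to `F`.
-/

namespace SymmSpace

/-! ### Square classes of local fields -/

section SquareClasses

lemma isSquare_units_iff {K : Type*} [Field K] {x : Kˣ} : IsSquare x ↔ IsSquare (x : K) := by
  refine ⟨fun h => h.map (Units.coeHom K), ?_⟩
  rintro ⟨y, hy⟩
  have hy0 : y ≠ 0 := by
    rintro rfl
    exact x.ne_zero (by simp [hy])
  exact ⟨Units.mk0 y hy0, Units.ext hy⟩

lemma isSquare_mul_iff_not_isSquare {k : Type*} [Field k] [Finite k] {a b : k}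
    (ha : ¬IsSquare a) (hb : b ≠ 0) : IsSquare (b * a) ↔ ¬IsSquare b := by
  classical
  have := Fintype.ofFinite k
  have ha0 : a ≠ 0 := fun h => ha (h ▸ IsSquare.zero)
  rw [← quadraticChar_one_iff_isSquare (mul_ne_zero hb ha0), map_mul,
    quadraticChar_neg_one_iff_not_isSquare.2 ha, ← quadraticChar_neg_one_iff_not_isSquare,
    mul_neg_one, neg_eq_iff_eq_neg]

section FractionField

variable {O K : Type*} [CommRing O] [Field K] [Algebra O K] [IsFractionRing O K]

lemma zpow_mem_range_units_iff {π : Kˣ} {p : O} (hp : Irreducible p) (hπ : algebraMap O K p = π)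
    {n : ℤ} : π ^ n ∈ (Units.map (algebraMap O K : O →* K)).range ↔ n = 0 := by
  refine ⟨?_, fun h => by simp [h]⟩
  rintro ⟨v, hv⟩
  have natCase {m : ℕ} (w : Oˣ) (hw : Units.map (algebraMap O K : O →* K) w = π ^ m) : m = 0 := by
    by_contra hm
    refine hp.not_isUnit ((isUnit_pow_iff hm).1 ⟨w, IsFractionRing.injective O K ?_⟩)
    simpa [hπ] using congrArg Units.val hw
  rcases n.eq_nat_or_neg with ⟨m, rfl | rfl⟩
  · simpa using natCase v (by simpa using hv)
  · simpa using natCase v⁻¹ (by rw [map_inv, hv]; simp)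

variable [IsDomain O] [IsDiscreteValuationRing O]

lemma exists_eq_zpow_mul_unit {π : Kˣ} {p : O} (hp : Irreducible p)
    (hπ : algebraMap O K p = π) (x : Kˣ) :
    ∃ (n : ℤ) (v : Oˣ), x = π ^ n * Units.map (algebraMap O K : O →* K) v := by
  obtain ⟨a, b, hb, hx⟩ := IsFractionRing.div_surjective (A := O) (x : K)
  have hb0 : b ≠ 0 := nonZeroDivisors.ne_zero hb
  have ha0 : a ≠ 0 := by
    rintro rfl
    exact x.ne_zero (by simp [← hx])
  obtain ⟨i, v, rfl⟩ := IsDiscreteValuationRing.eq_unit_mul_pow_irreducible ha0 hp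
  obtain ⟨j, w, rfl⟩ := IsDiscreteValuationRing.eq_unit_mul_pow_irreducible hb0 hp
  refine ⟨i - j, v / w, Units.ext ?_⟩
  simp only [map_mul, map_pow, hπ] at hx
  simp only [← hx, map_div, Units.val_mul, Units.val_zpow_eq_zpow_val, ne_eq, Units.ne_zero,
    not_false_eq_true, zpow_sub₀, zpow_natCast, Units.val_div_eq_div_val, Units.coe_map,
    MonoidHom.coe_coe]
  field_simp

variable (O K) in
lemma index_square_sup_range_units :
    (Subgroup.square Kˣ ⊔ (Units.map (algebraMap O K : O →* K)).range).index = 2 := by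
  obtain ⟨p, hp⟩ := IsDiscreteValuationRing.exists_irreducible O
  obtain ⟨π, hπ⟩ : ∃ π : Kˣ, algebraMap O K p = π :=
    ⟨Units.mk0 _ ((map_ne_zero_iff _ (IsFractionRing.injective O K)).2 hp.ne_zero), rfl⟩
  set U := (Units.map (algebraMap O K : O →* K)).range
  have zpow_mem_iff (n : ℤ) : π ^ n ∈ Subgroup.square Kˣ ⊔ U ↔ Even n := by
    refine ⟨fun h => ?_, fun h => Subgroup.mem_sup_left (h.isSquare_zpow π)⟩
    obtain ⟨_, ⟨s, rfl⟩, u, hu, hsu⟩ := Subgroup.mem_sup.1 h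
    obtain ⟨m, v, rfl⟩ := exists_eq_zpow_mul_unit hp hπ s
    have hv : Units.map (algebraMap O K : O →* K) v ∈ U := ⟨v, rfl⟩
    have hnm : π ^ (n - (m + m)) ∈ U := by
      have : π ^ (n - (m + m)) = Units.map (algebraMap O K : O →* K) v *
          Units.map (algebraMap O K : O →* K) v * u := by
        rw [zpow_sub, ← hsu, zpow_add, mul_mul_mul_comm, mul_assoc (π ^ m * π ^ m),
          mul_inv_cancel_comm]
      rw [this]
      exact mul_mem (mul_mem hv hv) hu
    exact ⟨m, sub_eq_zero.1 ((zpow_mem_range_units_iff hp hπ).1 hnm)⟩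
  refine Subgroup.index_eq_two_iff.2 ⟨π, fun x => ?_⟩
  obtain ⟨n, v, rfl⟩ := exists_eq_zpow_mul_unit hp hπ x
  have hv : Units.map (algebraMap O K : O →* K) v ∈ Subgroup.square Kˣ ⊔ U :=
    Subgroup.mem_sup_right ⟨v, rfl⟩
  rw [mul_right_comm, ← zpow_add_one, Subgroup.mul_mem_cancel_right _ hv,
    Subgroup.mul_mem_cancel_right _ hv, zpow_mem_iff, zpow_mem_iff, Int.even_add_one]
  exact xor_not_left.2 Iff.rfl

lemma isSquare_unit_iff_residue {O : Type*} [CommRing O] [IsLocalRing O]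
    [HenselianRing O (IsLocalRing.maximalIdeal O)] (h2 : IsUnit (2 : O)) (v : Oˣ) :
    IsSquare (v : O) ↔ IsSquare (IsLocalRing.residue O v) := by
  refine ⟨fun h => h.map _, ?_⟩
  rintro ⟨r, hr⟩
  obtain ⟨w, rfl⟩ := IsLocalRing.residue_surjective r
  have hw : IsUnit w := by
    rw [← IsLocalRing.residue_ne_zero_iff_isUnit]
    intro h
    exact (IsLocalRing.residue_ne_zero_iff_isUnit _).2 v.isUnit (by rw [hr, h, mul_zero])
  obtain ⟨y, hy, -⟩ := HenselianRing.is_henselian (I := IsLocalRing.maximalIdeal O)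
    (Polynomial.X ^ 2 - Polynomial.C (v : O)) (Polynomial.monic_X_pow_sub_C _ two_ne_zero) w
    (by rw [← IsLocalRing.residue_eq_zero_iff]; simp [hr, pow_two])
    (IsUnit.map _ (by simpa [one_add_one_eq_two] using h2.mul hw))
  exact ⟨y, by simpa [pow_two, sub_eq_zero, eq_comm] using hy⟩

lemma isSquare_map_unit_iff (v : Oˣ) :
    IsSquare (Units.map (algebraMap O K : O →* K) v) ↔ IsSquare (v : O) := by
  rw [isSquare_units_iff]
  refine ⟨?_, fun h => h.map (algebraMap O K)⟩
  rintro ⟨y, hy⟩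
  have hint : IsIntegral O (y ^ 2) := by
    rw [pow_two, ← hy]
    exact isIntegral_algebraMap
  obtain ⟨z, rfl⟩ := IsIntegrallyClosed.isIntegral_iff.1 (hint.of_pow two_pos)
  exact ⟨z, IsFractionRing.injective O K (by simpa using hy)⟩

variable (O K) in
/-- Half of the four square classes come from the parity of the valuation, half from the residue
field, since Hensel's lemma makes a unit a square as soon as its residue is one. -/
theorem index_square_units_of_henselian [HenselianRing O (IsLocalRing.maximalIdeal O)]
    [Finite (IsLocalRing.ResidueField O)] (h2 : IsUnit (2 : O)) :
    (Subgroup.square Kˣ).index = 4 := by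
  have isSquare_iff (v : Oˣ) : Units.map (algebraMap O K : O →* K) v ∈ Subgroup.square Kˣ ↔
      IsSquare (IsLocalRing.residue O v) :=
    (isSquare_map_unit_iff v).trans (isSquare_unit_iff_residue h2 v)
  suffices h : (Subgroup.square Kˣ).relIndex (Units.map (algebraMap O K : O →* K)).range = 2 by
    rw [← Subgroup.relIndex_mul_index (le_sup_left : Subgroup.square Kˣ ≤
      Subgroup.square Kˣ ⊔ (Units.map (algebraMap O K : O →* K)).range),
      index_square_sup_range_units, Subgroup.relIndex_sup_left, h]
  have hchar : ringChar (IsLocalRing.ResidueField O) ≠ 2 := fun h =>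
    (IsLocalRing.residue_ne_zero_iff_isUnit 2).2 h2 (by
      rw [map_ofNat, ← Nat.cast_ofNat, ← h, ringChar.Nat.cast_ringChar])
  obtain ⟨e, he⟩ := FiniteField.exists_nonsquare hchar
  obtain ⟨ε, rfl⟩ := IsLocalRing.residue_surjective e
  have hε : IsUnit ε := (IsLocalRing.residue_ne_zero_iff_isUnit ε).1 fun h => he (h ▸ IsSquare.zero)
  refine Subgroup.relIndex_eq_two_iff.2 ⟨Units.map _ hε.unit, ⟨_, rfl⟩, ?_⟩
  rintro _ ⟨v, rfl⟩
  rw [← map_mul, isSquare_iff, isSquare_iff, Units.val_mul, map_mul, IsUnit.unit_spec,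
    isSquare_mul_iff_not_isSquare he ((IsLocalRing.residue_ne_zero_iff_isUnit _).2 v.isUnit)]
  exact xor_not_left.2 Iff.rfl

end FractionField

section LocalField

lemma isNonarchimedeanLocalField_of_properSpace (K : Type*) [NontriviallyNormedField K]
    [IsUltrametricDist K] [ProperSpace K] :
    letI := ValuativeRel.ofValuation (NormedField.valuation (K := K))
    IsNonarchimedeanLocalField K := by
  let := ValuativeRel.ofValuation (NormedField.valuation (K := K))
  have := Valuation.Compatible.ofValuation (NormedField.valuation (K := K))
  have valuation_lt_iff (x y : K) :
      ValuativeRel.valuation K x < ValuativeRel.valuation K y ↔ ‖x‖ < ‖y‖ :=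
    (ValuativeRel.isEquiv _ (NormedField.valuation (K := K))).lt_iff_lt
  have : IsValuativeTopology K := by
    refine .of_zero fun s => ⟨fun hs => ?_, ?_⟩
    · obtain ⟨ε, hε, hs⟩ := Metric.mem_nhds_iff.1 hs
      obtain ⟨x, hx0, hxε⟩ := NormedField.exists_norm_lt K hε
      refine ⟨Units.mk0 (ValuativeRel.valuation K x) (by simpa using hx0), fun z hz => hs ?_⟩
      exact mem_ball_zero_iff.2 (((valuation_lt_iff z x).1 hz).trans hxε)
    · rintro ⟨γ, hs⟩
      obtain ⟨x, hx⟩ := ValuativeRel.valuation_surjective (γ : ValuativeRel.ValueGroupWithZero K)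
      have hx0 : x ≠ 0 := by
        rintro rfl
        exact γ.ne_zero (by rw [← hx, map_zero])
      refine Filter.mem_of_superset (Metric.ball_mem_nhds 0 (norm_pos_iff.2 hx0)) fun z hz => hs ?_
      rw [mem_ball_zero_iff, ← valuation_lt_iff, hx] at hz
      exact hz
  have : ValuativeRel.IsNontrivial K := by
    obtain ⟨x, hx⟩ := NormedField.exists_one_lt_norm K
    have hx1 : 1 < NormedField.valuation x := hx
    exact (ValuativeRel.isNontrivial_iff_isNontrivial (NormedField.valuation (K := K))).2
      ⟨x, (zero_lt_one.trans hx1).ne', hx1.ne'⟩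
  exact {}

theorem index_square_units_of_isUnit_two (K : Type*) [Field K] [ValuativeRel K]
    [TopologicalSpace K] [IsNonarchimedeanLocalField K] (h2 : IsUnit (2 : 𝒪[K])) :
    (Subgroup.square Kˣ).index = 4 := by
  let := IsTopologicalAddGroup.rightUniformSpace K
  have := isUniformAddGroup_of_addCommGroup (G := K)
  exact index_square_units_of_henselian 𝒪[K] K h2

theorem index_square_units_of_norm_two (K : Type*) [NontriviallyNormedField K]
    [IsUltrametricDist K] [ProperSpace K] (h2 : ‖(2 : K)‖ = 1) :
    (Subgroup.square Kˣ).index = 4 := by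
  let := ValuativeRel.ofValuation (NormedField.valuation (K := K))
  have := Valuation.Compatible.ofValuation (NormedField.valuation (K := K))
  have := isNonarchimedeanLocalField_of_properSpace K
  refine index_square_units_of_isUnit_two K ?_
  refine (Valuation.integer.integers (ValuativeRel.valuation K)).isUnit_iff_valuation_eq_one.2 ?_
  exact (Valuation.isEquiv_iff_val_eq_one.1
    (ValuativeRel.isEquiv _ (NormedField.valuation (K := K)))).2 (NNReal.eq h2)

variable (F : Type*) [Field F] [ValuativeRel F] [TopologicalSpace F] [IsNonarchimedeanLocalField F]

variable {F} in
lemma isUnit_two_of_ringChar_residueField_ne_two (hp : ringChar 𝓀[F] ≠ 2) : IsUnit (2 : 𝒪[F]) := by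
  by_contra h
  have h0 : ((2 : ℕ) : 𝓀[F]) = 0 := by
    rw [← map_natCast (IsLocalRing.residue 𝒪[F]), IsLocalRing.residue_eq_zero_iff]
    exact_mod_cast h
  exact ((Nat.dvd_prime Nat.prime_two).1 (ringChar.dvd h0)).elim CharP.ringChar_ne_one hp

variable {F} in
lemma two_ne_zero_of_ringChar_residueField_ne_two (hp : ringChar 𝓀[F] ≠ 2) : (2 : F) ≠ 0 :=
  fun h => (isUnit_two_of_ringChar_residueField_ne_two hp).ne_zero (Subtype.ext h)

theorem index_square_units_of_finiteDimensional (hp : ringChar 𝓀[F] ≠ 2) (K : Type*) [Field K]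
    [Algebra F K] [FiniteDimensional F K] : (Subgroup.square Kˣ).index = 4 := by
  let := IsTopologicalAddGroup.rightUniformSpace F
  have := isUniformAddGroup_of_addCommGroup (G := F)
  let : (Valued.v (R := F)).RankOne :=
    { hom' := ValuativeRel.IsRankLeOne.nonempty.some.emb (R := F).comp
        MonoidWithZeroHom.ValueGroup₀.embedding
      strictMono' := ValuativeRel.IsRankLeOne.nonempty.some.strictMono.comp
        MonoidWithZeroHom.ValueGroup₀.embedding_strictMono }
  let := Valued.toNontriviallyNormedField (L := F) (Γ₀ := ValuativeRel.ValueGroupWithZero F)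
  have : IsUltrametricDist F := inferInstance
  have : ProperSpace F := .of_nontriviallyNormedField_of_weaklyLocallyCompactSpace F
  let := spectralNorm.nontriviallyNormedField F K
  let := spectralNorm.normedAlgebra F K
  have : IsUltrametricDist K :=
    IsUltrametricDist.isUltrametricDist_of_isNonarchimedean_norm
      (isNonarchimedean_spectralNorm (K := F) (L := K))
  have : ProperSpace K := FiniteDimensional.proper F K
  have valuation_two : (Valued.v : Valuation F (ValuativeRel.ValueGroupWithZero F)) 2 = 1 :=
    (Valuation.integer.integers (ValuativeRel.valuation F)).isUnit_iff_valuation_eq_one.1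
      (isUnit_two_of_ringChar_residueField_ne_two hp)
  have norm_two : ‖(2 : F)‖ = 1 :=
    le_antisymm (Valued.toNormedField.norm_le_one_iff.2 valuation_two.le)
      (Valued.toNormedField.one_le_norm_iff.2 valuation_two.ge)
  refine index_square_units_of_norm_two K ?_
  rw [← map_ofNat (algebraMap F K) 2]
  exact (spectralNorm_extends _).trans norm_two

end LocalField

end SquareClasses

/-! ### Two-torsion and squares -/

section TwoTorsion

/-- The number of elements of order at most two, where an infinite set of them counts as `0`. -/
noncomputable abbrev twoTorsionCard (G : Type*) [Group G] : ℕ := Nat.card {g : G // g ^ 2 = 1}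

lemma twoTorsionCard_congr {G H : Type*} [Group G] [Group H] (e : G ≃* H) :
    twoTorsionCard G = twoTorsionCard H :=
  Nat.card_congr (e.toEquiv.subtypeEquiv fun g => by
    change _ ↔ e g ^ 2 = 1
    rw [← map_pow, map_eq_one_iff e e.injective])

lemma twoTorsionCard_prod (G H : Type*) [Group G] [Group H] :
    twoTorsionCard (G × H) = twoTorsionCard G * twoTorsionCard H := by
  rw [← Nat.card_prod]
  exact Nat.card_congr
    { toFun := fun g => (⟨g.1.1, congrArg Prod.fst g.2⟩, ⟨g.1.2, congrArg Prod.snd g.2⟩)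
      invFun := fun g => ⟨(g.1.1, g.2.1), Prod.ext g.1.2 g.2.2⟩
      left_inv := fun _ => rfl
      right_inv := fun _ => rfl }

lemma twoTorsionCard_pi {ι : Type*} [Fintype ι] (G : ι → Type*) [∀ i, Group (G i)] :
    twoTorsionCard (∀ i, G i) = ∏ i, twoTorsionCard (G i) := by
  rw [← Nat.card_pi]
  exact Nat.card_congr
    { toFun := fun g i => ⟨g.1 i, congrFun g.2 i⟩
      invFun := fun g => ⟨fun i => (g i).1, funext fun i => (g i).2⟩
      left_inv := fun _ => rfl
      right_inv := fun _ => rfl }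

lemma twoTorsionCard_units_of_isDomain (R : Type*) [CommRing R] [IsDomain R]
    (h2 : (2 : R) ≠ 0) : twoTorsionCard Rˣ = 2 := by
  have one_ne_neg_one : (1 : Rˣ) ≠ -1 := fun h => h2 <| by
    have : (1 : R) = -1 := congrArg Units.val h
    linear_combination this
  have sq_eq_one_set : {g : Rˣ | g ^ 2 = 1} = {1, -1} := by
    ext g
    refine ⟨fun h => ?_, by rintro (rfl | rfl) <;> simp⟩
    have h' : (g : R) ^ 2 = 1 := congrArg Units.val h
    exact (sq_eq_one_iff.1 h').imp Units.ext Units.ext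
  rw [twoTorsionCard, ← Set.coe_ofPred, sq_eq_one_set, Nat.card_coe_set_eq,
    Set.ncard_pair one_ne_neg_one]

lemma index_square_congr {G H : Type*} [CommGroup G] [CommGroup H] (e : G ≃* H) :
    (Subgroup.square G).index = (Subgroup.square H).index := by
  have square_eq : Subgroup.square G = (Subgroup.square H).comap (e : G →* H) := by
    ext x
    exact ⟨fun h => h.map e, fun h => by simpa using h.map e.symm⟩
  rw [square_eq, Subgroup.index_comap_of_surjective _ e.surjective]

lemma index_square_pi {ι : Type*} [Fintype ι] (G : ι → Type*) [∀ i, CommGroup (G i)] :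
    (Subgroup.square (∀ i, G i)).index = ∏ i, (Subgroup.square (G i)).index := by
  let f : (∀ i, G i) →* ∀ i, G i ⧸ Subgroup.square (G i) :=
    MonoidHom.pi fun i => (QuotientGroup.mk' _).comp (Pi.evalMonoidHom G i)
  have hf : Function.Surjective f := fun y => by
    choose x hx using fun i => QuotientGroup.mk'_surjective (Subgroup.square (G i)) (y i)
    exact ⟨x, funext hx⟩
  have hker : f.ker = Subgroup.square (∀ i, G i) := by
    ext x
    rw [MonoidHom.mem_ker, funext_iff]
    refine (forall_congr' fun i => QuotientGroup.eq_one_iff (x i)).trans ⟨fun h => ?_, ?_⟩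
    · choose y hy using h
      exact ⟨y, funext hy⟩
    · rintro ⟨y, rfl⟩ i
      exact ⟨y i, rfl⟩
  rw [← hker, Subgroup.index_ker, MonoidHom.range_eq_top.2 hf, Subgroup.card_top, Nat.card_pi]
  rfl

theorem index_square_units_of_isReduced (F : Type*) [Field F] [ValuativeRel F]
    [TopologicalSpace F] [IsNonarchimedeanLocalField F] (hp : ringChar 𝓀[F] ≠ 2)
    (L : Type*) [CommRing L] [Algebra F L] [FiniteDimensional F L] [IsReduced L] :
    (Subgroup.square Lˣ).index = twoTorsionCard Lˣ ^ 2 := by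
  have : IsArtinianRing L := IsArtinianRing.of_finite F L
  let := Fintype.ofFinite (MaximalSpectrum L)
  let e : Lˣ ≃* ∀ I : MaximalSpectrum L, (L ⧸ I.asIdeal)ˣ :=
    (Units.mapEquiv (IsArtinianRing.equivPi L : L ≃* _)).trans MulEquiv.piUnits
  rw [index_square_congr e, index_square_pi, twoTorsionCard_congr e, twoTorsionCard_pi,
    ← Finset.prod_pow]
  refine Finset.prod_congr rfl fun I _ => ?_
  let := Ideal.Quotient.field I.asIdeal
  have h2 : (2 : L ⧸ I.asIdeal) ≠ 0 := by
    rw [← map_ofNat (algebraMap F (L ⧸ I.asIdeal)) 2]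
    exact (map_ne_zero _).2 (two_ne_zero_of_ringChar_residueField_ne_two hp)
  rw [twoTorsionCard_units_of_isDomain _ h2]
  exact index_square_units_of_finiteDimensional F hp (L ⧸ I.asIdeal)

/-- Such a `Q` is an `𝔽₂`-vector space. -/
lemma nonempty_mulEquiv_of_sq_eq_one {Q : Type*} [CommGroup Q] (h : ∀ x : Q, x ^ 2 = 1) (k : ℕ)
    (hk : Nat.card Q = 2 ^ k) : Nonempty (Q ≃* Multiplicative (Fin k → ZMod 2)) := by
  let : Module (ZMod 2) (Additive Q) := AddCommGroup.zmodModule fun x => h x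
  have : Finite Q := Nat.finite_of_card_ne_zero (by rw [hk]; positivity)
  have : Module.Finite (ZMod 2) (Additive Q) := Module.Finite.of_finite
  have finrank_eq : Module.finrank (ZMod 2) (Additive Q) = k := by
    have card_eq := Module.natCard_eq_pow_finrank (K := ZMod 2) (V := Additive Q)
    rw [Nat.card_zmod] at card_eq
    exact Nat.pow_right_injective le_rfl (card_eq.symm.trans hk)
  let e := (Module.finBasisOfFinrankEq (ZMod 2) (Additive Q) finrank_eq).equivFun
  exact ⟨(MulEquiv.toAdditiveLeft).symm e.toAddEquiv⟩

lemma relIndex_map_powMonoidHom_two_range {G A : Type*} [CommGroup G] [CommGroup A] {j : G →* A}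
    (hj : Function.Injective j) :
    (j.range.map (powMonoidHom 2)).relIndex j.range = (Subgroup.square G).index := by
  have comap_eq : (j.range.map (powMonoidHom 2)).comap j = Subgroup.square G := by
    ext x
    simp [isSquare_iff_exists_sq, ← map_pow, hj.eq_iff, eq_comm]
  rw [← comap_eq, Subgroup.index_comap]

end TwoTorsion

/-! ### Galois cohomology of the two-torsion of a torus -/

section ConnectingMap

variable {Γ A M : Type*} [Group Γ] [CommGroup A] [MulDistribMulAction Γ A]

variable (Γ) in
/-- The preimage in `A` of the `Γ`-invariants of `A ⧸ B`, the source of the connecting map to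
`H¹(Γ, B)`. -/
def invariantsMod (B : Subgroup A) : Subgroup A where
  carrier := {b | ∀ s : Γ, b * (s • b)⁻¹ ∈ B}
  mul_mem' {a b} ha hb s := by
    rw [smul_mul', mul_inv, mul_mul_mul_comm]
    exact mul_mem (ha s) (hb s)
  one_mem' s := by simp
  inv_mem' {a} ha s := by
    rw [smul_inv', ← mul_inv]
    exact inv_mem (ha s)

variable [TopologicalSpace Γ] [Group M] [MulDistribMulAction Γ M]

lemma Cocycle.ext {a b : Cocycle Γ M} (h : a.toFun = b.toFun) : a = b := by
  cases a; cases b; congr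

variable {ι : M →* A} (hι : Function.Injective ι) (hsmul : ∀ (s : Γ) m, ι (s • m) = s • ι m)

include hι hsmul

lemma exists_cocycle_of_mem_invariantsMod (hcont : ∀ b : A, IsLocallyConstant fun s : Γ => s • b)
    {b : A} (hb : b ∈ invariantsMod Γ ι.range) :
    ∃ a : Cocycle Γ M, ∀ s, ι (a.toFun s) = b * (s • b)⁻¹ := by
  choose f hf using hb
  refine ⟨⟨f, ?_, fun s t => hι ?_⟩, hf⟩
  · have hconst : IsLocallyConstant (ι ∘ f) := by
      rw [show ι ∘ f = fun s => b * (s • b)⁻¹ from funext hf]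
      exact (hcont b).comp fun x => b * x⁻¹
    exact IsLocallyConstant.desc f ι hconst hι
  · rw [map_mul, hf, hsmul, hf, hf, smul_mul', smul_inv', ← mul_smul, mul_assoc,
      inv_mul_cancel_left]

lemma cohomologous_iff_mem_sup_fixedPoints {a a' : Cocycle Γ M} {b b' : A}
    (ha : ∀ s, ι (a.toFun s) = b * (s • b)⁻¹) (ha' : ∀ s, ι (a'.toFun s) = b' * (s • b')⁻¹) :
    cohomologous Γ M a a' ↔ b⁻¹ * b' ∈ ι.range ⊔ FixedPoints.subgroup Γ A := by
  have coboundary_iff (g : M) : (∀ s, a'.toFun s = g⁻¹ * a.toFun s * s • g) ↔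
      ι g * (b⁻¹ * b') ∈ FixedPoints.subgroup Γ A := by
    refine forall_congr' fun s => ?_
    rw [← hι.eq_iff, map_mul, map_mul, map_inv, ha, ha', hsmul, smul_mul', smul_mul', smul_inv']
    generalize s • b = u, s • b' = v, s • ι g = w
    rw [eq_comm, ← div_eq_one, ← div_eq_one (a := w * _)]
    simp only [div_eq_mul_inv, mul_inv, inv_inv, mul_comm, mul_left_comm, mul_assoc]
  rw [Subgroup.mem_sup]
  constructor
  · rintro ⟨g, hg⟩
    exact ⟨ι g⁻¹, ⟨_, rfl⟩, _, (coboundary_iff g).1 hg, by rw [map_inv, inv_mul_cancel_left]⟩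
  · rintro ⟨_, ⟨g, rfl⟩, x, hx, hgx⟩
    exact ⟨g⁻¹, (coboundary_iff g⁻¹).2 (by rwa [← hgx, map_inv, inv_mul_cancel_left])⟩

theorem nonempty_quotient_mulEquiv_H1 [IsMulCommutative M]
    (hcont : ∀ b : A, IsLocallyConstant fun s : Γ => s • b)
    (hcoboundary : ∀ a : Cocycle Γ M, ∃ b : A, ∀ s, ι (a.toFun s) = b * (s • b)⁻¹) :
    Nonempty (invariantsMod Γ ι.range ⧸
      (ι.range ⊔ FixedPoints.subgroup Γ A).subgroupOf (invariantsMod Γ ι.range) ≃* H1 Γ M) := by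
  choose a ha using fun b : invariantsMod Γ ι.range =>
    exists_cocycle_of_mem_invariantsMod hι hsmul hcont b.2
  have cohomologous_iff (b b' : invariantsMod Γ ι.range) :=
    cohomologous_iff_mem_sup_fixedPoints hι hsmul (ha b) (ha b')
  let δ : invariantsMod Γ ι.range ⧸
      (ι.range ⊔ FixedPoints.subgroup Γ A).subgroupOf (invariantsMod Γ ι.range) → H1 Γ M :=
    Quotient.lift (fun b => Quotient.mk (cohomologous Γ M) (a b)) fun b b' h =>
      Quotient.sound ((cohomologous_iff b b').2 (Subgroup.mem_subgroupOf.1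
        (QuotientGroup.leftRel_apply.1 h)))
  have injective : Function.Injective δ := by
    rintro ⟨b⟩ ⟨b'⟩ h
    exact Quotient.sound
      (QuotientGroup.leftRel_apply.2 ((cohomologous_iff b b').1 (Quotient.exact h)))
  have surjective : Function.Surjective δ := by
    rintro ⟨c⟩
    obtain ⟨b, hb⟩ := hcoboundary c
    refine ⟨Quotient.mk _ ⟨b, fun s => ⟨_, hb s⟩⟩, congrArg (Quotient.mk _) (Cocycle.ext ?_)⟩
    exact funext fun s => hι (by rw [ha, hb])
  have map_mul (x y) : δ (x * y) = δ x * δ y := by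
    obtain ⟨x⟩ := x
    obtain ⟨y⟩ := y
    refine congrArg (Quotient.mk (cohomologous Γ M)) (Cocycle.ext (funext fun s => hι ?_))
    rw [map_mul, ha, ha, ha, Subgroup.coe_mul, smul_mul', mul_inv, mul_mul_mul_comm]
  exact ⟨MulEquiv.ofBijective (⟨δ, map_mul⟩ : _ →ₙ* H1 Γ M) ⟨injective, surjective⟩⟩

end ConnectingMap

section TwoTorsionCohomology

variable {Γ A D : Type*} [Group Γ] [CommGroup A] [MulDistribMulAction Γ A]
  [CommGroup D] [MulDistribMulAction Γ D]

/-- The kernel of `d` on the two-torsion of `A`. -/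
def twoTorsionKer (d : A →* D) : Subgroup A := (powMonoidHom 2).ker ⊓ d.ker

variable {d : A →* D}

lemma mem_twoTorsionKer {x : A} : x ∈ twoTorsionKer d ↔ x ^ 2 = 1 ∧ d x = 1 := Iff.rfl

lemma mem_invariantsMod_twoTorsionKer_iff (hsmul : ∀ (s : Γ) x, d (s • x) = s • d x) {z : A} :
    z ∈ invariantsMod Γ (twoTorsionKer d) ↔
      z ^ 2 ∈ FixedPoints.subgroup Γ A ∧ d z ∈ FixedPoints.subgroup Γ D := by
  refine (forall_congr' fun s => ?_).trans forall_and
  rw [mem_twoTorsionKer, mul_pow, inv_pow, mul_inv_eq_one, map_mul, map_inv, mul_inv_eq_one,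
    smul_pow', hsmul, eq_comm, eq_comm (a := d z)]

lemma map_invariantsMod_twoTorsionKer (hsmul : ∀ (s : Γ) x, d (s • x) = s • d x)
    (hsqrt : ∀ x : A, ∃ y, y ^ 2 = x) {e : A} (he : e ^ 2 = 1)
    (hd2 : ∀ x : D, x ^ 2 = 1 → x = 1 ∨ x = d e) :
    (invariantsMod Γ (twoTorsionKer d)).map (powMonoidHom 2) =
      FixedPoints.subgroup Γ A ⊓ ((FixedPoints.subgroup Γ D).map (powMonoidHom 2)).comap d := by
  refine le_antisymm ?_ ?_
  · rintro _ ⟨z, hz, rfl⟩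
    have hz' := (mem_invariantsMod_twoTorsionKer_iff hsmul).1 hz
    exact ⟨hz'.1, d z, hz'.2, (map_pow d z 2).symm⟩
  · rintro a ⟨ha, f, hf, hfa⟩
    obtain ⟨y, rfl⟩ := hsqrt a
    suffices ∃ z, z ^ 2 = y ^ 2 ∧ d z = f by
      obtain ⟨z, hzy, rfl⟩ := this
      exact ⟨z, (mem_invariantsMod_twoTorsionKer_iff hsmul).2 ⟨hzy ▸ ha, hf⟩, hzy⟩
    have hsq : (f⁻¹ * d y) ^ 2 = 1 := by
      rw [mul_pow, inv_pow, ← map_pow, ← hfa, powMonoidHom_apply, inv_mul_cancel]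
    rcases hd2 _ hsq with h | h
    · exact ⟨y, rfl, (inv_mul_eq_one.1 h).symm⟩
    · refine ⟨y * e⁻¹, by rw [mul_pow, inv_pow, he, inv_one, mul_one], ?_⟩
      rw [map_mul, map_inv, ← h, mul_inv_rev, inv_inv, mul_inv_cancel_left]

omit [MulDistribMulAction Γ D] in
lemma ker_powMonoidHom_two_le {e : A} (he : e ∈ FixedPoints.subgroup Γ A) (he2 : e ^ 2 = 1)
    (hd2 : ∀ x : D, x ^ 2 = 1 → x = 1 ∨ x = d e) :
    (powMonoidHom 2 : A →* A).ker ≤ twoTorsionKer d ⊔ FixedPoints.subgroup Γ A := fun x hx => by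
  have hx2 : x ^ 2 = 1 := hx
  rcases hd2 (d x) (by rw [← map_pow, hx2, map_one]) with h | h
  · exact Subgroup.mem_sup_left ⟨hx, h⟩
  · refine Subgroup.mem_sup.2 ⟨x * e⁻¹, ?_, e, he, inv_mul_cancel_right _ _⟩
    rw [mem_twoTorsionKer, mul_pow, inv_pow, hx2, he2, map_mul, map_inv, h]
    simp only [inv_one, mul_one, mul_inv_cancel, and_self]

theorem relIndex_invariantsMod_twoTorsionKer_mul (hsmul : ∀ (s : Γ) x, d (s • x) = s • d x)
    (hsqrt : ∀ x : A, ∃ y, y ^ 2 = x)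
    {e : A} (he : e ∈ FixedPoints.subgroup Γ A) (he2 : e ^ 2 = 1)
    (hd2 : ∀ x : D, x ^ 2 = 1 → x = 1 ∨ x = d e)
    (hd : FixedPoints.subgroup Γ D ≤ (FixedPoints.subgroup Γ A).map d ⊔
      (FixedPoints.subgroup Γ D).map (powMonoidHom 2)) :
    (twoTorsionKer d ⊔ FixedPoints.subgroup Γ A).relIndex (invariantsMod Γ (twoTorsionKer d)) *
        ((FixedPoints.subgroup Γ D).map (powMonoidHom 2)).relIndex (FixedPoints.subgroup Γ D) =
      ((FixedPoints.subgroup Γ A).map (powMonoidHom 2)).relIndex (FixedPoints.subgroup Γ A) := by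
  set AΓ := FixedPoints.subgroup Γ A
  set DΓ := FixedPoints.subgroup Γ D
  let W := AΓ ⊓ (DΓ.map (powMonoidHom 2)).comap d
  have hfixed : AΓ.map d ≤ DΓ := by
    rintro _ ⟨x, hx, rfl⟩ s
    rw [← hsmul, hx s]
  have le_invariantsMod : twoTorsionKer d ⊔ AΓ ≤ invariantsMod Γ (twoTorsionKer d) := by
    refine sup_le (fun x hx => ?_) fun x hx => ?_
    · rw [mem_invariantsMod_twoTorsionKer_iff hsmul, (mem_twoTorsionKer.1 hx).1,
        (mem_twoTorsionKer.1 hx).2]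
      exact ⟨one_mem _, one_mem _⟩
    · exact (mem_invariantsMod_twoTorsionKer_iff hsmul).2 ⟨pow_mem hx 2, hfixed ⟨x, hx, rfl⟩⟩
  have relIndex_Z : (twoTorsionKer d ⊔ AΓ).relIndex (invariantsMod Γ (twoTorsionKer d)) =
      (AΓ.map (powMonoidHom 2)).relIndex W := by
    have ker_le : _ ≤ twoTorsionKer d ⊔ AΓ := ker_powMonoidHom_two_le he he2 hd2
    have map_torsion : (twoTorsionKer d).map (powMonoidHom 2) = ⊥ :=
      (Subgroup.map_eq_bot_iff _).2 inf_le_left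
    rw [← bot_sup_eq (AΓ.map (powMonoidHom 2)), ← map_torsion, ← Subgroup.map_sup,
      show W = _ from (map_invariantsMod_twoTorsionKer hsmul hsqrt he2 hd2).symm,
      Subgroup.relIndex_map_map, sup_eq_left.2 ker_le,
      sup_eq_left.2 (ker_le.trans le_invariantsMod)]
  have relIndex_W : W.relIndex AΓ = (DΓ.map (powMonoidHom 2)).relIndex DΓ := by
    have sup_eq : AΓ.map d ⊔ DΓ.map (powMonoidHom 2) = DΓ := by
      refine le_antisymm (sup_le hfixed ?_) hd
      rintro _ ⟨x, hx, rfl⟩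
      exact pow_mem hx 2
    rw [Subgroup.inf_relIndex_left, Subgroup.relIndex_comap, ← Subgroup.relIndex_sup_right, sup_eq]
  rw [relIndex_Z, ← relIndex_W]
  refine Subgroup.relIndex_mul_relIndex _ _ _ ?_ inf_le_left
  rintro _ ⟨x, hx, rfl⟩
  exact ⟨pow_mem hx 2, d x, hfixed ⟨x, hx, rfl⟩, (map_pow d x 2).symm⟩

variable [TopologicalSpace Γ] {M : Type*} [Group M] [MulDistribMulAction Γ M] {ι : M →* A}

theorem h1IsElementaryTwo_of_range_eq_twoTorsionKer (hι : Function.Injective ι)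
    (hrange : ι.range = twoTorsionKer d) (hιsmul : ∀ (s : Γ) m, ι (s • m) = s • ι m)
    (hcont : ∀ b : A, IsLocallyConstant fun s : Γ => s • b)
    (hcoboundary : ∀ a : Cocycle Γ M, ∃ b : A, ∀ s, ι (a.toFun s) = b * (s • b)⁻¹)
    (hsmul : ∀ (s : Γ) x, d (s • x) = s • d x) (hsqrt : ∀ x : A, ∃ y, y ^ 2 = x)
    {e : A} (he : e ∈ FixedPoints.subgroup Γ A) (he2 : e ^ 2 = 1)
    (hd2 : ∀ x : D, x ^ 2 = 1 → x = 1 ∨ x = d e)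
    (hd : FixedPoints.subgroup Γ D ≤ (FixedPoints.subgroup Γ A).map d ⊔
      (FixedPoints.subgroup Γ D).map (powMonoidHom 2)) {n k : ℕ} (hn : n ≠ 0)
    (hD : ((FixedPoints.subgroup Γ D).map (powMonoidHom 2)).relIndex
      (FixedPoints.subgroup Γ D) = n)
    (hA : ((FixedPoints.subgroup Γ A).map (powMonoidHom 2)).relIndex
      (FixedPoints.subgroup Γ A) = 2 ^ k * n) :
    H1IsElementaryTwo Γ M k := by
  have commutative : IsMulCommutative M :=
    ⟨⟨fun a b => hι (by rw [map_mul, map_mul, mul_comm])⟩⟩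
  obtain ⟨φ⟩ := nonempty_quotient_mulEquiv_H1 hι hιsmul hcont hcoboundary
  rw [hrange] at φ
  have card_eq := relIndex_invariantsMod_twoTorsionKer_mul hsmul hsqrt he he2 hd2 hd
  rw [hD, hA] at card_eq
  refine (nonempty_mulEquiv_of_sq_eq_one ?_ k (Nat.eq_of_mul_eq_mul_right
    (Nat.pos_of_ne_zero hn) card_eq)).elim fun ψ => ⟨commutative, ⟨φ.symm.trans ψ⟩⟩
  rintro ⟨z⟩
  exact (QuotientGroup.eq_one_iff (z ^ 2)).2
    (Subgroup.mem_sup_right ((mem_invariantsMod_twoTorsionKer_iff hsmul).1 z.2).1)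

end TwoTorsionCohomology

/-! ### Eigenframes -/

section Eigenframe

variable {n A : Type*} [Fintype n] [DecidableEq n] [CommRing A]

/-- The algebra homomorphism `d ↦ P diag(d) P⁻¹`, whose image consists of the matrices that are
diagonal in the basis given by the columns of `P`. -/
def conjDiagonal (P : GL n A) : (n → A) →ₐ[A] Matrix n n A :=
  (MulSemiringAction.toAlgHom A (Matrix n n A) (ConjAct.toConjAct P)).comp
    (Matrix.diagonalAlgHom A)

lemma conjDiagonal_apply (P : GL n A) (d : n → A) :
    conjDiagonal P d = P.val * Matrix.diagonal d * (P⁻¹).val := rfl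

lemma mul_eq_mul_diagonal_iff {P : GL n A} {M : Matrix n n A} {d : n → A} :
    M * P.val = P.val * Matrix.diagonal d ↔ M = conjDiagonal P d :=
  (Units.eq_mul_inv_iff_mul_eq P).symm

lemma conjDiagonal_injective (P : GL n A) : Function.Injective (conjDiagonal P) := fun _ _ h =>
  Matrix.diagonal_injective (MulAction.injective (ConjAct.toConjAct P) h)

lemma charpoly_conjDiagonal (P : GL n A) (d : n → A) :
    (conjDiagonal P d).charpoly = ∏ i, (Polynomial.X - Polynomial.C (d i)) := by
  rw [conjDiagonal_apply, Matrix.coe_units_inv, Matrix.charpoly_units_conj,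
    Matrix.charpoly_diagonal]

lemma isUnit_conjDiagonal_iff {P : GL n A} {d : n → A} : IsUnit (conjDiagonal P d) ↔ IsUnit d := by
  rw [conjDiagonal_apply, Units.isUnit_mul_units, Units.isUnit_units_mul, Matrix.isUnit_diagonal]

lemma exists_eq_diagonal_of_commute [IsDomain A] {t : n → A} (ht : Function.Injective t)
    {M : Matrix n n A} (hM : Commute M (Matrix.diagonal t)) : ∃ d, M = Matrix.diagonal d := by
  refine ⟨M.diag, (Matrix.IsDiag.diagonal_diag fun i j hij => ?_).symm⟩
  have entry : M i j * t j = t i * M i j := by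
    rw [← Matrix.mul_diagonal, hM.eq, Matrix.diagonal_mul]
  exact (mul_eq_zero.1 (by linear_combination entry : (t j - t i) * M i j = 0)).resolve_left
    (sub_ne_zero.2 (ht.ne hij.symm))

/-- The columns of `P` form a basis of eigenvectors of `τ`, with the distinct eigenvalues `t`. -/
structure IsEigenframe (τ : Matrix n n A) (P : GL n A) (t : n → A) : Prop where
  injective : Function.Injective t
  conjDiagonal_eq : conjDiagonal P t = τ

namespace IsEigenframe

variable [IsDomain A] {τ : Matrix n n A} {P : GL n A} {t : n → A}

lemma exists_conjDiagonal_eq (h : IsEigenframe τ P t) {M : Matrix n n A} (hM : Commute M τ) :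
    ∃ d, conjDiagonal P d = M := by
  have diagonal_eq : (P⁻¹).val * τ * P.val = Matrix.diagonal t := by
    rw [mul_assoc, mul_eq_mul_diagonal_iff.2 h.conjDiagonal_eq.symm, Units.inv_mul_cancel_left]
  obtain ⟨d, hd⟩ := exists_eq_diagonal_of_commute h.injective
    (M := (P⁻¹).val * M * P.val) (by
      rw [← diagonal_eq]
      simp only [Commute, SemiconjBy, mul_assoc, Units.mul_inv_cancel_left]
      rw [← mul_assoc M, hM.eq, mul_assoc])
  exact ⟨d, (mul_eq_mul_diagonal_iff.1 (by rw [← hd, mul_assoc, Units.mul_inv_cancel_left])).symm⟩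

omit [IsDomain A] in
lemma commute_conjDiagonal (h : IsEigenframe τ P t) (d : n → A) : Commute (conjDiagonal P d) τ :=
  h.conjDiagonal_eq ▸ (Commute.all d t).map (conjDiagonal P)

lemma commute (h : IsEigenframe τ P t) {M N : Matrix n n A} (hM : Commute M τ)
    (hN : Commute N τ) : Commute M N := by
  obtain ⟨d, rfl⟩ := h.exists_conjDiagonal_eq hM
  obtain ⟨e, rfl⟩ := h.exists_conjDiagonal_eq hN
  exact (Commute.all d e).map (conjDiagonal P)

end IsEigenframe

lemma isSymm_mul_conjDiagonal {S : Matrix n n A} {P : GL n A} (hP : P.valᵀ * S * P.val = 1)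
    (d : n → A) : (S * conjDiagonal P d).IsSymm := by
  have eq_transpose_mul : S * P.val = ((P⁻¹).val)ᵀ := by
    have transpose_inv_mul : ((P⁻¹).val)ᵀ * P.valᵀ = 1 := by
      rw [← Matrix.transpose_mul, Units.mul_inv, Matrix.transpose_one]
    rw [← mul_one ((P⁻¹).val)ᵀ, ← hP, mul_assoc, ← mul_assoc, transpose_inv_mul, one_mul]
  rw [Matrix.IsSymm, conjDiagonal_apply, ← mul_assoc, ← mul_assoc, eq_transpose_mul]
  simp only [Matrix.transpose_mul, Matrix.transpose_transpose, Matrix.diagonal_transpose, mul_assoc]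

section Field

variable {k : Type*} [Field k] {τ S : Matrix n n k} {P : GL n k} {t : n → k}

theorem exists_isEigenframe (ht : Function.Injective t)
    (hχ : τ.charpoly = ∏ i, (Polynomial.X - Polynomial.C (t i))) :
    ∃ P, IsEigenframe τ P t := by
  have exists_eigenvector (i : n) : ∃ v : n → k, v ≠ 0 ∧ τ *ᵥ v = t i • v := by
    obtain ⟨v, hv0, hv⟩ := Matrix.exists_mulVec_eq_zero_iff.2
      (show (Matrix.scalar n (t i) - τ).det = 0 by
        rw [← Matrix.eval_charpoly, hχ, Polynomial.eval_prod]
        exact Finset.prod_eq_zero (Finset.mem_univ i) (by simp))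
    refine ⟨v, hv0, ?_⟩
    rw [Matrix.sub_mulVec, sub_eq_zero] at hv
    rw [← hv]
    ext j
    simp [Matrix.mulVec_diagonal]
  choose v hv0 hv using exists_eigenvector
  obtain ⟨P, hP⟩ : IsUnit (Matrix.of v)ᵀ := by
    rw [← Matrix.linearIndependent_cols_iff_isUnit]
    refine Module.End.eigenvectors_linearIndependent' (Matrix.toLin' τ) t ht v fun i => ?_
    rw [Module.End.hasEigenvector_iff, Module.End.mem_eigenspace_iff]
    exact ⟨by rw [Matrix.toLin'_apply, hv], hv0 i⟩
  refine ⟨P, ht, (mul_eq_mul_diagonal_iff.1 ?_).symm⟩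
  ext i j
  rw [hP, Matrix.mul_diagonal, mul_comm]
  exact congrFun (hv j) i

lemma IsEigenframe.exists_transpose_mul_mul_eq_diagonal (h : IsEigenframe τ P t) (hS : S.IsSymm)
    (hτ : (S * τ).IsSymm) : ∃ b, P.valᵀ * S * P.val = Matrix.diagonal b := by
  refine exists_eq_diagonal_of_commute h.injective ?_
  have eigen : τ * P.val = P.val * Matrix.diagonal t :=
    mul_eq_mul_diagonal_iff.2 h.conjDiagonal_eq.symm
  have eigen' : Matrix.diagonal t * P.valᵀ * S = P.valᵀ * (S * τ) := by
    have := congrArg Matrix.transpose eigen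
    rw [Matrix.transpose_mul, Matrix.transpose_mul, Matrix.diagonal_transpose] at this
    rw [← this, ← hτ.eq, Matrix.transpose_mul, hS.eq, mul_assoc]
  rw [Commute, SemiconjBy, ← mul_assoc, ← mul_assoc, eigen', mul_assoc _ P.val, ← eigen]
  simp only [mul_assoc]

/-- The columns of an eigenframe are orthogonal, so it remains to rescale them. -/
theorem exists_isEigenframe_orthonormal [IsSepClosed k] (h2 : (2 : k) ≠ 0) (hS : S.IsSymm)
    (hSu : IsUnit S) (hτ : (S * τ).IsSymm) (ht : Function.Injective t)
    (hχ : τ.charpoly = ∏ i, (Polynomial.X - Polynomial.C (t i))) :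
    ∃ P, IsEigenframe τ P t ∧ P.valᵀ * S * P.val = 1 := by
  obtain ⟨V, hV⟩ := exists_isEigenframe ht hχ
  obtain ⟨b, hb⟩ := hV.exists_transpose_mul_mul_eq_diagonal hS hτ
  have hb0 (i : n) : b i ≠ 0 := by
    have : IsUnit (Matrix.diagonal b) :=
      hb ▸ (((Matrix.isUnit_transpose _).2 V.isUnit).mul hSu).mul V.isUnit
    exact (Pi.isUnit_iff.1 (Matrix.isUnit_diagonal.1 this) i).ne_zero
  have : NeZero ((2 : ℕ) : k) := ⟨by exact_mod_cast h2⟩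
  choose r hr using fun i => IsSepClosed.exists_pow_nat_eq (b i)⁻¹ 2
  have hr0 (i : n) : r i ≠ 0 := fun h => inv_ne_zero (hb0 i) (by rw [← hr, h, zero_pow two_ne_zero])
  obtain ⟨D, hD⟩ : IsUnit (Matrix.diagonal r) :=
    Matrix.isUnit_diagonal.2 (Pi.isUnit_iff.2 fun i => (hr0 i).isUnit)
  refine ⟨V * D, ⟨ht, (mul_eq_mul_diagonal_iff.1 ?_).symm⟩, ?_⟩
  · rw [Units.val_mul, hD, ← mul_assoc, mul_eq_mul_diagonal_iff.2 hV.conjDiagonal_eq.symm,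
      mul_assoc, mul_assoc, (Matrix.commute_diagonal t r).eq]
  · rw [Units.val_mul, hD, Matrix.transpose_mul, Matrix.diagonal_transpose,
      show ∀ X Y : Matrix n n k, X * V.valᵀ * S * (V.val * Y) = X * (V.valᵀ * S * V.val) * Y by
        simp only [mul_assoc, implies_true],
      hb, Matrix.diagonal_mul_diagonal, Matrix.diagonal_mul_diagonal, ← Matrix.diagonal_one]
    congr 1
    ext i
    have hri := hr i
    have hbi := hb0 i
    field_simp at hri
    linear_combination hri

end Field

end Eigenframe

/-! ### Matrices symmetric about the antidiagonal -/

section Antitranspose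

variable {A B : Type*} [CommRing A] [CommRing B]

lemma J_mul_J : (J A).val * (J A).val = 1 := (J A).val_inv

lemma J_transpose : (J A).valᵀ = (J A).val := by
  ext i j; fin_cases i <;> fin_cases j <;> simp [J]

lemma det_J : (J A).val.det = -1 := by
  simp [J, Matrix.det_fin_three]

/-- The transpose with respect to the antidiagonal, that is, the adjoint for the bilinear form with
Gram matrix `J`. -/
def antitranspose (M : Matrix (Fin 3) (Fin 3) A) : Matrix (Fin 3) (Fin 3) A :=
  (J A).val * Mᵀ * (J A).val

lemma antitranspose_mul (M N : Matrix (Fin 3) (Fin 3) A) :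
    antitranspose (M * N) = antitranspose N * antitranspose M := by
  simp only [antitranspose, Matrix.transpose_mul, Matrix.mul_assoc]
  rw [← Matrix.mul_assoc (J A).val (J A).val, J_mul_J, Matrix.one_mul]

lemma antitranspose_one : antitranspose (1 : Matrix (Fin 3) (Fin 3) A) = 1 := by
  simp [antitranspose, J_mul_J]

lemma antitranspose_add (M N : Matrix (Fin 3) (Fin 3) A) :
    antitranspose (M + N) = antitranspose M + antitranspose N := by
  simp [antitranspose, Matrix.mul_add, Matrix.add_mul]

lemma antitranspose_smul (a : A) (M : Matrix (Fin 3) (Fin 3) A) :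
    antitranspose (a • M) = a • antitranspose M := by
  simp [antitranspose]

lemma antitranspose_map (f : A →+* B) (M : Matrix (Fin 3) (Fin 3) A) :
    antitranspose (M.map f) = (antitranspose M).map f := by
  have map_val_J : (J A).val.map f = (J B).val := congrArg Units.val (map_J f)
  simp only [antitranspose, Matrix.map_mul, map_val_J, Matrix.transpose_map]

lemma det_antitranspose (M : Matrix (Fin 3) (Fin 3) A) : (antitranspose M).det = M.det := by
  simp [antitranspose, det_J]

lemma antitranspose_eq_self_iff {M : Matrix (Fin 3) (Fin 3) A} :
    antitranspose M = M ↔ ((J A).val * M).IsSymm := by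
  rw [antitranspose, mul_assoc, Matrix.IsSymm, Matrix.transpose_mul, J_transpose,
    ← (J A).isUnit.mul_right_inj, ← mul_assoc, J_mul_J, one_mul]

lemma sigma_eq_iff {g h : GL (Fin 3) A} : sigma A g = h ↔ antitranspose g.val * h.val = 1 := by
  have antitranspose_mul_sigma : antitranspose g.val * (sigma A g).val = 1 := by
    change antitranspose g.val * antitranspose (g⁻¹).val = 1
    rw [← antitranspose_mul, Units.inv_mul, antitranspose_one]
  refine ⟨fun hgh => hgh ▸ antitranspose_mul_sigma, fun hgh => Units.ext ?_⟩
  exact (IsUnit.of_mul_eq_one _ hgh).mul_left_cancel (antitranspose_mul_sigma.trans hgh.symm)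

lemma eq_sigma_inv_iff {g : GL (Fin 3) A} : g = (sigma A g)⁻¹ ↔ antitranspose g.val = g.val := by
  rw [← inv_eq_iff_eq_inv, eq_comm, sigma_eq_iff, Units.mul_inv_eq_one]

lemma mem_unitary_iff {c : A →+* A} {g : GL (Fin 3) A} :
    g ∈ unitary c ↔ antitranspose (g.val.map c) * g.val = 1 :=
  sigma_eq_iff (g := Matrix.GeneralLinearGroup.map c g)

lemma mem_symm_iff {c : A →+* A} {g : GL (Fin 3) A} :
    g ∈ symm c ↔ antitranspose g.val = g.val ∧ g.val.map c * g.val = 1 := by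
  change g ∈ unitary c ∧ g = (sigma A g)⁻¹ ↔ _
  rw [eq_sigma_inv_iff, mem_unitary_iff, and_comm]
  refine and_congr_right fun h => ?_
  rw [antitranspose_map, h]

lemma mem_specialOrthogonal_iff {g : GL (Fin 3) A} :
    g ∈ specialOrthogonal A ↔ antitranspose g.val * g.val = 1 ∧ g.val.det = 1 := by
  change sigma A g = g ∧ Matrix.GeneralLinearGroup.det g = 1 ↔ _
  rw [sigma_eq_iff, Units.ext_iff]
  rfl

lemma mem_or_neg_mem_specialOrthogonal [IsDomain A] {g : GL (Fin 3) A}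
    (hg : antitranspose g.val * g.val = 1) :
    g ∈ specialOrthogonal A ∨ -g ∈ specialOrthogonal A := by
  have det_sq : g.val.det ^ 2 = 1 := by
    simpa [det_antitranspose, pow_two] using congrArg Matrix.det hg
  have neg_isometry : antitranspose (-g).val * (-g).val = 1 := by
    rw [Units.val_neg, ← neg_one_smul A g.val, antitranspose_smul]
    simpa using hg
  refine (sq_eq_one_iff.1 det_sq).imp (fun h => mem_specialOrthogonal_iff.2 ⟨hg, h⟩) fun h =>
    mem_specialOrthogonal_iff.2 ⟨neg_isometry, ?_⟩
  rw [Units.val_neg, Matrix.det_neg, h, Fintype.card_fin]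
  ring

end Antitranspose

section OrthonormalFrame

/-- The columns of `P` form a basis of eigenvectors of `τ`, with the distinct eigenvalues `t`, that
is orthonormal for the symmetric bilinear form with Gram matrix `J`. -/
structure IsOrthonormalFrame {A : Type*} [CommRing A] (τ : Matrix (Fin 3) (Fin 3) A)
    (P : GL (Fin 3) A) (t : Fin 3 → A) : Prop extends IsEigenframe τ P t where
  orthonormal : P.valᵀ * (J A).val * P.val = 1

variable {k : Type*} [Field k] {τ τ' : Matrix (Fin 3) (Fin 3) k} {P P' : GL (Fin 3) k}
  {t : Fin 3 → k}

theorem exists_isOrthonormalFrame [IsSepClosed k] (h2 : (2 : k) ≠ 0)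
    (ht : Function.Injective t) (hτ : antitranspose τ = τ)
    (hχ : τ.charpoly = ∏ i, (Polynomial.X - Polynomial.C (t i))) :
    ∃ P, IsOrthonormalFrame τ P t := by
  obtain ⟨P, hP, orthonormal⟩ := exists_isEigenframe_orthonormal h2 J_transpose (J k).isUnit
    (antitranspose_eq_self_iff.1 hτ) ht hχ
  exact ⟨P, hP, orthonormal⟩

namespace IsOrthonormalFrame

lemma antitranspose_eq_self (h : IsOrthonormalFrame τ P t) {M : Matrix (Fin 3) (Fin 3) k}
    (hM : Commute M τ) : antitranspose M = M := by
  obtain ⟨d, rfl⟩ := h.exists_conjDiagonal_eq hM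
  exact antitranspose_eq_self_iff.2 (isSymm_mul_conjDiagonal h.orthonormal d)

lemma antitranspose_mul_val (h : IsOrthonormalFrame τ P t) :
    antitranspose P.val * P.val = (J k).val := by
  rw [antitranspose, mul_assoc, mul_assoc, ← mul_assoc P.valᵀ, h.orthonormal, mul_one]

/-- The matrix carrying one frame to the other is an isometry, and its sign can be chosen. -/
theorem exists_mem_specialOrthogonal_mul_eq (h : IsOrthonormalFrame τ P t)
    (h' : IsOrthonormalFrame τ' P' t) :
    ∃ g ∈ specialOrthogonal k, τ * g.val = g.val * τ' := by
  have intertwines : τ * (P * P'⁻¹).val = (P * P'⁻¹).val * τ' := by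
    rw [← h'.conjDiagonal_eq, conjDiagonal_apply, Units.val_mul, ← mul_assoc,
      mul_eq_mul_diagonal_iff.2 h.conjDiagonal_eq.symm]
    simp only [mul_assoc, Units.inv_mul_cancel_left]
  have isometry : antitranspose (P * P'⁻¹).val * (P * P'⁻¹).val = 1 := by
    rw [Units.val_mul, antitranspose_mul, mul_assoc, ← mul_assoc (antitranspose P.val),
      h.antitranspose_mul_val, ← h'.antitranspose_mul_val, mul_assoc (antitranspose P'.val),
      Units.mul_inv, mul_one, ← antitranspose_mul, Units.mul_inv, antitranspose_one]
  rcases mem_or_neg_mem_specialOrthogonal isometry with hg | hg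
  · exact ⟨_, hg, intertwines⟩
  · exact ⟨_, hg, by rw [Units.val_neg, mul_neg, neg_mul, intertwines]⟩

end IsOrthonormalFrame

end OrthonormalFrame

/-! ### The torus of matrices commuting with a regular matrix -/

section Torus

variable {n : Type*} [Fintype n] [DecidableEq n]

omit [DecidableEq n] in
lemma commute_map_iff {A B : Type*} [CommRing A] [CommRing B] {f : A →+* B}
    (hf : Function.Injective f) {M N : Matrix n n A} :
    Commute (M.map f) (N.map f) ↔ Commute M N := by
  simp only [Commute, SemiconjBy, ← Matrix.map_mul, (Matrix.map_injective hf).eq_iff]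

/-- The invertible matrices commuting with a given matrix. -/
def torus {A : Type*} [CommRing A] (τ : Matrix n n A) : Subgroup (GL n A) where
  carrier := {g | Commute g.val τ}
  mul_mem' ha hb := Commute.mul_left ha hb
  one_mem' := Commute.one_left _
  inv_mem' ha := Commute.units_inv_left ha

lemma mem_torus {A : Type*} [CommRing A] {τ : Matrix n n A} {g : GL n A} :
    g ∈ torus τ ↔ Commute g.val τ := Iff.rfl

section Subring

variable {R k : Type*} [CommRing R] [CommRing k] [IsDomain k] {f : R →+* k} {τ : Matrix n n R}
  {P : GL n k} {t : n → k}

lemma IsEigenframe.commute_of_map (hf : Function.Injective f) (h : IsEigenframe (τ.map f) P t)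
    {M N : Matrix n n R} (hM : Commute M τ) (hN : Commute N τ) : Commute M N :=
  (commute_map_iff hf).1 (h.commute ((commute_map_iff hf).2 hM) ((commute_map_iff hf).2 hN))

lemma IsEigenframe.isMulCommutative_torus (hf : Function.Injective f)
    (h : IsEigenframe (τ.map f) P t) : IsMulCommutative (torus τ) :=
  ⟨⟨fun a b => Subtype.ext (Units.ext (h.commute_of_map hf a.2 b.2))⟩⟩

end Subring

lemma IsOrthonormalFrame.antitranspose_eq_self_of_map {R k : Type*} [CommRing R] [Field k]
    {f : R →+* k} (hf : Function.Injective f) {τ : Matrix (Fin 3) (Fin 3) R} {P : GL (Fin 3) k}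
    {t : Fin 3 → k} (h : IsOrthonormalFrame (τ.map f) P t) {M : Matrix (Fin 3) (Fin 3) R}
    (hM : Commute M τ) : antitranspose M = M := by
  refine Matrix.map_injective hf ((antitranspose_map f M).symm.trans ?_)
  exact h.antitranspose_eq_self ((commute_map_iff hf).2 hM)

variable {F k : Type*} [Field F] [Field k] [Algebra F k] {τ : Matrix n n F} {P : GL n k} {t : n → k}

lemma mem_centralizer_singleton_iff {M : Matrix n n F} :
    M ∈ Subalgebra.centralizer F {τ} ↔ Commute M τ := by
  simp only [Subalgebra.mem_centralizer_iff, Set.mem_singleton_iff, forall_eq]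
  exact eq_comm

/-- The torus is the unit group of the algebra of all matrices commuting with `τ`. -/
def unitsCentralizerEquivTorus (τ : Matrix n n F) :
    (Subalgebra.centralizer F {τ})ˣ ≃* torus τ where
  toFun u := ⟨Units.map (Subalgebra.centralizer F {τ}).val.toMonoidHom u,
    mem_centralizer_singleton_iff.1 u.1.2⟩
  invFun g := ⟨⟨g.1.val, mem_centralizer_singleton_iff.2 g.2⟩,
    ⟨(g⁻¹).1.val, mem_centralizer_singleton_iff.2 (g⁻¹).2⟩,
    Subtype.ext g.1.val_inv, Subtype.ext g.1.inv_val⟩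
  left_inv _ := rfl
  right_inv _ := rfl
  map_mul' _ _ := rfl

lemma IsEigenframe.isReduced_centralizer (h : IsEigenframe (τ.map (algebraMap F k)) P t) :
    IsReduced (Subalgebra.centralizer F {τ}) := by
  refine (isReduced_iff_pow_one_lt 2 one_lt_two).2 fun x hx => Subtype.ext ?_
  obtain ⟨d, hd⟩ := h.exists_conjDiagonal_eq
    ((commute_map_iff (algebraMap F k).injective).2 (mem_centralizer_singleton_iff.1 x.2))
  have d_sq : d ^ 2 = 0 := conjDiagonal_injective P <| by
    rw [map_pow, hd, map_zero]
    exact ((algebraMap F k).mapMatrix.map_pow x.1 2).symm.trans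
      (by rw [show x.1 ^ 2 = 0 from congrArg Subtype.val hx, map_zero])
  refine Matrix.map_injective (algebraMap F k).injective (hd.symm.trans ?_)
  rw [(pow_eq_zero_iff two_ne_zero).1 d_sq, map_zero]
  exact (map_zero (algebraMap F k).mapMatrix).symm

open scoped IsMulCommutative in
theorem IsEigenframe.index_square_torus [ValuativeRel F] [TopologicalSpace F]
    [IsNonarchimedeanLocalField F] (hp : ringChar 𝓀[F] ≠ 2)
    (h : IsEigenframe (τ.map (algebraMap F k)) P t) [IsMulCommutative (torus τ)] :
    (Subgroup.square (torus τ)).index = twoTorsionCard (torus τ) ^ 2 := by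
  let : CommRing (Subalgebra.centralizer F {τ}) :=
    { (inferInstance : Ring (Subalgebra.centralizer F {τ})) with
      mul_comm := fun a b => Subtype.ext <| h.commute_of_map (algebraMap F k).injective
        (mem_centralizer_singleton_iff.1 a.2) (mem_centralizer_singleton_iff.1 b.2) }
  have : FiniteDimensional F (Subalgebra.centralizer F {τ}) :=
    FiniteDimensional.of_injective (Subalgebra.centralizer F {τ}).val.toLinearMap
      Subtype.val_injective
  have : IsReduced (Subalgebra.centralizer F {τ}) := h.isReduced_centralizer
  rw [← index_square_congr (unitsCentralizerEquivTorus τ),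
    ← twoTorsionCard_congr (unitsCentralizerEquivTorus τ)]
  exact index_square_units_of_isReduced F hp _

end Torus

section Hilbert90

section Cocycle

variable {F k : Type*} [Field F] [Field k] [Algebra F k]

lemma Cocycle.map_one {Γ A : Type*} [Group Γ] [TopologicalSpace Γ] [Group A]
    [MulDistribMulAction Γ A] (a : Cocycle Γ A) : a.toFun 1 = 1 := by
  simpa using a.map_mul 1 1

/-- A cocycle is locally constant, hence comes from a finite normal subextension. -/
lemma Cocycle.exists_factor_restrictNormalHom [Normal F k] {A : Type*} [Group A]
    [MulDistribMulAction (k ≃ₐ[F] k) A] (a : Cocycle (k ≃ₐ[F] k) A) :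
    ∃ (E : IntermediateField F k) (_ : FiniteDimensional F E) (_ : Normal F E)
      (a' : (E ≃ₐ[F] E) → A), ∀ s σ, a' (AlgEquiv.restrictNormalHom E s * σ) =
        a.toFun s * s • a' σ := by
  have nhds_one : {s | a.toFun s = 1} ∈ nhds (1 : k ≃ₐ[F] k) :=
    (a.locallyConstant.isOpen_fiber 1).mem_nhds a.map_one
  obtain ⟨E, hfin, hnorm, hE⟩ := (krullTopology_mem_nhds_one_iff_of_normal F k _).1 nhds_one
  have factors {s s' : k ≃ₐ[F] k}
      (h : AlgEquiv.restrictNormalHom E s = AlgEquiv.restrictNormalHom E s') :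
      a.toFun s = a.toFun s' := by
    have trivial_on : a.toFun (s'⁻¹ * s) = 1 := hE <| by
      rw [SetLike.mem_coe, ← IntermediateField.restrictNormalHom_ker, MonoidHom.mem_ker,
        _root_.map_mul, map_inv, h, inv_mul_cancel]
    rw [← mul_inv_cancel_left s' s, a.map_mul, trivial_on, smul_one, mul_one]
  choose lift hlift using AlgEquiv.restrictNormalHom_surjective (F := F) (K₁ := E) k
  refine ⟨E, hfin, hnorm, fun σ => a.toFun (lift σ), fun s σ => ?_⟩
  rw [← a.map_mul]
  exact factors (by rw [hlift, _root_.map_mul, hlift])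

/-- By independence of characters, no condition excludes all of `E`, and a vector space over an
infinite field is not a finite union of proper subspaces. -/
lemma exists_forall_sum_mul_ne_zero [Infinite F] (E : IntermediateField F k)
    [FiniteDimensional F E] {ι : Type*} [Finite ι] (ε : ι → (E ≃ₐ[F] E) → k)
    (hε : ∀ i, ε i 1 ≠ 0) : ∃ c : E, ∀ i, ∑ σ : E ≃ₐ[F] E, ε i σ * (σ c : k) ≠ 0 := by
  let f (i : ι) : E →ₗ[F] k := ∑ σ : E ≃ₐ[F] E,
    (LinearMap.mulLeft F (ε i σ)).comp (E.val.toLinearMap.comp σ.toLinearMap)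
  have f_apply (i : ι) (c : E) : f i c = ∑ σ : E ≃ₐ[F] E, ε i σ * (σ c : k) := by
    simp [f, LinearMap.sum_apply]
  by_contra! hcon
  have cover : ⋃ i, (LinearMap.ker (f i) : Set E) = Set.univ := by
    refine Set.eq_univ_of_forall fun c => ?_
    obtain ⟨i, hi⟩ := hcon c
    exact Set.mem_iUnion.2 ⟨i, by rw [SetLike.mem_coe, LinearMap.mem_ker, f_apply, hi]⟩
  obtain ⟨i, hi⟩ := Subspace.exists_eq_top_of_iUnion_eq_univ cover
  have independent := (linearIndependent_monoidHom E k).comp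
    (fun σ : E ≃ₐ[F] E => ((E.val : E →* k).comp (σ : E →* E))) (fun σ σ' h => by
      ext x
      exact DFunLike.congr_fun h x)
  rw [Fintype.linearIndependent_iff] at independent
  refine hε i (independent (ε i) ?_ 1)
  ext c
  have f_eq_zero : f i c = 0 := by rw [← LinearMap.mem_ker, hi]; trivial
  rw [f_apply] at f_eq_zero
  simpa using f_eq_zero

end Cocycle

variable {n F k : Type*} [Fintype n] [DecidableEq n] [Field F] [Field k] [Algebra F k]
  {τ : Matrix n n F} {P : GL n k} {t : n → k}

/-- The points over `k` of the torus of matrices commuting with `τ`. -/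
abbrev torusOver (τ : Matrix n n F) (k : Type*) [Field k] [Algebra F k] : Subgroup (GL n k) :=
  torus (τ.map (algebraMap F k))

/-- The Galois group acts on the points of the torus entrywise. -/
instance torusOverAction : MulDistribMulAction (k ≃ₐ[F] k) (torusOver τ k) where
  smul s g := ⟨Matrix.GeneralLinearGroup.map (s : k →ₐ[F] k).toRingHom g, by
    have map_commute := Commute.map g.2 (s : k →ₐ[F] k).toRingHom.mapMatrix
    rwa [show (s : k →ₐ[F] k).toRingHom.mapMatrix (τ.map (algebraMap F k)) =
      τ.map (algebraMap F k) by ext; simp] at map_commute⟩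
  one_smul _ := rfl
  mul_smul _ _ _ := rfl
  smul_one _ := Subtype.ext (map_one _)
  smul_mul _ _ _ := Subtype.ext (map_mul _ _ _)

lemma val_smul_torusOver (s : k ≃ₐ[F] k) (g : torusOver τ k) :
    (s • g).1.val = g.1.val.map s := rfl

lemma isLocallyConstant_algEquiv_apply [Algebra.IsIntegral F k] (x : k) :
    IsLocallyConstant fun s : k ≃ₐ[F] k => s x := by
  rw [IsLocallyConstant.iff_exists_open]
  intro s
  refine ⟨_, (stabilizer_isOpen_of_isIntegral (K := F) x).leftCoset s,
    mem_own_leftCoset (MulAction.stabilizer (k ≃ₐ[F] k) x).toSubmonoid s, ?_⟩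
  rintro _ ⟨u, hu, rfl⟩
  exact congrArg s hu

lemma isLocallyConstant_map_algEquiv [Algebra.IsIntegral F k] (g : GL n k) :
    IsLocallyConstant fun s : k ≃ₐ[F] k =>
      Matrix.GeneralLinearGroup.map (s : k →ₐ[F] k).toRingHom g := by
  rw [IsLocallyConstant.iff_exists_open]
  intro s
  refine ⟨⋂ i, ⋂ j, {u | u (g.val i j) = s (g.val i j)},
    isOpen_iInter_of_finite fun i => isOpen_iInter_of_finite fun j =>
      (isLocallyConstant_algEquiv_apply (F := F) (g.val i j)).isOpen_fiber _, by simp, ?_⟩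
  intro u hu
  simp only [Set.mem_iInter, Set.mem_ofPred_eq] at hu
  ext i j
  exact hu i j

lemma isLocallyConstant_smul_torusOver [Algebra.IsIntegral F k] (g : torusOver τ k) :
    IsLocallyConstant fun s : k ≃ₐ[F] k => s • g :=
  IsLocallyConstant.desc _ Subtype.val (isLocallyConstant_map_algEquiv g.1) Subtype.val_injective

lemma exists_val_eq_sum_smul [Infinite F] (h : IsEigenframe (τ.map (algebraMap F k)) P t)
    (E : IntermediateField F k) [FiniteDimensional F E] (a : (E ≃ₐ[F] E) → torusOver τ k) :
    ∃ (c : E) (b : torusOver τ k), b.1.val = ∑ σ : E ≃ₐ[F] E, (σ c : k) • (a σ).1.val := by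
  choose ε hε using fun σ => h.exists_conjDiagonal_eq (a σ).2
  have unit_ε (σ : E ≃ₐ[F] E) : IsUnit (ε σ) :=
    isUnit_conjDiagonal_iff.1 (hε σ ▸ (a σ).1.isUnit)
  obtain ⟨c, hc⟩ := exists_forall_sum_mul_ne_zero E (fun i σ => ε σ i)
    fun i => (Pi.isUnit_iff.1 (unit_ε 1) i).ne_zero
  have sum_eq : conjDiagonal P (∑ σ : E ≃ₐ[F] E, (σ c : k) • ε σ) =
      ∑ σ : E ≃ₐ[F] E, (σ c : k) • (a σ).1.val := by
    simp only [map_sum, map_smul, hε]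
  have unit_sum : IsUnit (∑ σ : E ≃ₐ[F] E, (σ c : k) • ε σ) := Pi.isUnit_iff.2 fun i => by
    refine IsUnit.mk0 _ ?_
    simpa only [Finset.sum_apply, Pi.smul_apply, smul_eq_mul, mul_comm] using hc i
  obtain ⟨b, hb⟩ := isUnit_conjDiagonal_iff (P := P).2 unit_sum
  exact ⟨c, ⟨b, mem_torus.2 (hb ▸ h.commute_conjDiagonal _)⟩, hb.trans sum_eq⟩

/-- Hilbert 90: the cocycle is trivialized by its Poincaré series. -/
theorem IsEigenframe.exists_eq_mul_smul_inv [Infinite F] [Normal F k]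
    (h : IsEigenframe (τ.map (algebraMap F k)) P t) (a : Cocycle (k ≃ₐ[F] k) (torusOver τ k)) :
    ∃ b : torusOver τ k, ∀ s, a.toFun s = b * (s • b)⁻¹ := by
  obtain ⟨E, _, _, a', ha'⟩ := a.exists_factor_restrictNormalHom
  obtain ⟨c, b, hb⟩ := exists_val_eq_sum_smul h E a'
  refine ⟨b, fun s => eq_mul_inv_of_mul_eq (Subtype.ext (Units.ext ?_))⟩
  have map_sum : b.1.val.map s = ∑ σ : E ≃ₐ[F] E, s (σ c : k) • (s • a' σ).1.val := by
    rw [hb]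
    refine (_root_.map_sum (s : k →ₐ[F] k).toRingHom.mapMatrix _ _).trans
      (Finset.sum_congr rfl fun σ _ => ?_)
    ext i j
    simp [val_smul_torusOver]
  rw [Subgroup.coe_mul, Units.val_mul, val_smul_torusOver, map_sum, Finset.mul_sum, hb]
  refine Fintype.sum_equiv (Equiv.mulLeft (AlgEquiv.restrictNormalHom E s)) _ _ fun σ => ?_
  have restrict_apply : ((AlgEquiv.restrictNormalHom E s * σ) c : k) = s (σ c : k) :=
    AlgEquiv.restrictNormal_apply E s (σ c)
  rw [Equiv.coe_mulLeft, restrict_apply, ha', Matrix.mul_smul]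
  rfl

end Hilbert90

/-! ### Cohomology of the stabilizer -/

lemma infinite_of_isNonarchimedeanLocalField (F : Type*) [Field F] [ValuativeRel F]
    [TopologicalSpace F] [IsNonarchimedeanLocalField F] : Infinite F := by
  refine not_finite_iff_infinite.1 fun _ => ?_
  have : Finite 𝒪[F] := Finite.of_injective _ Subtype.val_injective
  exact IsDiscreteValuationRing.not_isField 𝒪[F] (Finite.isField_of_domain 𝒪[F])

section GaloisDescent

variable {n F k : Type*} [Fintype n] [DecidableEq n] [Field F] [Field k] [Algebra F k]
  {τ : Matrix n n F} {P : GL n k} {t : n → k}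

lemma generalLinearGroup_map_injective {A B : Type*} [CommRing A] [CommRing B] {f : A →+* B}
    (hf : Function.Injective f) :
    Function.Injective (Matrix.GeneralLinearGroup.map (n := n) f) :=
  Units.map_injective (Matrix.map_injective hf)

omit [Fintype n] [DecidableEq n] in
lemma exists_map_algebraMap_eq [IsGalois F k] {M : Matrix n n k}
    (hM : ∀ s : k ≃ₐ[F] k, M.map s = M) : ∃ N : Matrix n n F, N.map (algebraMap F k) = M := by
  choose N hN using fun i j => (InfiniteGalois.mem_range_algebraMap_iff_fixed (M i j)).2 fun s =>
    congrFun₂ (hM s) i j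
  exact ⟨Matrix.of N, Matrix.ext hN⟩

lemma exists_generalLinearGroup_map_eq [IsGalois F k] {g : GL n k}
    (hg : ∀ s : k ≃ₐ[F] k, Matrix.GeneralLinearGroup.map (s : k →ₐ[F] k).toRingHom g = g) :
    ∃ q : GL n F, Matrix.GeneralLinearGroup.map (algebraMap F k) q = g := by
  obtain ⟨M, hM⟩ := exists_map_algebraMap_eq (F := F) fun s => congrArg Units.val (hg s)
  have unit_M : IsUnit M := by
    rw [Matrix.isUnit_iff_isUnit_det, ← isUnit_map_iff (algebraMap F k), RingHom.map_det,
      RingHom.mapMatrix_apply, hM]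
    exact (Matrix.isUnit_iff_isUnit_det _).1 g.isUnit
  obtain ⟨q, rfl⟩ := unit_M
  exact ⟨q, Units.ext hM⟩

/-- The points of the torus over `F`, as points over `k`. -/
def torusInclusion (τ : Matrix n n F) (k : Type*) [Field k] [Algebra F k] :
    torus τ →* torusOver τ k :=
  ((Matrix.GeneralLinearGroup.map (algebraMap F k)).comp (torus τ).subtype).codRestrict _
    fun g => (commute_map_iff (algebraMap F k).injective).2 g.2

lemma torusInclusion_injective : Function.Injective (torusInclusion τ k) := fun _ _ h =>
  Subtype.ext (generalLinearGroup_map_injective (algebraMap F k).injective (congrArg Subtype.val h))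

lemma range_torusInclusion [IsGalois F k] :
    (torusInclusion τ k).range = FixedPoints.subgroup (k ≃ₐ[F] k) (torusOver τ k) := by
  ext g
  rw [FixedPoints.mem_subgroup]
  constructor
  · rintro ⟨y, rfl⟩ s
    ext i j
    exact s.commutes _
  · intro hg
    obtain ⟨q, hq⟩ := exists_generalLinearGroup_map_eq fun s => congrArg Subtype.val (hg s)
    refine ⟨⟨q, (commute_map_iff (algebraMap F k).injective).1 ?_⟩, Subtype.ext hq⟩
    rw [show q.val.map (algebraMap F k) = g.1.val from congrArg Units.val hq]
    exact g.2

lemma range_unitsMap_algebraMap [IsGalois F k] :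
    (Units.map (algebraMap F k : F →* k)).range = FixedPoints.subgroup (k ≃ₐ[F] k) kˣ := by
  ext x
  rw [FixedPoints.mem_subgroup]
  constructor
  · rintro ⟨y, rfl⟩ s
    exact Units.ext (s.commutes _)
  · intro hx
    obtain ⟨y, hy⟩ := (InfiniteGalois.mem_range_algebraMap_iff_fixed (k := F) x.val).2 fun s =>
      congrArg Units.val (hx s)
    have y_ne_zero : y ≠ 0 := by
      rintro rfl
      exact x.ne_zero (by rw [← hy, map_zero])
    exact ⟨Units.mk0 y y_ne_zero, Units.ext hy⟩

lemma IsEigenframe.exists_sq_eq [IsSepClosed k] (h2 : (2 : k) ≠ 0)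
    (h : IsEigenframe (τ.map (algebraMap F k)) P t) (x : torusOver τ k) :
    ∃ y, y ^ 2 = x := by
  obtain ⟨d, hd⟩ := h.exists_conjDiagonal_eq x.2
  have : NeZero ((2 : ℕ) : k) := ⟨by exact_mod_cast h2⟩
  choose r hr using fun i => IsSepClosed.exists_pow_nat_eq (d i) 2
  have sq_eq : conjDiagonal P r ^ 2 = x.1.val := by
    rw [← map_pow, ← hd]
    exact congrArg (conjDiagonal P) (funext hr)
  obtain ⟨y, hy⟩ : IsUnit (conjDiagonal P r) :=
    (isUnit_pow_iff two_ne_zero).1 (sq_eq ▸ x.1.isUnit)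
  refine ⟨⟨y, mem_torus.2 (hy ▸ h.commute_conjDiagonal r)⟩, Subtype.ext (Units.ext ?_)⟩
  exact (congrArg (· ^ 2) hy).trans sq_eq

end GaloisDescent

section TorusDet

variable {F k : Type*} [Field F] [Field k] [Algebra F k] {τ : Matrix (Fin 3) (Fin 3) F}

/-- The determinant on the torus of matrices commuting with a `3 × 3` matrix. -/
def torusDet (τ : Matrix (Fin 3) (Fin 3) F) (k : Type*) [Field k] [Algebra F k] :
    torusOver τ k →* kˣ :=
  Matrix.GeneralLinearGroup.det.comp (torusOver τ k).subtype

lemma torusDet_smul (s : k ≃ₐ[F] k) (x : torusOver τ k) :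
    torusDet τ k (s • x) = s • torusDet τ k x :=
  Units.ext ((s : k →ₐ[F] k).toRingHom.map_det x.1.val).symm

lemma exists_torusDet_eq_neg_one :
    ∃ e ∈ FixedPoints.subgroup (k ≃ₐ[F] k) (torusOver τ k), e ^ 2 = 1 ∧ torusDet τ k e = -1 := by
  refine ⟨⟨-1, Commute.neg_one_left _⟩, fun s => ?_, Subtype.ext (by simp), Units.ext ?_⟩
  · ext i j
    simp [val_smul_torusOver, Matrix.one_apply, apply_ite]
  · change (-(1 : Matrix (Fin 3) (Fin 3) k)).det = -1
    rw [Matrix.det_neg, Fintype.card_fin, Matrix.det_one]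
    norm_num

/-- A scalar `f` has determinant `f³`, which is `f` up to squares. -/
lemma exists_torusDet_torusInclusion_eq (f : Fˣ) :
    ∃ y : torus τ, torusDet τ k (torusInclusion τ k y) =
      Units.map (algebraMap F k : F →* k) f ^ 3 := by
  refine ⟨⟨Matrix.GeneralLinearGroup.scalar (Fin 3) f, ?_⟩, Units.ext ?_⟩
  · exact Matrix.scalar_commute _ (Commute.all _) _
  · change ((Matrix.scalar (Fin 3) f.val).map (algebraMap F k)).det = _
    simp [Matrix.det_diagonal]

lemma fixedPoints_units_le [IsGalois F k] :
    FixedPoints.subgroup (k ≃ₐ[F] k) kˣ ≤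
      (FixedPoints.subgroup (k ≃ₐ[F] k) (torusOver τ k)).map (torusDet τ k) ⊔
        (FixedPoints.subgroup (k ≃ₐ[F] k) kˣ).map (powMonoidHom 2) := by
  rw [← range_unitsMap_algebraMap]
  rintro _ ⟨f, rfl⟩
  obtain ⟨y, hy⟩ := exists_torusDet_torusInclusion_eq (τ := τ) (k := k) f
  refine Subgroup.mem_sup.2 ⟨_, ⟨_, ?_, hy⟩, _, ⟨_, ⟨f⁻¹, rfl⟩, rfl⟩, ?_⟩
  · rw [SetLike.mem_coe, ← range_torusInclusion]
    exact ⟨y, rfl⟩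
  · rw [map_inv, powMonoidHom_apply]
    group

end TorusDet

section Stabilizer

variable {F E k : Type u} [Field F] [Field E] [Algebra F E] [Field k] [Algebra F k]
  {τ : Matrix (Fin 3) (Fin 3) F} {P : GL (Fin 3) k} {t : Fin 3 → k} {γ : GL (Fin 3) E}

open scoped IsMulCommutative in
lemma IsOrthonormalFrame.mem_twoTorsionKer_iff [IsMulCommutative (torusOver τ k)]
    (h : IsOrthonormalFrame (τ.map (algebraMap F k)) P t) {x : torusOver τ k} :
    x ∈ twoTorsionKer (torusDet τ k) ↔ x.1 ∈ specialOrthogonal k := by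
  rw [mem_twoTorsionKer, mem_specialOrthogonal_iff, h.antitranspose_eq_self x.2, pow_two,
    Subtype.ext_iff, Units.ext_iff, Units.ext_iff]
  rfl

open scoped IsMulCommutative in
theorem IsOrthonormalFrame.h1IsElementaryTwo_stabilizer [IsSepClosed k] [IsGalois F k]
    [ValuativeRel F] [TopologicalSpace F] [IsNonarchimedeanLocalField F]
    (hp : ringChar 𝓀[F] ≠ 2) (h : IsOrthonormalFrame (τ.map (algebraMap F k)) P t)
    (hstab : ∀ g, g ∈ stabilizer F γ k ↔ g ∈ specialOrthogonal k ∧ g ∈ torusOver τ k)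
    {m : ℕ} (hm : twoTorsionCard (torus τ) ^ 2 = 4 * 2 ^ m) :
    H1IsElementaryTwo (k ≃ₐ[F] k) (stabilizer F γ k) m := by
  have := infinite_of_isNonarchimedeanLocalField F
  have h2 : (2 : k) ≠ 0 := by
    rw [← map_ofNat (algebraMap F k) 2]
    exact (map_ne_zero _).2 (two_ne_zero_of_ringChar_residueField_ne_two hp)
  have := h.isMulCommutative_torus (algebraMap F k).injective
  have : IsMulCommutative (torusOver τ k) :=
    h.isMulCommutative_torus (f := RingHom.id k) Function.injective_id
  let ι : stabilizer F γ k →* torusOver τ k := Subgroup.inclusion fun g hg => ((hstab g).1 hg).2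
  have range_ι : ι.range = twoTorsionKer (torusDet τ k) := by
    ext x
    rw [h.mem_twoTorsionKer_iff]
    exact ⟨by rintro ⟨a, rfl⟩; exact ((hstab _).1 a.2).1,
      fun hx => ⟨⟨x.1, (hstab _).2 ⟨hx, x.2⟩⟩, rfl⟩⟩
  have coboundary (a : Cocycle (k ≃ₐ[F] k) (stabilizer F γ k)) :
      ∃ b, ∀ s, ι (a.toFun s) = b * (s • b)⁻¹ :=
    h.exists_eq_mul_smul_inv ⟨fun s => ι (a.toFun s), a.locallyConstant.comp _, fun s t => by
      rw [a.map_mul, map_mul]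
      rfl⟩
  obtain ⟨e, he, he2, det_e⟩ := exists_torusDet_eq_neg_one (τ := τ) (k := k)
  refine h1IsElementaryTwo_of_range_eq_twoTorsionKer (Subgroup.inclusion_injective _) range_ι
    (fun _ _ => rfl) isLocallyConstant_smul_torusOver coboundary torusDet_smul
    (h.exists_sq_eq h2) he he2 (fun x hx => ?_) fixedPoints_units_le four_ne_zero ?_ ?_
  · rw [det_e]
    exact Units.eq_or_eq_neg_of_sq_eq_sq x 1 (by rwa [one_pow])
  · rw [← range_unitsMap_algebraMap, relIndex_map_powMonoidHom_two_range
      (j := Units.map (algebraMap F k : F →* k)) (Units.map_injective (algebraMap F k).injective),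
      index_square_units_of_finiteDimensional F hp F]
  · rw [← range_torusInclusion, relIndex_map_powMonoidHom_two_range
      (j := torusInclusion τ k) torusInclusion_injective, h.index_square_torus hp, hm, mul_comm]

end Stabilizer

/-! ### The Cayley transform -/

section Quadratic

variable {F E : Type*} [Field F] [Field E] [Algebra F E]

/-- A nonzero element `ξ` with `θ(ξ) = -ξ` and `E = F ⊕ F ξ`. -/
structure IsImaginary (θ : E ≃ₐ[F] E) (ξ : E) : Prop where
  ne_zero : ξ ≠ 0
  map_eq : θ ξ = -ξ
  exists_eq : ∀ e, ∃ a b : F, e = algebraMap F E a + algebraMap F E b * ξ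

variable {θ : E ≃ₐ[F] E} {ξ : E}

lemma natCard_algEquiv_of_finrank_eq_two (hE : Module.finrank F E = 2) (hθ : θ ≠ 1) :
    Nat.card (E ≃ₐ[F] E) = 2 := by
  have : FiniteDimensional F E := Module.finite_of_finrank_pos (by omega)
  have : Nontrivial (E ≃ₐ[F] E) := ⟨θ, 1, hθ⟩
  have le_two := AlgEquiv.card_le (F := F) (K := E)
  rw [hE, ← Nat.card_eq_fintype_card] at le_two
  exact le_antisymm le_two Finite.one_lt_card

lemma isGalois_of_finrank_eq_two (hE : Module.finrank F E = 2) (hθ : θ ≠ 1) : IsGalois F E := by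
  have : FiniteDimensional F E := Module.finite_of_finrank_pos (by omega)
  exact IsGalois.of_card_aut_eq_finrank F E
    ((natCard_algEquiv_of_finrank_eq_two hE hθ).trans hE.symm)

lemma univ_algEquiv_of_finrank_eq_two [Fintype (E ≃ₐ[F] E)] [DecidableEq (E ≃ₐ[F] E)]
    (hE : Module.finrank F E = 2) (hθ : θ ≠ 1) :
    (Finset.univ : Finset (E ≃ₐ[F] E)) = {1, θ} := by
  refine (Finset.eq_univ_of_card _ ?_).symm
  rw [Finset.card_pair hθ.symm, ← Nat.card_eq_fintype_card,
    natCard_algEquiv_of_finrank_eq_two hE hθ]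

theorem isImaginary_of_trace_eq_zero (h2 : (2 : F) ≠ 0) (hE : Module.finrank F E = 2)
    (hθ : θ ≠ 1) (hξ0 : ξ ≠ 0) (hξ : Algebra.trace F E ξ = 0) : IsImaginary θ ξ := by
  classical
  have : FiniteDimensional F E := Module.finite_of_finrank_pos (by omega)
  have : IsGalois F E := isGalois_of_finrank_eq_two hE hθ
  have univ_eq := univ_algEquiv_of_finrank_eq_two hE hθ
  have h2E : (2 : E) ≠ 0 := by
    rw [← map_ofNat (algebraMap F E) 2]
    exact (map_ne_zero _).2 h2
  have map_ξ : θ ξ = -ξ := by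
    have trace_eq := trace_eq_sum_automorphisms (K := F) (L := E) ξ
    rw [hξ, map_zero, univ_eq, Finset.sum_pair hθ.symm, AlgEquiv.one_apply] at trace_eq
    exact (neg_eq_of_add_eq_zero_right trace_eq.symm).symm
  have map_map (e : E) : θ (θ e) = e := by
    have : θ * θ ∈ ({1, θ} : Finset (E ≃ₐ[F] E)) := univ_eq ▸ Finset.mem_univ _
    rw [Finset.mem_insert, Finset.mem_singleton, mul_eq_left] at this
    exact DFunLike.congr_fun (this.resolve_right hθ) e
  have rational {e : E} (he : θ e = e) : ∃ a, algebraMap F E a = e := by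
    refine (IsGalois.mem_range_algebraMap_iff_fixed e).2 fun σ => ?_
    have : σ ∈ ({1, θ} : Finset (E ≃ₐ[F] E)) := univ_eq ▸ Finset.mem_univ _
    rw [Finset.mem_insert, Finset.mem_singleton] at this
    rcases this with rfl | rfl
    exacts [rfl, he]
  refine ⟨hξ0, map_ξ, fun e => ?_⟩
  obtain ⟨a, ha⟩ := rational (e := (e + θ e) / 2) (by
    rw [map_div₀, map_add, map_map, map_ofNat, add_comm])
  obtain ⟨b, hb⟩ := rational (e := (e - θ e) / (2 * ξ)) (by
    rw [map_div₀, map_sub, map_map, map_mul, map_ξ, map_ofNat, mul_neg, div_neg, ← neg_div,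
      neg_sub])
  refine ⟨a, b, ?_⟩
  rw [ha, hb]
  field_simp
  ring

namespace IsImaginary

lemma two_mul_ne_zero (h2 : (2 : F) ≠ 0) (h : IsImaginary θ ξ) : 2 * ξ ≠ 0 := by
  rw [← map_ofNat (algebraMap F E) 2]
  exact mul_ne_zero ((map_ne_zero _).2 h2) h.ne_zero

lemma map_map (h : IsImaginary θ ξ) (e : E) : θ (θ e) = e := by
  obtain ⟨a, b, rfl⟩ := h.exists_eq e
  simp [h.map_eq]

lemma exists_algebraMap_eq (h2 : (2 : F) ≠ 0) (h : IsImaginary θ ξ) {e : E} (he : θ e = e) :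
    ∃ a, algebraMap F E a = e := by
  obtain ⟨a, b, rfl⟩ := h.exists_eq e
  simp only [map_add, map_mul, AlgEquiv.commutes, h.map_eq] at he
  have b_eq_zero : algebraMap F E b = 0 := (mul_eq_zero.1
    (by linear_combination -he : algebraMap F E b * (2 * ξ) = 0)).resolve_right
    (h.two_mul_ne_zero h2)
  exact ⟨a, by rw [b_eq_zero, zero_mul, add_zero]⟩

lemma exists_sq_eq (h2 : (2 : F) ≠ 0) (h : IsImaginary θ ξ) : ∃ u, algebraMap F E u = ξ ^ 2 :=
  h.exists_algebraMap_eq h2 (by rw [map_pow, h.map_eq, neg_sq])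

lemma algebraMap_ne (h2 : (2 : F) ≠ 0) (h : IsImaginary θ ξ) (a : F) : algebraMap F E a ≠ ξ := by
  rintro rfl
  have := h.map_eq
  rw [AlgEquiv.commutes] at this
  exact h.two_mul_ne_zero h2 (by linear_combination this)

/-- The elements `(a + ξ) / (a - ξ)` with `a ∈ F` have norm one, and only finitely many of them are
eigenvalues of `γ`. -/
lemma exists_isUnit_one_sub_smul [Infinite F] (h2 : (2 : F) ≠ 0) (h : IsImaginary θ ξ)
    {n : Type*} [Fintype n] [DecidableEq n] (γ : Matrix n n E) :
    ∃ c, θ c * c = 1 ∧ IsUnit (1 - c • γ) := by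
  have sub_ne_zero (a : F) : algebraMap F E a - ξ ≠ 0 := sub_ne_zero.2 (h.algebraMap_ne h2 a)
  have add_ne_zero (a : F) : algebraMap F E a + ξ ≠ 0 := fun h0 =>
    h.algebraMap_ne h2 (-a) (by rw [map_neg, neg_eq_of_add_eq_zero_right h0])
  have injective : Function.Injective fun a : F =>
      (algebraMap F E a + ξ) / (algebraMap F E a - ξ) := by
    intro a b hab
    rw [div_eq_div_iff (sub_ne_zero a) (sub_ne_zero b)] at hab
    refine (algebraMap F E).injective (mul_left_cancel₀ (h.two_mul_ne_zero h2) ?_)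
    linear_combination -hab
  obtain ⟨a, ha⟩ := ((Polynomial.finite_setOfPred_isRoot γ.charpoly_monic.ne_zero).preimage
    injective.injOn).exists_notMem
  set μ := (algebraMap F E a + ξ) / (algebraMap F E a - ξ)
  have μ_ne_zero : μ ≠ 0 := div_ne_zero (add_ne_zero a) (sub_ne_zero a)
  refine ⟨μ⁻¹, ?_, ?_⟩
  · have conj_ne_zero : algebraMap F E a + -ξ ≠ 0 := by
      rw [← sub_eq_add_neg]
      exact sub_ne_zero a
    simp only [μ, map_inv₀, map_div₀, map_add, map_sub, AlgEquiv.commutes, h.map_eq]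
    field_simp [add_ne_zero a, sub_ne_zero a]
    ring
  · have smul_eq : 1 - μ⁻¹ • γ = μ⁻¹ • (Matrix.scalar n μ - γ) := by
      rw [smul_sub, Matrix.scalar_apply, ← Matrix.smul_one_eq_diagonal, smul_smul,
        inv_mul_cancel₀ μ_ne_zero, one_smul]
    rw [smul_eq, Matrix.isUnit_iff_isUnit_det, Matrix.det_smul, ← Matrix.eval_charpoly]
    exact (mul_ne_zero (pow_ne_zero _ (inv_ne_zero μ_ne_zero)) ha).isUnit

end IsImaginary

end Quadratic

section Cayley

variable {n A B : Type*} [Fintype n] [DecidableEq n] [CommRing A] [CommRing B] {c ξ : A}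
  {γ γ' τ τ' g : Matrix n n A}

/-- The relation `τ = ξ (1 + cγ) / (1 - cγ)`, written without denominators. -/
def IsCayley (c ξ : A) (γ τ : Matrix n n A) : Prop :=
  (1 - c • γ) * (τ + ξ • 1) = (2 * ξ) • 1

namespace IsCayley

lemma map (h : IsCayley c ξ γ τ) (f : A →+* B) :
    IsCayley (f c) (f ξ) (γ.map f) (τ.map f) := by
  have map_smul (a : A) (M : Matrix n n A) : f.mapMatrix (a • M) = f a • f.mapMatrix M :=
    Matrix.map_smul' f a M (map_mul f)
  have mapped := congrArg f.mapMatrix h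
  simpa only [map_mul, map_sub, map_add, map_one, map_ofNat, map_smul] using! mapped

/-- Up to an affine change of variable, `τ` is the inverse of `1 - cγ`. -/
lemma exists_eq_smul_inv (h : IsCayley c ξ γ τ) (hξ : IsUnit (2 * ξ)) :
    ∃ u : (Matrix n n A)ˣ, u.val = 1 - c • γ ∧ τ + ξ • 1 = (2 * ξ) • (u⁻¹).val := by
  obtain ⟨s, hs⟩ := hξ
  have inv_right : (1 - c • γ) * ((s⁻¹).val • (τ + ξ • 1)) = 1 := by
    rw [mul_smul_comm, show _ * _ = _ from h, smul_smul, ← hs, Units.inv_mul, one_smul]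
  refine ⟨⟨_, _, inv_right, mul_eq_one_comm.1 inv_right⟩, rfl, ?_⟩
  rw [Units.inv_mk, smul_smul, ← hs, Units.mul_inv, one_smul]

lemma semiconjBy_iff (h : IsCayley c ξ γ τ) (h' : IsCayley c ξ γ' τ') (hc : IsUnit c)
    (hξ : IsUnit (2 * ξ)) : SemiconjBy g γ γ' ↔ SemiconjBy g τ τ' := by
  obtain ⟨u, hu, hτ⟩ := h.exists_eq_smul_inv hξ
  obtain ⟨u', hu', hτ'⟩ := h'.exists_eq_smul_inv hξ
  calc SemiconjBy g γ γ' ↔ SemiconjBy g u.val u'.val := by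
        simp only [hu, hu', SemiconjBy, mul_sub, sub_mul, mul_one, one_mul, mul_smul_comm,
          smul_mul_assoc, sub_right_inj, hc.smul_left_cancel]
    _ ↔ SemiconjBy g (u⁻¹).val (u'⁻¹).val := SemiconjBy.units_inv_right_iff.symm
    _ ↔ SemiconjBy g (τ + ξ • 1) (τ' + ξ • 1) := by
        simp only [hτ, hτ', SemiconjBy, mul_smul_comm, smul_mul_assoc, hξ.smul_left_cancel]
    _ ↔ SemiconjBy g τ τ' := by
        simp only [SemiconjBy, mul_add, add_mul, mul_smul_comm, smul_mul_assoc, mul_one, one_mul,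
          add_left_inj]

lemma exists_isEigenframe {k : Type*} [Field k] {c ξ : k} {γ τ : Matrix n n k} {P : GL n k}
    {d : n → k} (h : IsCayley c ξ γ τ) (hc : c ≠ 0) (hξ : 2 * ξ ≠ 0)
    (hγ : IsEigenframe γ P d) : ∃ t, IsEigenframe τ P t := by
  have one_sub_eq : 1 - c • γ = conjDiagonal P (1 - c • d) := by
    rw [map_sub, map_one, map_smul, hγ.conjDiagonal_eq]
  obtain ⟨u, hu, hτ⟩ := h.exists_eq_smul_inv hξ.isUnit
  obtain ⟨v, hv⟩ := isUnit_conjDiagonal_iff (P := P).1 (one_sub_eq ▸ hu ▸ u.isUnit)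
  have inv_eq : (u⁻¹).val = conjDiagonal P (v⁻¹).val := Units.inv_eq_of_mul_eq_one_right <| by
    rw [hu, one_sub_eq, ← hv, ← map_mul, Units.mul_inv, map_one]
  refine ⟨(2 * ξ) • (v⁻¹).val - ξ • 1, fun i j hij => hγ.injective ?_, ?_⟩
  · have inv_eq : (v⁻¹).val i = (v⁻¹).val j := by simpa [hξ] using hij
    have val_eq : v.val i = v.val j := left_inv_eq_right_inv (congrFun v.mul_inv i) <| by
      rw [inv_eq]
      exact congrFun v.inv_mul j
    simpa [hv, hc] using val_eq
  · rw [map_sub, map_smul, map_smul, map_one, ← inv_eq, ← hτ, add_sub_cancel_right]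

end IsCayley

/-- If `x'` is inverse to `x`, then `(1 - x')⁻¹` and `(1 - x)⁻¹` add up to `1`. -/
lemma eq_one_sub_of_mul_eq_one {R : Type*} [Ring R] {x x' w w' : R} (hx : x' * x = 1)
    (hw : (1 - x) * w = 1) (hw' : w' * (1 - x') = 1) : w' = 1 - w := by
  calc w' = w' * ((1 - x) * w) := by rw [hw, mul_one]
    _ = -(w' * (1 - x')) * (x * w) := by nth_rw 1 [← hx]; noncomm_ring
    _ = (1 - x) * w - w := by rw [hw']; noncomm_ring
    _ = 1 - w := by rw [hw]

end Cayley

section SymmetricSpace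

variable {F E : Type u} [Field F] [Field E] [Algebra F E] {θ : E ≃ₐ[F] E} {ξ c : E}
  {γ : GL (Fin 3) E}

theorem IsImaginary.exists_isCayley (h2 : (2 : F) ≠ 0) (h : IsImaginary θ ξ) (hc : θ c * c = 1)
    (hγ : γ ∈ symmPoints θ) (hu : IsUnit (1 - c • γ.val)) :
    ∃ τ : Matrix (Fin 3) (Fin 3) F, antitranspose τ = τ ∧
      IsCayley c ξ γ.val (τ.map (algebraMap F E)) := by
  obtain ⟨antisymm, unit_eq⟩ := mem_symm_iff.1 hγ
  obtain ⟨u, hu⟩ := hu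
  set w := (u⁻¹).val
  have mul_w : (1 - c • γ.val) * w = 1 := hu ▸ u.mul_inv
  have conj_w : w.map θ = 1 - w := by
    refine eq_one_sub_of_mul_eq_one (x' := (c • γ.val).map θ) ?_ mul_w ?_
    · rw [Matrix.map_smul' θ c γ.val (map_mul θ), smul_mul_smul_comm, hc, one_smul]
      exact unit_eq
    · have inv_mul : (θ : E →+* E).mapMatrix (w * (1 - c • γ.val)) = 1 := by
        rw [← hu, Units.inv_mul, map_one]
      rwa [map_mul, map_sub, map_one] at inv_mul
  have antitranspose_w : antitranspose w = w := by
    have one_sub_antisymm : antitranspose (1 - c • γ.val) = 1 - c • γ.val := by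
      rw [sub_eq_add_neg, ← neg_smul, antitranspose_add, antitranspose_one, antitranspose_smul,
        antisymm]
    refine left_inv_eq_right_inv ?_ mul_w
    rw [← one_sub_antisymm, ← antitranspose_mul, mul_w, antitranspose_one]
  have rational (i j : Fin 3) : ∃ a, algebraMap F E a = ((2 * ξ) • w - ξ • 1) i j := by
    refine h.exists_algebraMap_eq h2 ?_
    have conj_entry : θ (w i j) = (1 : Matrix (Fin 3) (Fin 3) E) i j - w i j := congrFun₂ conj_w i j
    have conj_one :
        θ ((1 : Matrix (Fin 3) (Fin 3) E) i j) = (1 : Matrix (Fin 3) (Fin 3) E) i j := by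
      rw [Matrix.one_apply]; split_ifs <;> simp
    simp only [Matrix.sub_apply, Matrix.smul_apply, smul_eq_mul, map_sub, map_mul, map_ofNat,
      h.map_eq, conj_entry, conj_one]
    ring
  choose τ hτ using rational
  have map_τ : (Matrix.of τ).map (algebraMap F E) = (2 * ξ) • w - ξ • 1 := Matrix.ext hτ
  refine ⟨Matrix.of τ, Matrix.map_injective (algebraMap F E).injective ?_, ?_⟩
  · change (antitranspose (Matrix.of τ)).map (algebraMap F E) = (Matrix.of τ).map (algebraMap F E)
    rw [← antitranspose_map, map_τ, sub_eq_add_neg, ← neg_smul, antitranspose_add,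
      antitranspose_smul, antitranspose_smul, antitranspose_w, antitranspose_one]
  · rw [IsCayley, map_τ, sub_add_cancel, mul_smul_comm, mul_w]

variable {k : Type u} [Field k] [IsSepClosed k] [Algebra F k]

lemma map_algebraMap_map_algHom {F n A B : Type*} [CommRing F] [CommRing A] [CommRing B]
    [Algebra F A] [Algebra F B]
    (M : Matrix n n F) (f : A →ₐ[F] B) :
    (M.map (algebraMap F A)).map f = M.map (algebraMap F B) := by
  ext i j
  exact f.commutes (M i j)

lemma exists_charpoly_eq_prod {n : Type*} [Fintype n] [DecidableEq n] {M : Matrix n n k}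
    (hM : M.charpoly.Separable) :
    ∃ d : n → k, Function.Injective d ∧
      M.charpoly = ∏ i, (Polynomial.X - Polynomial.C (d i)) := by
  classical
  have splits := IsSepClosed.splits_of_separable M.charpoly hM
  have nodup := Polynomial.nodup_roots hM
  have card_roots : M.charpoly.roots.toFinset.card = Fintype.card n := by
    rw [Multiset.toFinset_card_of_nodup nodup, ← splits.natDegree_eq_card_roots,
      M.charpoly_natDegree_eq_dim]
  let e : n ≃ M.charpoly.roots.toFinset := Fintype.equivOfCardEq (by simp [card_roots])
  refine ⟨fun i => e i, Subtype.val_injective.comp e.injective, ?_⟩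
  rw [e.prod_comp fun x => Polynomial.X - Polynomial.C x.val, Finset.prod_coe_sort
    M.charpoly.roots.toFinset fun x => Polynomial.X - Polynomial.C x]
  conv_lhs => rw [splits.eq_prod_roots_of_monic M.charpoly_monic]
  rw [Finset.prod, Multiset.toFinset_val, nodup.dedup]

theorem exists_isCayley_isOrthonormalFrame [Infinite F] (h2 : (2 : F) ≠ 0)
    (h : IsImaginary θ ξ) (φ : E →ₐ[F] k) (hγ : γ ∈ symmPoints θ)
    (hreg : IsRegularSemisimple γ) :
    ∃ (c : E) (τ : Matrix (Fin 3) (Fin 3) F) (P : GL (Fin 3) k) (t : Fin 3 → k),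
      θ c * c = 1 ∧ antitranspose τ = τ ∧ IsCayley c ξ γ.val (τ.map (algebraMap F E)) ∧
      IsOrthonormalFrame (τ.map (algebraMap F k)) P t := by
  obtain ⟨c, hc, hu⟩ := h.exists_isUnit_one_sub_smul h2 γ.val
  obtain ⟨τ, antisymm, hτ⟩ := h.exists_isCayley h2 hc hγ hu
  have h2k : (2 : k) ≠ 0 := by
    rw [← map_ofNat (algebraMap F k) 2]
    exact (map_ne_zero _).2 h2
  have charpoly_map : (γ.val.map (φ : E →+* k)).charpoly = γ.val.charpoly.map φ :=
    Matrix.charpoly_map _ _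
  obtain ⟨d, hd, hχ⟩ := exists_charpoly_eq_prod (M := γ.val.map (φ : E →+* k))
    (charpoly_map ▸ hreg.map)
  obtain ⟨P, hP⟩ := exists_isOrthonormalFrame h2k hd
    (by rw [antitranspose_map, (mem_symm_iff.1 hγ).1]) hχ
  have hφτ := hτ.map (φ : E →+* k)
  rw [AlgHom.coe_toRingHom, map_algebraMap_map_algHom] at hφτ
  have φ2ξ : 2 * φ ξ ≠ 0 := by
    rw [← map_ofNat φ 2, ← map_mul]
    exact (map_ne_zero φ).2 (h.two_mul_ne_zero h2)
  obtain ⟨t, ht⟩ := hφτ.exists_isEigenframe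
    ((map_ne_zero φ).2 (right_ne_zero_of_mul_eq_one hc)) φ2ξ hP.toIsEigenframe
  exact ⟨c, τ, P, t, hc, antisymm, hτ, ht, hP.orthonormal⟩

end SymmetricSpace

/-! ### Two-torsion of the centralizer -/

section BaseChange

variable {F E : Type u} [Field F] [Field E] [Algebra F E] {R : Type u} [CommRing R] [Algebra F R]
  {θ : E ≃ₐ[F] E} {c ξ : E} {γ γ' : GL (Fin 3) E} {τ τ' : Matrix (Fin 3) (Fin 3) F}

lemma includeRight_injective : Function.Injective
    (Algebra.TensorProduct.includeRight : R →ₐ[F] E ⊗[F] R) :=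
  Algebra.TensorProduct.includeRight_injective (algebraMap F E).injective

lemma IsCayley.semiconjBy_baseChange_iff (hc : c ≠ 0) (hξ : 2 * ξ ≠ 0)
    (h : IsCayley c ξ γ.val (τ.map (algebraMap F E)))
    (h' : IsCayley c ξ γ'.val (τ'.map (algebraMap F E))) (x : GL (Fin 3) (E ⊗[F] R)) :
    SemiconjBy x (baseChange R γ) (baseChange R γ') ↔
      SemiconjBy x.val (τ.map (algebraMap F (E ⊗[F] R))) (τ'.map (algebraMap F (E ⊗[F] R))) := by
  let f : E →ₐ[F] E ⊗[F] R := Algebra.TensorProduct.includeLeft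
  have hf := h.map (f : E →+* E ⊗[F] R)
  have hf' := h'.map (f : E →+* E ⊗[F] R)
  have fξ : IsUnit (2 * f ξ) := by
    rw [← map_ofNat f 2, ← map_mul]
    exact hξ.isUnit.map f
  refine SemiconjBy.units_val_iff.symm.trans
    ((hf.semiconjBy_iff hf' (hc.isUnit.map f) fξ).trans ?_)
  simp only [AlgHom.coe_toRingHom, map_algebraMap_map_algHom]

lemma IsCayley.semiconjBy_embed_iff (hc : c ≠ 0) (hξ : 2 * ξ ≠ 0)
    (h : IsCayley c ξ γ.val (τ.map (algebraMap F E)))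
    (h' : IsCayley c ξ γ'.val (τ'.map (algebraMap F E))) (g : GL (Fin 3) R) :
    SemiconjBy (embed F E R g) (baseChange R γ) (baseChange R γ') ↔
      SemiconjBy g.val (τ.map (algebraMap F R)) (τ'.map (algebraMap F R)) := by
  let i : R →ₐ[F] E ⊗[F] R := Algebra.TensorProduct.includeRight
  rw [h.semiconjBy_baseChange_iff hc hξ h', ← map_algebraMap_map_algHom τ i,
    ← map_algebraMap_map_algHom τ' i]
  change g.val.map i.toRingHom * (τ.map _).map i.toRingHom =
    (τ'.map _).map i.toRingHom * g.val.map i.toRingHom ↔ _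
  rw [← Matrix.map_mul, ← Matrix.map_mul]
  exact (Matrix.map_injective includeRight_injective).eq_iff

lemma IsCayley.mem_stabilizer_iff {k : Type u} [Field k] [Algebra F k] (hc : c ≠ 0)
    (hξ : 2 * ξ ≠ 0) (h : IsCayley c ξ γ.val (τ.map (algebraMap F E))) (g : GL (Fin 3) k) :
    g ∈ stabilizer F γ k ↔ g ∈ specialOrthogonal k ∧ g ∈ torusOver τ k := by
  refine Subgroup.mem_inf.trans (and_congr_right fun _ => ?_)
  rw [Subgroup.mem_comap, Subgroup.mem_centralizer_singleton_iff, mem_torus]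
  exact h.semiconjBy_embed_iff hc hξ h g

lemma IsCayley.mem_centralizer_iff (hc : c ≠ 0) (hξ : 2 * ξ ≠ 0)
    (h : IsCayley c ξ γ.val (τ.map (algebraMap F E))) (x : GL (Fin 3) (E ⊗[F] R)) :
    x ∈ centralizer θ γ R ↔ antitranspose (x.val.map (conj θ R)) * x.val = 1 ∧
      Commute x.val (τ.map (algebraMap F (E ⊗[F] R))) := by
  refine Subgroup.mem_inf.trans (and_congr mem_unitary_iff ?_)
  rw [Subgroup.mem_centralizer_singleton_iff]
  exact h.semiconjBy_baseChange_iff hc hξ h x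

end BaseChange

section Counting

variable {F E : Type u} [Field F] [Field E] [Algebra F E] {θ : E ≃ₐ[F] E} {ξ : E}

lemma twoTorsionCard_eq_of_mem_range_iff {G X : Type*} [Group G] [Group X] {f : G →* X}
    (hf : Function.Injective f) {H : Subgroup X}
    (hH : ∀ x, x ^ 2 = 1 → (x ∈ f.range ↔ x ∈ H)) : twoTorsionCard G = twoTorsionCard H := by
  have card_eq (K : Subgroup X) : twoTorsionCard K = Nat.card {x : X // x ^ 2 = 1 ∧ x ∈ K} :=
    Nat.card_congr
      { toFun := fun x => ⟨x.1.1, congrArg Subtype.val x.2, x.1.2⟩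
        invFun := fun x => ⟨⟨x.1, x.2.2⟩, Subtype.ext x.2.1⟩
        left_inv := fun _ => rfl
        right_inv := fun _ => rfl }
  rw [twoTorsionCard_congr (MonoidHom.ofInjective hf), card_eq, card_eq]
  simp only [and_congr_right (hH _)]

/-- If `x` is fixed by `θ ⊗ 1`, then `2x` is a sum of traces `(e + θ(e)) ⊗ r`. -/
lemma IsImaginary.conj_eq_self_iff (h2 : (2 : F) ≠ 0) (h : IsImaginary θ ξ) {R : Type u}
    [CommRing R] [Algebra F R] {x : E ⊗[F] R} :
    conj θ R x = x ↔ ∃ r : R, (Algebra.TensorProduct.includeRight : R →ₐ[F] E ⊗[F] R) r = x := by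
  refine ⟨fun hx => ?_, fun ⟨r, hr⟩ => by rw [← hr]; simp [conj]⟩
  have add_conj (y : E ⊗[F] R) :
      ∃ r : R, (Algebra.TensorProduct.includeRight : R →ₐ[F] E ⊗[F] R) r = y + conj θ R y := by
    induction y with
    | zero => exact ⟨0, by simp⟩
    | tmul e r =>
      obtain ⟨a, ha⟩ := h.exists_algebraMap_eq h2 (e := e + θ e) (by
        rw [map_add, h.map_map, add_comm])
      refine ⟨a • r, ?_⟩
      have conj_tmul : conj θ R (e ⊗ₜ r) = θ e ⊗ₜ r := by simp [conj]
      rw [conj_tmul, ← TensorProduct.add_tmul, ← ha, Algebra.TensorProduct.includeRight_apply,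
        Algebra.algebraMap_eq_smul_one, TensorProduct.smul_tmul]
    | add y z hy hz =>
      obtain ⟨r, hr⟩ := hy
      obtain ⟨s, hs⟩ := hz
      exact ⟨r + s, by rw [map_add, hr, hs, map_add, add_add_add_comm]⟩
  obtain ⟨r, hr⟩ := add_conj x
  refine ⟨(2⁻¹ : F) • r, ?_⟩
  rw [map_smul, hr, hx, ← two_smul F, inv_smul_smul₀ h2]

lemma IsImaginary.twoTorsionCard_U1 (h2 : (2 : F) ≠ 0) (h : IsImaginary θ ξ) (R : Type u)
    [CommRing R] [Algebra F R] : twoTorsionCard (U1 θ R) = twoTorsionCard Rˣ := by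
  let i : R →ₐ[F] E ⊗[F] R := Algebra.TensorProduct.includeRight
  have hi : Function.Injective i := includeRight_injective
  refine (twoTorsionCard_eq_of_mem_range_iff (f := Units.map i.toMonoidHom)
    (Units.map_injective hi) fun x hx => ?_).symm
  have mem_U1_iff : x ∈ U1 θ R ↔ conj θ R x.val = x.val := by
    change x * Units.map (conj θ R).toMonoidHom x = 1 ↔ _
    rw [← hx, pow_two, mul_right_inj, Units.ext_iff]
    rfl
  rw [mem_U1_iff, h.conj_eq_self_iff h2]
  refine ⟨fun ⟨r, hr⟩ => ⟨r.val, congrArg Units.val hr⟩, fun ⟨r, hr⟩ => ?_⟩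
  have r_mul_self : r * r = 1 := hi <| by
    rw [map_mul, hr, ← pow_two, ← Units.val_pow_eq_pow_val, hx, Units.val_one, map_one]
  exact ⟨⟨r, r, r_mul_self, r_mul_self⟩, Units.ext hr⟩

lemma IsImaginary.twoTorsionCard_U1_of_algEquiv (h2 : (2 : F) ≠ 0) (h : IsImaginary θ ξ)
    {R : Type u} [CommRing R] [Algebra F R] {K : Type*} [Field K] [Algebra F K] (e : R ≃ₐ[F] K) :
    twoTorsionCard (U1 θ R) = 2 := by
  have h2K : (2 : K) ≠ 0 := by
    rw [← map_ofNat (algebraMap F K) 2]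
    exact (map_ne_zero _).2 h2
  rw [h.twoTorsionCard_U1 h2, twoTorsionCard_congr (Units.mapEquiv (e : R ≃* K)),
    twoTorsionCard_units_of_isDomain K h2K]

lemma IsImaginary.map_conj_eq_self_iff (h2 : (2 : F) ≠ 0) (h : IsImaginary θ ξ) {R : Type u}
    [CommRing R] [Algebra F R] {n : Type*} {M : Matrix n n (E ⊗[F] R)} :
    M.map (conj θ R) = M ↔ ∃ N : Matrix n n R,
      N.map (Algebra.TensorProduct.includeRight : R →ₐ[F] E ⊗[F] R) = M := by
  refine ⟨fun hM => ?_, ?_⟩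
  · choose N hN using fun i j => (h.conj_eq_self_iff h2).1 (congrFun (congrFun hM i) j)
    exact ⟨Matrix.of N, by ext i j; exact hN i j⟩
  · rintro ⟨N, rfl⟩
    ext i j
    exact (h.conj_eq_self_iff h2).2 ⟨N i j, rfl⟩

/-- An element `x` of the centralizer is symmetric, so it is unitary precisely when `x̄ x = 1`; an
involution therefore has to be fixed by the conjugation. -/
theorem IsCayley.mem_range_embed_torus_iff (h2 : (2 : F) ≠ 0) (h : IsImaginary θ ξ) {k : Type u}
    [Field k] [Algebra F k] (φ : E →ₐ[F] k) {c : E} (hc : c ≠ 0) {γ : GL (Fin 3) E}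
    {τ : Matrix (Fin 3) (Fin 3) F} (hτ : IsCayley c ξ γ.val (τ.map (algebraMap F E)))
    {P : GL (Fin 3) k} {t : Fin 3 → k} (hP : IsOrthonormalFrame (τ.map (algebraMap F k)) P t)
    {x : GL (Fin 3) (E ⊗[F] F)} (hx : x ^ 2 = 1) :
    x ∈ ((embed F E F).comp (torus τ).subtype).range ↔ x ∈ centralizer θ γ F := by
  let i : F →ₐ[F] E ⊗[F] F := Algebra.TensorProduct.includeRight
  have x_mul_self : x.val * x.val = 1 := by rw [← Units.val_mul, ← pow_two, hx, Units.val_one]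
  have unitary_iff (hxτ : Commute x.val (τ.map (algebraMap F (E ⊗[F] F)))) :
      antitranspose (x.val.map (conj θ F)) * x.val = 1 ↔ x.val.map (conj θ F) = x.val := by
    let ψ : E ⊗[F] F →ₐ[F] k := φ.comp (Algebra.TensorProduct.rid F F E).toAlgHom
    have ψ_injective : Function.Injective (ψ : E ⊗[F] F →+* k) :=
      φ.toRingHom.injective.comp (Algebra.TensorProduct.rid F F E).injective
    rw [← map_algebraMap_map_algHom τ ψ] at hP
    rw [show antitranspose (x.val.map (conj θ F)) = _ from
      antitranspose_map (conj θ F : E ⊗[F] F →+* E ⊗[F] F) x.val,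
      hP.antitranspose_eq_self_of_map ψ_injective hxτ]
    rw [AlgHom.coe_toRingHom, ← x_mul_self]
    exact x.isUnit.mul_left_inj
  rw [hτ.mem_centralizer_iff hc (h.two_mul_ne_zero h2), and_congr_left unitary_iff,
    h.map_conj_eq_self_iff h2]
  constructor
  · rintro ⟨g, rfl⟩
    exact ⟨⟨g.1.val, rfl⟩, map_algebraMap_map_algHom τ i ▸ Commute.map g.2 i.mapMatrix⟩
  · rintro ⟨⟨N, hN⟩, hxτ⟩
    rw [← hN, ← map_algebraMap_map_algHom τ i] at hxτ
    have N_mul_self : N * N = 1 := Matrix.map_injective includeRight_injective <| by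
      change i.mapMatrix (N * N) = i.mapMatrix 1
      rw [map_mul, map_one, ← x_mul_self, ← hN]
      rfl
    have N_comm : Commute N τ := (commute_map_iff (f := i.toRingHom) includeRight_injective).1 hxτ
    exact ⟨⟨⟨N, N, N_mul_self, N_mul_self⟩, N_comm⟩, Units.ext hN⟩

theorem IsCayley.twoTorsionCard_centralizer (h2 : (2 : F) ≠ 0) (h : IsImaginary θ ξ) {k : Type u}
    [Field k] [Algebra F k] (φ : E →ₐ[F] k) {c : E} (hc : c ≠ 0) {γ : GL (Fin 3) E}
    {τ : Matrix (Fin 3) (Fin 3) F} (hτ : IsCayley c ξ γ.val (τ.map (algebraMap F E)))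
    {P : GL (Fin 3) k} {t : Fin 3 → k} (hP : IsOrthonormalFrame (τ.map (algebraMap F k)) P t) :
    twoTorsionCard (centralizer θ γ F) = twoTorsionCard (torus τ) :=
  (twoTorsionCard_eq_of_mem_range_iff (f := (embed F E F).comp (torus τ).subtype)
    ((generalLinearGroup_map_injective includeRight_injective).comp (torus τ).subtype_injective)
    fun _ hx => hτ.mem_range_embed_torus_iff h2 h φ hc hP hx).symm

section Types

variable (h2 : (2 : F) ≠ 0) (h : IsImaginary θ ξ) {γ : GL (Fin 3) E}

include h2 h

lemma IsTypeI.twoTorsionCard_eq (hγ : IsTypeI θ γ) : twoTorsionCard (centralizer θ γ F) = 4 := by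
  have h2E : (2 : E) ≠ 0 := by
    rw [← map_ofNat (algebraMap F E) 2]
    exact (map_ne_zero _).2 h2
  obtain ⟨e, -⟩ := hγ
  rw [twoTorsionCard_congr (e F), twoTorsionCard_prod,
    h.twoTorsionCard_U1_of_algEquiv h2 AlgEquiv.refl,
    twoTorsionCard_congr (Units.mapEquiv (Algebra.TensorProduct.rid F F E : E ⊗[F] F ≃* E)),
    twoTorsionCard_units_of_isDomain E h2E]

lemma IsTypeII.twoTorsionCard_eq (hγ : IsTypeII θ γ) :
    twoTorsionCard (centralizer θ γ F) = 8 := by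
  obtain ⟨e, -⟩ := hγ
  rw [twoTorsionCard_congr (e F), twoTorsionCard_prod, twoTorsionCard_prod,
    h.twoTorsionCard_U1_of_algEquiv h2 AlgEquiv.refl]

lemma IsTypeIII.twoTorsionCard_eq (hγ : IsTypeIII θ γ) :
    twoTorsionCard (centralizer θ γ F) = 4 := by
  obtain ⟨K, _, _, -, -, e, -⟩ := hγ
  rw [twoTorsionCard_congr (e F), twoTorsionCard_prod,
    h.twoTorsionCard_U1_of_algEquiv h2 AlgEquiv.refl,
    h.twoTorsionCard_U1_of_algEquiv h2 (Algebra.TensorProduct.rid F F K)]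

lemma IsTypeIV.twoTorsionCard_eq (hγ : IsTypeIV θ γ) :
    twoTorsionCard (centralizer θ γ F) = 2 := by
  obtain ⟨K, _, _, -, e, -⟩ := hγ
  rw [twoTorsionCard_congr (e F),
    h.twoTorsionCard_U1_of_algEquiv h2 (Algebra.TensorProduct.rid F F K)]

end Types

end Counting

/-! ### Stable classes and rational orbits -/

section Descent

variable {n F k : Type*} [Fintype n] [DecidableEq n] [Field F] [Field k] [Algebra F k]

/-- The quotients `g s(g)⁻¹` form a cocycle; trivializing it moves `g` into `GL(F)`. -/
theorem exists_eq_mul_map_of_forall_h1_eq_one [IsGalois F k] {A : Subgroup (GL n k)}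
    [MulDistribMulAction (k ≃ₐ[F] k) A]
    (smul_val : ∀ (s : k ≃ₐ[F] k) (a : A),
      (s • a).1 = Matrix.GeneralLinearGroup.map (s : k →ₐ[F] k).toRingHom a.1)
    (hA : ∀ x : H1 (k ≃ₐ[F] k) A, x = 1) {g : GL n k}
    (hg : ∀ s : k ≃ₐ[F] k,
      g * (Matrix.GeneralLinearGroup.map (s : k →ₐ[F] k).toRingHom g)⁻¹ ∈ A) :
    ∃ a ∈ A, ∃ q : GL n F, g = a * Matrix.GeneralLinearGroup.map (algebraMap F k) q := by
  let a : Cocycle (k ≃ₐ[F] k) A :=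
    { toFun := fun s => ⟨_, hg s⟩
      locallyConstant := IsLocallyConstant.desc _ Subtype.val
        ((isLocallyConstant_map_algEquiv g).comp fun x => g * x⁻¹) Subtype.val_injective
      map_mul := fun s t => Subtype.ext <| by
        rw [Subgroup.coe_mul, smul_val, map_mul, map_inv, mul_assoc, inv_mul_cancel_left]
        rfl }
  obtain ⟨b, hb⟩ := Quotient.exact (hA (Quotient.mk _ a))
  have fixed (s : k ≃ₐ[F] k) :
      Matrix.GeneralLinearGroup.map (s : k →ₐ[F] k).toRingHom (b.1⁻¹ * g) = b.1⁻¹ * g := by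
    have trivialized : 1 = b.1⁻¹ * (g * (_)⁻¹) * _ :=
      (congrArg Subtype.val (hb s)).trans (congrArg (b.1⁻¹ * (a.toFun s).1 * ·) (smul_val s b))
    rw [eq_comm, mul_eq_one_iff_eq_inv, ← mul_assoc, mul_inv_eq_iff_eq_mul] at trivialized
    rw [map_mul, map_inv, trivialized]
  obtain ⟨q, hq⟩ := exists_generalLinearGroup_map_eq fixed
  exact ⟨b.1, b.2, q, by rw [hq, mul_inv_cancel_left]⟩

end Descent

variable {F E k : Type u} [Field F] [Field E] [Algebra F E] [Field k] [Algebra F k]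
  {θ : E ≃ₐ[F] E} {c ξ : E} {γ γ' : GL (Fin 3) E} {τ τ' : Matrix (Fin 3) (Fin 3) F}

lemma mem_stableClass_iff : γ' ∈ stableClass θ k γ ↔ γ' ∈ symmPoints θ ∧
    ∃ g ∈ specialOrthogonal k, SemiconjBy (embed F E k g) (baseChange k γ') (baseChange k γ) := by
  refine and_congr_right fun _ => exists_congr fun g => and_congr_right fun _ => ?_
  rw [mul_assoc, inv_mul_eq_iff_eq_mul, eq_comm]
  rfl

lemma mem_rationalOrbit_iff : γ' ∈ rationalOrbit θ γ ↔ γ' ∈ symmPoints θ ∧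
    ∃ g ∈ specialOrthogonal F,
      SemiconjBy (Matrix.GeneralLinearGroup.map (algebraMap F E) g) γ' γ := by
  refine and_congr_right fun _ => exists_congr fun g => and_congr_right fun _ => ?_
  rw [mul_assoc, inv_mul_eq_iff_eq_mul, eq_comm]
  rfl

lemma embed_map_algebraMap (g : GL (Fin 3) F) :
    embed F E k (Matrix.GeneralLinearGroup.map (algebraMap F k) g) =
      baseChange k (Matrix.GeneralLinearGroup.map (algebraMap F E) g) := by
  ext i j
  exact ((Algebra.TensorProduct.includeRight : k →ₐ[F] E ⊗[F] k).commutes (g.val i j)).trans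
    ((Algebra.TensorProduct.includeLeft : E →ₐ[F] E ⊗[F] k).commutes (g.val i j)).symm

lemma rationalOrbit_subset_stableClass : rationalOrbit θ γ ⊆ stableClass θ k γ := by
  intro γ' hγ'
  obtain ⟨symm_γ', g, hg, conj⟩ := mem_rationalOrbit_iff.1 hγ'
  refine mem_stableClass_iff.2 ⟨symm_γ', _, map_mem_specialOrthogonal (Algebra.ofId F k) hg, ?_⟩
  rw [AlgHom.toRingHom_eq_coe, Algebra.toRingHom_ofId, embed_map_algebraMap]
  exact conj.map (baseChange k)

lemma isUnit_one_sub_smul_of_mem_stableClass (hu : IsUnit (1 - c • γ.val))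
    (hγ' : γ' ∈ stableClass θ k γ) : IsUnit (1 - c • γ'.val) := by
  obtain ⟨-, g, -, conj⟩ := mem_stableClass_iff.1 hγ'
  let i : E →ₐ[F] E ⊗[F] k := Algebra.TensorProduct.includeLeft
  have conj_one_sub : SemiconjBy (embed F E k g).val (i.mapMatrix (1 - c • γ'.val))
      (i.mapMatrix (1 - c • γ.val)) := by
    rw [map_sub, map_sub, map_one]
    exact (SemiconjBy.one_right _).sub_right (conj.units_val.smul_right c)
  have unit_map := (Units.isUnit_units_mul (embed F E k g) _).1
    (conj_one_sub.eq ▸ (hu.map i.mapMatrix).mul (embed F E k g).isUnit)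
  rw [Matrix.isUnit_iff_isUnit_det, ← AlgHom.map_det] at unit_map
  rw [Matrix.isUnit_iff_isUnit_det]
  exact (isUnit_map_iff i _).1 unit_map

lemma mem_specialOrthogonal_of_map {g : GL (Fin 3) F}
    (hg : Matrix.GeneralLinearGroup.map (algebraMap F k) g ∈ specialOrthogonal k) :
    g ∈ specialOrthogonal F := by
  have inj := (algebraMap F k).injective
  rw [mem_specialOrthogonal_iff] at hg ⊢
  change antitranspose (g.val.map (algebraMap F k)) * g.val.map (algebraMap F k) = 1 ∧
    ((algebraMap F k).mapMatrix g.val).det = 1 at hg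
  rw [antitranspose_map, ← Matrix.map_mul, ← RingHom.map_det, map_eq_one_iff _ inj] at hg
  exact ⟨Matrix.map_injective inj (hg.1.trans (map_one (algebraMap F k).mapMatrix).symm), hg.2⟩

theorem IsCayley.stableClass_eq_rationalOrbit [IsGalois F k] (h2 : (2 : F) ≠ 0)
    (h : IsImaginary θ ξ) (hc : θ c * c = 1)
    (hτ : IsCayley c ξ γ.val (τ.map (algebraMap F E)))
    (hH1 : ∀ x : H1 (k ≃ₐ[F] k) (stabilizer F γ k), x = 1) :
    stableClass θ k γ = rationalOrbit θ γ := by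
  have hc0 : c ≠ 0 := right_ne_zero_of_mul_eq_one hc
  have hξ := h.two_mul_ne_zero h2
  refine Set.Subset.antisymm (fun γ' hγ' => ?_) rationalOrbit_subset_stableClass
  obtain ⟨u, hu, -⟩ := hτ.exists_eq_smul_inv hξ.isUnit
  obtain ⟨τ', -, hτ'⟩ := h.exists_isCayley h2 hc hγ'.1
    (isUnit_one_sub_smul_of_mem_stableClass (hu ▸ u.isUnit) hγ')
  obtain ⟨symm_γ', g, hg, conj⟩ := mem_stableClass_iff.1 hγ'
  rw [hτ'.semiconjBy_embed_iff hc0 hξ hτ] at conj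
  have conj_map (s : k ≃ₐ[F] k) :
      SemiconjBy (g.val.map s) (τ'.map (algebraMap F k)) (τ.map (algebraMap F k)) := by
    have := SemiconjBy.map conj (s : k →ₐ[F] k).mapMatrix
    rwa [AlgHom.mapMatrix_apply, AlgHom.mapMatrix_apply, AlgHom.mapMatrix_apply,
      map_algebraMap_map_algHom, map_algebraMap_map_algHom] at this
  obtain ⟨a, ha, q, rfl⟩ := exists_eq_mul_map_of_forall_h1_eq_one (fun _ _ => rfl) hH1
    (g := g) fun s => (hτ.mem_stabilizer_iff hc0 hξ _).2
      ⟨mul_mem hg (inv_mem (map_mem_specialOrthogonal (s : k →ₐ[F] k) hg)),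
        conj.mul_left (conj_map s).units_inv_symm_left⟩
  obtain ⟨ha, haτ⟩ := (hτ.mem_stabilizer_iff hc0 hξ _).1 ha
  refine mem_rationalOrbit_iff.2 ⟨symm_γ', q,
    mem_specialOrthogonal_of_map ((Subgroup.mul_mem_cancel_left _ ha).1 hg), ?_⟩
  have conj_q : SemiconjBy (q.val.map (algebraMap F k)) (τ'.map (algebraMap F k))
      (τ.map (algebraMap F k)) := by
    have := SemiconjBy.mul_left (Commute.units_inv_left haτ) conj
    rwa [Units.val_mul, Units.inv_mul_cancel_left] at this
  refine SemiconjBy.units_val_iff.1 ((hτ'.semiconjBy_iff hτ hc0.isUnit hξ.isUnit).2 ?_)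
  change q.val.map _ * _ = _ * q.val.map _ at conj_q ⊢
  rw [← Matrix.map_mul, ← Matrix.map_mul] at conj_q ⊢
  rw [Matrix.map_injective (algebraMap F k).injective conj_q]

/-! ### Representatives of the square classes -/

lemma isKleinFour_quotient_square {G : Type*} [CommGroup G]
    (hindex : (Subgroup.square G).index = 4) : IsKleinFour (G ⧸ Subgroup.square G) where
  card_four := hindex
  exponent_two := by
    have exponent_dvd : Monoid.exponent (G ⧸ Subgroup.square G) ∣ 2 :=
      Monoid.exponent_dvd_of_forall_pow_eq_one fun q => by
        obtain ⟨g, rfl⟩ := QuotientGroup.mk_surjective q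
        exact (QuotientGroup.eq_one_iff _).2 (Subgroup.mem_square.2 (IsSquare.sq g))
    refine ((Nat.dvd_prime Nat.prime_two).1 exponent_dvd).resolve_left fun exponent_one => ?_
    have := Monoid.exp_eq_one_iff.1 exponent_one
    rw [Subgroup.index, Nat.card_of_subsingleton 1] at hindex
    omega

lemma exists_eq_mul_sq_of_index_square_eq_four {G : Type*} [CommGroup G]
    (hindex : (Subgroup.square G).index = 4) {u v : G} (hu : ¬IsSquare u) (hv : ¬IsSquare v)
    (huv : ¬IsSquare (u * v)) (x : G) :
    ∃ a ∈ ({1, u, v, u * v} : Set G), ∃ y, x = a * y ^ 2 := by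
  have := isKleinFour_quotient_square hindex
  let π : G →* G ⧸ Subgroup.square G := QuotientGroup.mk' _
  have map_ne_one {a : G} (ha : ¬IsSquare a) : π a ≠ 1 :=
    fun h => ha (Subgroup.mem_square.1 ((QuotientGroup.eq_one_iff a).1 h))
  have map_u_ne : π u ≠ π v := fun h => map_ne_one huv <| by
    rw [map_mul, h, IsKleinFour.mul_self]
  have cover : ∃ a ∈ ({1, u, v, u * v} : Set G), π a = π x := by
    by_contra! not_mem
    refine not_mem (u * v) (by simp) ((map_mul π u v).trans ?_)
    exact (IsKleinFour.eq_mul_of_ne_all (map_ne_one hu) (map_ne_one hv) map_u_ne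
      (map_one π ▸ (not_mem 1 (by simp)).symm) (not_mem u (by simp)).symm
      (not_mem v (by simp)).symm).symm
  obtain ⟨a, ha, hax⟩ := cover
  obtain ⟨y, hy⟩ := Subgroup.mem_square.1 (QuotientGroup.eq.1 hax)
  exact ⟨a, ha, y, by rw [pow_two, ← hy, mul_inv_cancel_left]⟩

section Valuation

variable {F : Type*} [Field F] [ValuativeRel F]

lemma not_isSquare_unit_mul_irreducible {ϖ : 𝒪[F]} (hϖ : Irreducible ϖ) (v : 𝒪[F]ˣ) :
    ¬IsSquare ((v : 𝒪[F]) * (ϖ : F)) := by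
  rintro ⟨y, hy⟩
  have integral : ValuativeRel.valuation F y ≤ 1 := by
    refine (pow_le_one_iff two_ne_zero).1 ?_
    rw [← map_pow, pow_two, ← hy]
    exact ((v : 𝒪[F]) * ϖ).2
  exact ((irreducible_units_mul v).2 hϖ).not_isSquare ⟨⟨y, integral⟩, Subtype.ext hy⟩

lemma exists_units_eq_of_algebraMap_eq {E : Type*} [Field E] [Algebra F E]
    (ζ : (integralClosure 𝒪[F] E)ˣ) {w : F}
    (hw : algebraMap F E w = (ζ : integralClosure 𝒪[F] E)) : ∃ u : 𝒪[F]ˣ, (u : 𝒪[F]) = w := by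
  have mem_of_eq {ζ : integralClosure 𝒪[F] E} {w : F} (hw : algebraMap F E w = ζ) : w ∈ 𝒪[F] :=
    Valuation.Integers.mem_of_integral
      (Valuation.integer.integers (ValuativeRel.valuation F))
      ((isIntegral_algHom_iff (IsScalarTower.toAlgHom 𝒪[F] F E)
        (algebraMap F E).injective).1 (hw ▸ ζ.2))
  have mul_inv := congrArg Subtype.val ζ.mul_inv
  have hw_inv : algebraMap F E w⁻¹ = (ζ⁻¹ : (integralClosure 𝒪[F] E)ˣ) := by
    rw [map_inv₀, hw]
    exact inv_eq_of_mul_eq_one_right mul_inv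
  have w_ne_zero : w ≠ 0 :=
    (map_ne_zero (algebraMap F E)).1 (hw ▸ left_ne_zero_of_mul_eq_one mul_inv)
  exact ⟨⟨⟨w, mem_of_eq hw⟩, ⟨w⁻¹, mem_of_eq hw_inv⟩, Subtype.ext (mul_inv_cancel₀ w_ne_zero),
    Subtype.ext (inv_mul_cancel₀ w_ne_zero)⟩, rfl⟩

end Valuation

theorem exists_eq_mul_sq {F E : Type u} [Field F] [ValuativeRel F] [TopologicalSpace F]
    [IsNonarchimedeanLocalField F] (hp : ringChar 𝓀[F] ≠ 2) [Field E] [Algebra F E]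
    {θ : E ≃ₐ[F] E} {ϖ : 𝒪[F]} (hϖ : Irreducible ϖ) (ξ : (integralClosure 𝒪[F] E)ˣ)
    (h : IsImaginary θ ((ξ : integralClosure 𝒪[F] E) : E)) {D : F} (hD : D ≠ 0) :
    ∃ ν f : F, D = ν * f ^ 2 ∧ algebraMap F E ν ∈
      ({1, ((ξ : integralClosure 𝒪[F] E) : E) ^ 2, algebraMap F E ϖ,
          ((ξ : integralClosure 𝒪[F] E) : E) ^ 2 * algebraMap F E ϖ} : Set E) := by
  have h2 := two_ne_zero_of_ringChar_residueField_ne_two hp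
  obtain ⟨u', hu'⟩ := h.exists_sq_eq h2
  obtain ⟨u, rfl⟩ := exists_units_eq_of_algebraMap_eq (ξ ^ 2) hu'
  have not_isSquare_u : ¬IsSquare ((u : 𝒪[F]) : F) := by
    rintro ⟨y, hy⟩
    rw [hy, map_mul, ← pow_two] at hu'
    rcases sq_eq_sq_iff_eq_or_eq_neg.1 hu' with eq_ξ | eq_neg
    · exact h.algebraMap_ne h2 y eq_ξ
    · exact h.algebraMap_ne h2 (-y) (by rw [map_neg, eq_neg, neg_neg])
  have u_ne_zero : ((u : 𝒪[F]) : F) ≠ 0 := fun h0 => u.ne_zero (Subtype.ext h0)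
  have ϖ_ne_zero : (ϖ : F) ≠ 0 := fun h0 => hϖ.ne_zero (Subtype.ext h0)
  obtain ⟨a, ha, y, hy⟩ := exists_eq_mul_sq_of_index_square_eq_four
    (u := Units.mk0 _ u_ne_zero) (v := Units.mk0 _ ϖ_ne_zero)
    (index_square_units_of_finiteDimensional F hp F)
    (fun hu => not_isSquare_u ((isSquare_units_iff).1 hu))
    (fun hϖ' => not_isSquare_unit_mul_irreducible hϖ 1 (by simpa using hϖ'.map (Units.coeHom F)))
    (fun huϖ => not_isSquare_unit_mul_irreducible hϖ u (by simpa using huϖ.map (Units.coeHom F)))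
    (Units.mk0 D hD)
  refine ⟨a, y, congrArg Units.val hy, ?_⟩
  rcases ha with rfl | rfl | rfl | rfl <;> simp [hu']

/-! ### Rational eigenvalues -/

section Eigenline

variable {n F k : Type*} [Fintype n] [DecidableEq n] [Field F] [Field k] [Algebra F k]
  {τ : Matrix n n F} {P : GL n k} {t : n → k}

/-- `τ` acts on the eigenline, which is the image of the rational matrix `N`, by a rational
scalar. -/
lemma IsEigenframe.exists_algebraMap_eq_of_conjDiagonal_single
    (h : IsEigenframe (τ.map (algebraMap F k)) P t) {N : Matrix n n F} {i : n} {s : k}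
    (hs : s ≠ 0) (hN : conjDiagonal P (Pi.single i s) = N.map (algebraMap F k)) :
    ∃ z, algebraMap F k z = t i := by
  have map_mul_eq : (τ * N).map (algebraMap F k) = t i • N.map (algebraMap F k) := by
    rw [Matrix.map_mul, ← h.conjDiagonal_eq, ← hN, ← map_mul, ← map_smul]
    congr 1
    ext j
    obtain rfl | hj := eq_or_ne j i <;> simp [*]
  have N_ne_zero : N ≠ 0 := by
    rintro rfl
    rw [Matrix.map_zero _ (map_zero _), map_eq_zero_iff _ (conjDiagonal_injective P),
      Pi.single_eq_zero_iff] at hN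
    exact hs hN
  obtain ⟨a, b, hab⟩ : ∃ a b, N a b ≠ 0 := by
    by_contra! h0
    exact N_ne_zero (Matrix.ext h0)
  refine ⟨(τ * N) a b / N a b, ?_⟩
  rw [map_div₀, div_eq_iff ((map_ne_zero _).2 hab)]
  exact congrFun (congrFun map_mul_eq a) b

end Eigenline

variable {F k : Type*} [Field F] [Field k] [Algebra F k]
  {τ : Matrix (Fin 3) (Fin 3) F} {P : GL (Fin 3) k} {t : Fin 3 → k}

lemma exists_sq_eq_one_of_two_lt_twoTorsionCard_torus (hcard : 2 < twoTorsionCard (torus τ)) :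
    ∃ M, Commute M τ ∧ M ^ 2 = 1 ∧ M ≠ 1 ∧ M ≠ -1 := by
  by_contra! h
  let negOne : torus τ := ⟨-1, mem_torus.2 (Commute.neg_one_left τ)⟩
  have subset_pair : {g : torus τ | g ^ 2 = 1} ⊆ {1, negOne} := by
    intro g hg
    by_cases hg1 : g.1.val = 1
    · exact Or.inl (Subtype.ext (Units.ext hg1))
    · exact Or.inr (Subtype.ext (Units.ext
        (h g.1.val g.2 (congrArg (fun x : torus τ => x.1.val) hg) hg1)))
  have card_le := (Set.ncard_le_ncard subset_pair).trans (Set.ncard_insert_le 1 {negOne})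
  rw [Set.ncard_singleton, ← Nat.card_coe_set_eq] at card_le
  exact absurd hcard card_le.not_gt

lemma exists_one_add_zsmul_eq_single {ε : Fin 3 → k} (hε : ε ^ 2 = 1) (h1 : ε ≠ 1)
    (h2 : ε ≠ -1) : ∃ (s : ℤ) (i : Fin 3), 1 + s • ε = Pi.single i 2 := by
  have sign (j : Fin 3) : ∃ b : Bool, ε j = if b then 1 else -1 :=
    (sq_eq_one_iff.1 (congrFun hε j)).elim (fun h => ⟨true, h⟩) fun h => ⟨false, h⟩
  choose f hf using sign
  have odd_one_out (f : Fin 3 → Bool) :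
      (∃ b, ∀ j, f j = b) ∨ ∃ i, ∀ j ≠ i, f j = !f i := by
    decide +revert
  rcases odd_one_out f with ⟨_ | _, all_eq⟩ | ⟨i, hi⟩
  · exact absurd (funext fun j => by simp [hf, all_eq]) h2
  · exact absurd (funext fun j => by simp [hf, all_eq]) h1
  · refine ⟨if f i then 1 else -1, i, funext fun j => ?_⟩
    obtain rfl | hj := eq_or_ne j i
    · cases hfj : f j <;> norm_num [hf, hfj]
    · cases hfi : f i <;> simp [hf, hi j hj, hfi, hj]

theorem IsEigenframe.exists_conjDiagonal_single (h : IsEigenframe (τ.map (algebraMap F k)) P t)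
    (hcard : 2 < twoTorsionCard (torus τ)) :
    ∃ (N : Matrix (Fin 3) (Fin 3) F) (i : Fin 3),
      conjDiagonal P (Pi.single i 2) = N.map (algebraMap F k) := by
  obtain ⟨M, hMτ, hM, hM1, hM2⟩ := exists_sq_eq_one_of_two_lt_twoTorsionCard_torus hcard
  obtain ⟨ε, hε⟩ := h.exists_conjDiagonal_eq
    ((commute_map_iff (algebraMap F k).injective).2 hMτ)
  change conjDiagonal P ε = (algebraMap F k).mapMatrix M at hε
  have map_injective : Function.Injective ((algebraMap F k).mapMatrix (m := Fin 3)) :=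
    Matrix.map_injective (algebraMap F k).injective
  have ε_sq : ε ^ 2 = 1 := conjDiagonal_injective P <| by
    rw [map_pow, hε, ← map_pow, hM, map_one, map_one]
  have ε_ne_one : ε ≠ 1 := by
    rintro rfl
    exact hM1 (map_injective (by rw [← hε, map_one, map_one]))
  have ε_ne_neg_one : ε ≠ -1 := by
    rintro rfl
    exact hM2 (map_injective (by rw [← hε, map_neg, map_one, map_neg, map_one]))
  obtain ⟨s, i, hs⟩ := exists_one_add_zsmul_eq_single ε_sq ε_ne_one ε_ne_neg_one
  refine ⟨1 + s • M, i, ?_⟩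
  change _ = (algebraMap F k).mapMatrix _
  rw [← hs, map_add, map_zsmul, hε, map_one, map_add, map_zsmul, map_one]

/-- Complete the square. -/
lemma exists_eq_sq_sub_C (h2 : (2 : F) ≠ 0) {q : Polynomial F} (hq : q.Monic)
    (hdeg : q.natDegree = 2) :
    ∃ x D, q = (Polynomial.X - Polynomial.C x) ^ 2 - Polynomial.C D := by
  obtain ⟨x, hx⟩ : ∃ x, 2 * x = -q.coeff 1 := ⟨_, mul_div_cancel₀ _ h2⟩
  refine ⟨x, x ^ 2 - q.coeff 0, ?_⟩
  have expand : q = Polynomial.X ^ 2 + Polynomial.C (q.coeff 1) * Polynomial.X +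
      Polynomial.C (q.coeff 0) := by
    conv_lhs => rw [hq.as_sum, hdeg, Finset.sum_range_succ, Finset.sum_range_one]
    ring
  replace hx := congrArg Polynomial.C hx
  simp only [map_mul, map_neg, map_ofNat] at hx
  rw [map_sub, map_pow]
  linear_combination expand + Polynomial.X * hx

theorem IsEigenframe.exists_charpoly_eq (h2 : (2 : F) ≠ 0)
    (h : IsEigenframe (τ.map (algebraMap F k)) P t) (hcard : 2 < twoTorsionCard (torus τ)) :
    ∃ z x D : F, D ≠ 0 ∧ τ.charpoly =
      (Polynomial.X - Polynomial.C z) *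
        ((Polynomial.X - Polynomial.C x) ^ 2 - Polynomial.C D) := by
  have h2k : (2 : k) ≠ 0 := by
    rw [← map_ofNat (algebraMap F k) 2]
    exact (map_ne_zero _).2 h2
  have charpoly_map : τ.charpoly.map (algebraMap F k) =
      ∏ i, (Polynomial.X - Polynomial.C (t i)) := by
    rw [← charpoly_conjDiagonal P, h.conjDiagonal_eq, Matrix.charpoly_map]
  obtain ⟨N, i, hN⟩ := h.exists_conjDiagonal_single hcard
  obtain ⟨z, hz⟩ := h.exists_algebraMap_eq_of_conjDiagonal_single h2k hN
  have isRoot : τ.charpoly.IsRoot z := by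
    rw [← Polynomial.isRoot_map_iff (algebraMap F k).injective, charpoly_map, hz,
      Polynomial.isRoot_prod]
    exact ⟨i, Finset.mem_univ i, Polynomial.root_X_sub_C.2 rfl⟩
  obtain ⟨q, hq⟩ := Polynomial.dvd_iff_isRoot.2 isRoot
  have q_monic : q.Monic :=
    (Polynomial.monic_X_sub_C z).of_mul_monic_left (hq ▸ τ.charpoly_monic)
  have q_natDegree : q.natDegree = 2 := by
    have natDegree_eq := τ.charpoly_natDegree_eq_dim
    rw [hq, (Polynomial.monic_X_sub_C z).natDegree_mul q_monic, Polynomial.natDegree_X_sub_C,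
      Fintype.card_fin] at natDegree_eq
    omega
  obtain ⟨x, D, rfl⟩ := exists_eq_sq_sub_C h2 q_monic q_natDegree
  refine ⟨z, x, D, ?_, hq⟩
  rintro rfl
  have separable : τ.charpoly.Separable :=
    (Polynomial.separable_map (algebraMap F k)).1
      (charpoly_map ▸ Polynomial.separable_prod_X_sub_C_iff.2 h.injective)
  have dvd : (Polynomial.X - Polynomial.C x) * (Polynomial.X - Polynomial.C x) ∣ τ.charpoly :=
    hq ▸ ⟨Polynomial.X - Polynomial.C z, by rw [map_zero]; ring⟩
  exact Polynomial.not_isUnit_X_sub_C x (separable.squarefree _ dvd)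

/-! ### The inverse Cayley transform -/

section CharpolyEq

variable {n A : Type*} [Fintype n] [DecidableEq n] [CommRing A]

lemma isUnit_scalar_sub_iff_of_charpoly_eq {M N : Matrix n n A} (h : M.charpoly = N.charpoly)
    (a : A) : IsUnit (Matrix.scalar n a - M) ↔ IsUnit (Matrix.scalar n a - N) := by
  rw [Matrix.isUnit_iff_isUnit_det, Matrix.isUnit_iff_isUnit_det, ← Matrix.eval_charpoly,
    ← Matrix.eval_charpoly, h]

lemma isUnit_add_smul_one_iff_of_charpoly_eq {M N : Matrix n n A} (h : M.charpoly = N.charpoly)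
    (a : A) : IsUnit (M + a • 1) ↔ IsUnit (N + a • 1) := by
  have add_eq (L : Matrix n n A) : L + a • 1 = -(Matrix.scalar n (-a) - L) := by
    rw [Matrix.scalar_apply, ← Matrix.smul_one_eq_diagonal, neg_smul]
    abel
  rw [add_eq, add_eq, IsUnit.neg_iff, IsUnit.neg_iff, isUnit_scalar_sub_iff_of_charpoly_eq h]

lemma IsCayley.isUnit_add_smul_one {c ξ : A} {γ τ : Matrix n n A} (h : IsCayley c ξ γ τ)
    (hξ : IsUnit (2 * ξ)) : IsUnit (τ + ξ • 1) := by
  obtain ⟨u, -, hτ⟩ := h.exists_eq_smul_inv hξ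
  obtain ⟨s, hs⟩ := hξ
  rw [hτ, ← hs]
  exact (s • u⁻¹).isUnit

end CharpolyEq

lemma antitranspose_val_inv {A : Type*} [CommRing A] {u : GL (Fin 3) A}
    (hu : antitranspose u.val = u.val) : antitranspose (u⁻¹).val = (u⁻¹).val := by
  refine (Units.inv_eq_of_mul_eq_one_left ?_).symm
  rw [← hu, ← antitranspose_mul, Units.mul_inv, antitranspose_one]

variable {F E : Type u} [Field F] [Field E] [Algebra F E] {θ : E ≃ₐ[F] E} {c ξ : E}
  {γ : GL (Fin 3) E} {τ τ' : Matrix (Fin 3) (Fin 3) F}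

lemma IsImaginary.map_add_smul_one_map (h : IsImaginary θ ξ) :
    (τ.map (algebraMap F E) + ξ • 1).map θ = τ.map (algebraMap F E) - ξ • 1 := by
  rw [Matrix.map_add _ (map_add θ), Matrix.map_smul' θ ξ _ (map_mul θ), h.map_eq,
    Matrix.map_one _ (map_zero θ) (map_one θ), neg_smul, ← sub_eq_add_neg]
  congr 1
  exact map_algebraMap_map_algHom τ (θ : E →ₐ[F] E)

/-- The conjugate of `u = τ + ξ` is `τ - ξ = u - 2ξ`, and `cγ = (τ - ξ) (τ + ξ)⁻¹`. -/
theorem IsImaginary.exists_mem_symmPoints_isCayley (h : IsImaginary θ ξ) (hc : θ c * c = 1)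
    (hτ : antitranspose τ = τ) (hu : IsUnit (τ.map (algebraMap F E) + ξ • 1)) :
    ∃ γ ∈ symmPoints θ, IsCayley c ξ γ.val (τ.map (algebraMap F E)) := by
  have c_ne_zero : c ≠ 0 := right_ne_zero_of_mul_eq_one hc
  obtain ⟨u, hu⟩ := hu
  let u' := Matrix.GeneralLinearGroup.map (θ : E →+* E) u
  have val_u' : u'.val = u.val - (2 * ξ) • 1 := by
    change u.val.map θ = _
    rw [hu, h.map_add_smul_one_map, two_mul, add_smul, add_sub_add_right_eq_sub]
  have commute : Commute u' u := Units.ext <| by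
    simp only [Units.val_mul, val_u', sub_mul, mul_sub, smul_mul_assoc, mul_smul_comm, one_mul,
      mul_one]
  have map_u' : Matrix.GeneralLinearGroup.map (θ : E →+* E) u' = u :=
    Units.ext (Matrix.ext fun i j => h.map_map _)
  have antisymm_u : antitranspose u.val = u.val := by
    rw [hu, antitranspose_add, antitranspose_map, hτ, antitranspose_smul, antitranspose_one]
  have antisymm_u' : antitranspose u'.val = u'.val := by
    change antitranspose (u.val.map (θ : E →+* E)) = _
    rw [antitranspose_map, antisymm_u]
    rfl
  let γ : GL (Fin 3) E := (Units.mk0 c c_ne_zero)⁻¹ • (u' * u⁻¹)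
  have val_γ : γ.val = c⁻¹ • (u'.val * (u⁻¹).val) := rfl
  refine ⟨γ, mem_symm_iff.2 ⟨?_, ?_⟩, ?_⟩
  · rw [val_γ, antitranspose_smul, antitranspose_mul, antisymm_u', antitranspose_val_inv antisymm_u,
      ← Units.val_mul, ← Units.val_mul, commute.inv_right.eq]
  · have map_γ : γ.val.map θ = c • (u.val * (u'⁻¹).val) := by
      rw [val_γ, Matrix.map_smul' θ _ _ (map_mul θ), map_inv₀, inv_eq_of_mul_eq_one_right hc,
        ← Units.val_mul]
      congr 1
      change (Matrix.GeneralLinearGroup.map (θ : E →+* E) (u' * u⁻¹)).val = _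
      rw [map_mul, map_inv, map_u']
      rfl
    change γ.val.map θ * γ.val = 1
    rw [map_γ, val_γ, smul_mul_smul_comm, mul_inv_cancel₀ c_ne_zero, one_smul, mul_assoc,
      Units.inv_mul_cancel_left, Units.mul_inv]
  · rw [IsCayley, ← hu, val_γ, smul_smul, mul_inv_cancel₀ c_ne_zero, one_smul, sub_mul, one_mul,
      Units.inv_mul_cancel_right, val_u', sub_sub_cancel]

/-- Symmetric matrices with the same distinct eigenvalues are conjugate under the orthogonal group
of a separably closed field. -/
theorem IsCayley.exists_mem_stableClass_isCayley {k : Type u} [Field k] [IsSepClosed k]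
    [Algebra F k] {P : GL (Fin 3) k} {t : Fin 3 → k} (h2 : (2 : F) ≠ 0) (h : IsImaginary θ ξ)
    (hc : θ c * c = 1) (hγ : IsCayley c ξ γ.val (τ.map (algebraMap F E)))
    (hP : IsOrthonormalFrame (τ.map (algebraMap F k)) P t) (hτ' : antitranspose τ' = τ')
    (hχ : τ'.charpoly = τ.charpoly) :
    ∃ γ' ∈ stableClass θ k γ, IsCayley c ξ γ'.val (τ'.map (algebraMap F E)) := by
  have h2k : (2 : k) ≠ 0 := by
    rw [← map_ofNat (algebraMap F k) 2]
    exact (map_ne_zero _).2 h2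
  have h2ξ := h.two_mul_ne_zero h2
  obtain ⟨γ', hγ', hτγ'⟩ := h.exists_mem_symmPoints_isCayley hc hτ' <|
    (isUnit_add_smul_one_iff_of_charpoly_eq (by rw [Matrix.charpoly_map, Matrix.charpoly_map, hχ])
      ξ).2 (hγ.isUnit_add_smul_one h2ξ.isUnit)
  obtain ⟨P', hP'⟩ := exists_isOrthonormalFrame (τ := τ'.map (algebraMap F k)) h2k
    hP.injective (by rw [antitranspose_map, hτ'])
    (by rw [← charpoly_conjDiagonal P, hP.conjDiagonal_eq, Matrix.charpoly_map, hχ,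
      Matrix.charpoly_map])
  obtain ⟨g, hg, intertwines⟩ := hP.exists_mem_specialOrthogonal_mul_eq hP'
  refine ⟨γ', mem_stableClass_iff.2 ⟨hγ', g, hg, ?_⟩, hτγ'⟩
  exact (hτγ'.semiconjBy_embed_iff (right_ne_zero_of_mul_eq_one hc) h2ξ hγ g).2 intertwines.symm

/-! ### The tori `T_ν` -/

section Cross

variable {A B : Type*} [CommRing A] [CommRing B]

/-- The matrices of the shape occurring in the definition of `T_ν`. -/
def cross (ν x y z : A) : Matrix (Fin 3) (Fin 3) A :=
  !![x, 0, y; 0, z, 0; ν * y, 0, x]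

lemma map_cross (f : A →+* B) (ν x y z : A) :
    (cross ν x y z).map f = cross (f ν) (f x) (f y) (f z) := by
  ext i j
  fin_cases i <;> fin_cases j <;> simp [cross]

lemma antitranspose_cross (ν x y z : A) : antitranspose (cross ν x y z) = cross ν x y z := by
  rw [antitranspose_eq_self_iff]
  ext i j
  fin_cases i <;> fin_cases j <;> simp [cross, J, Matrix.mul_apply, Fin.sum_univ_three]

lemma charpoly_cross (ν x y z : A) : (cross ν x y z).charpoly =
    (Polynomial.X - Polynomial.C z) *
      ((Polynomial.X - Polynomial.C x) ^ 2 - Polynomial.C (ν * y ^ 2)) := by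
  simp [cross, Matrix.charpoly, Matrix.det_fin_three]
  ring

lemma cross_add_smul_one (ν x y z a : A) :
    cross ν x y z + a • 1 = cross ν (x + a) y (z + a) := by
  ext i j
  fin_cases i <;> fin_cases j <;> simp [cross]

lemma one_sub_smul_cross (ν x y z a : A) :
    1 - a • cross ν x y z = cross ν (1 - a * x) (-(a * y)) (1 - a * z) := by
  ext i j
  fin_cases i <;> fin_cases j <;> simp [cross, mul_left_comm]

lemma smul_cross (ν x y z a : A) : a • cross ν x y z = cross ν (a * x) (a * y) (a * z) := by
  ext i j
  fin_cases i <;> fin_cases j <;> simp [cross, mul_left_comm]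

lemma det_cross (ν x y z : A) : (cross ν x y z).det = (x ^ 2 - ν * y ^ 2) * z := by
  simp [cross, Matrix.det_fin_three]
  ring

lemma cross_mul_cross (ν x y z x' y' z' : A) :
    cross ν x y z * cross ν x' y' z' =
      cross ν (x * x' + ν * (y * y')) (x * y' + y * x') (z * z') := by
  ext i j
  fin_cases i <;> fin_cases j <;> simp [cross, Matrix.mul_apply, Fin.sum_univ_three] <;> ring

lemma cross_one_zero_one (ν : A) : cross ν 1 0 1 = 1 := by
  ext i j
  fin_cases i <;> fin_cases j <;> simp [cross]

lemma exists_val_inv_eq_cross {u : GL (Fin 3) A} {ν x y z : A} (hu : u.val = cross ν x y z) :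
    ∃ x' y' z', (u⁻¹).val = cross ν x' y' z' := by
  have isUnit_det : IsUnit ((x ^ 2 - ν * y ^ 2) * z) := by
    rw [← det_cross, ← hu]
    exact u.isUnit.map Matrix.detMonoidHom
  obtain ⟨d, hd⟩ := (isUnit_of_mul_isUnit_left isUnit_det).exists_right_inv
  obtain ⟨w, hw⟩ := (isUnit_of_mul_isUnit_right isUnit_det).exists_right_inv
  refine ⟨d * x, -(d * y), w, Units.inv_eq_of_mul_eq_one_right ?_⟩
  rw [hu, cross_mul_cross, ← cross_one_zero_one ν]
  congr 1
  · linear_combination hd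
  · ring

lemma IsCayley.exists_val_eq_cross {c ξ ν x y z : A} {γ : Matrix (Fin 3) (Fin 3) A}
    (h : IsCayley c ξ γ (cross ν x y z)) (hc : IsUnit c) (hξ : IsUnit (2 * ξ)) :
    ∃ x' y' z', γ = cross ν x' y' z' := by
  obtain ⟨u, hu⟩ := h.isUnit_add_smul_one hξ
  obtain ⟨x', y', z', hinv⟩ := exists_val_inv_eq_cross (hu.trans (cross_add_smul_one ν x y z ξ))
  obtain ⟨s, hs⟩ := hc.exists_left_inv
  have one_sub_eq : 1 - c • γ = (2 * ξ) • (u⁻¹).val := by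
    rw [← Units.mul_left_inj u, smul_mul_assoc, Units.inv_mul, hu]
    exact h
  have γ_eq : γ = s • (1 - (2 * ξ) • (u⁻¹).val) := by
    rw [← one_sub_eq, sub_sub_cancel, smul_smul, hs, one_smul]
  rw [γ_eq, hinv, one_sub_smul_cross, smul_cross]
  exact ⟨_, _, _, rfl⟩

end Cross

variable {F E k : Type u} [Field F] [Field E] [Algebra F E] [Field k] [IsSepClosed k]
  [Algebra F k] {θ : E ≃ₐ[F] E} {c ξ : E} {γ : GL (Fin 3) E} {τ : Matrix (Fin 3) (Fin 3) F}
  {P : GL (Fin 3) k} {t : Fin 3 → k}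

theorem IsCayley.stableClass_inter_T_nonempty (h2 : (2 : F) ≠ 0) (h : IsImaginary θ ξ)
    (hc : θ c * c = 1) (hγ : IsCayley c ξ γ.val (τ.map (algebraMap F E)))
    (hP : IsOrthonormalFrame (τ.map (algebraMap F k)) P t) {z x ν f : F}
    (hχ : τ.charpoly = (Polynomial.X - Polynomial.C z) *
      ((Polynomial.X - Polynomial.C x) ^ 2 - Polynomial.C (ν * f ^ 2))) :
    (stableClass θ k γ ∩ T θ (algebraMap F E ν)).Nonempty := by
  obtain ⟨γ', hγ', hτγ'⟩ := hγ.exists_mem_stableClass_isCayley h2 h hc hP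
    (antitranspose_cross ν x f z) ((charpoly_cross ν x f z).trans hχ.symm)
  rw [map_cross] at hτγ'
  exact ⟨γ', hγ', hγ'.1.1, hτγ'.exists_val_eq_cross
    (right_ne_zero_of_mul_eq_one hc).isUnit (h.two_mul_ne_zero h2).isUnit⟩

lemma H1IsElementaryTwo.eq_one {Γ A : Type*} [Group Γ] [TopologicalSpace Γ] [Group A]
    [MulDistribMulAction Γ A] (h : H1IsElementaryTwo Γ A 0) (x : H1 Γ A) : x = 1 := by
  obtain ⟨_, ⟨e⟩⟩ := h
  exact e.injective (Subsingleton.elim _ _)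

lemma one_mem_frakD {F E : Type u} [Field F] [Field E] [Algebra F E] (k : Type u) [Field k]
    [Algebra F k] (γ : GL (Fin 3) E) : 1 ∈ frakD (F := F) k γ := by
  refine congrArg (Quotient.mk _) ?_
  congr 1

end SymmSpace

open SymmSpace in
theorem mainTheorem6_general {F E Fbar : Type u}
    [Field F] [ValuativeRel F] [TopologicalSpace F] [IsNonarchimedeanLocalField F]
    (hp : ringChar 𝓀[F] ≠ 2)
    [Field E] [Algebra F E] (hE : Module.finrank F E = 2) (θ : E ≃ₐ[F] E) (hθ : θ ≠ 1)
    [Field Fbar] [Algebra F Fbar] [IsSepClosure F Fbar]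
    (ϖ : 𝒪[F]) (hϖ : Irreducible ϖ)
    (ξ : (integralClosure 𝒪[F] E)ˣ) (hξ : Algebra.trace F E ((ξ : integralClosure 𝒪[F] E) : E) = 0)
    (γ : GL (Fin 3) E) (hγ : γ ∈ symmPoints θ) (hreg : IsRegularSemisimple γ) :
    (IsTypeI θ γ ∨ IsTypeII θ γ ∨ IsTypeIII θ γ →
      ∃ ν ∈ ({1, ((ξ : integralClosure 𝒪[F] E) : E) ^ 2, algebraMap F E ϖ,
          ((ξ : integralClosure 𝒪[F] E) : E) ^ 2 * algebraMap F E ϖ} : Set E),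
        (stableClass θ Fbar γ ∩ T θ ν).Nonempty) ∧
    (IsTypeI θ γ → H1IsElementaryTwo (Fbar ≃ₐ[F] Fbar) (stabilizer F γ Fbar) 2) ∧
    (IsTypeII θ γ → H1IsElementaryTwo (Fbar ≃ₐ[F] Fbar) (stabilizer F γ Fbar) 4) ∧
    (IsTypeIII θ γ → H1IsElementaryTwo (Fbar ≃ₐ[F] Fbar) (stabilizer F γ Fbar) 2) ∧
    (IsTypeIV θ γ →
      (∀ c : H1 (Fbar ≃ₐ[F] Fbar) (stabilizer F γ Fbar), c = 1) ∧
      frakD (F := F) Fbar γ = {1} ∧ stableClass θ Fbar γ = rationalOrbit θ γ) := by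
  have : IsSepClosed Fbar := IsSepClosure.sep_closed F
  have : IsGalois F Fbar := inferInstance
  have : IsGalois F E := isGalois_of_finrank_eq_two hE hθ
  have : Infinite F := infinite_of_isNonarchimedeanLocalField F
  have h2 := two_ne_zero_of_ringChar_residueField_ne_two hp
  have h := isImaginary_of_trace_eq_zero h2 hE hθ (fun h0 => ξ.ne_zero (Subtype.ext h0)) hξ
  let φ : E →ₐ[F] Fbar := IsSepClosed.lift
  obtain ⟨c, τ, P, t, hc, -, hτ, hP⟩ := exists_isCayley_isOrthonormalFrame h2 h φ hγ hreg
  have hc0 : c ≠ 0 := right_ne_zero_of_mul_eq_one hc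
  have hcard := hτ.twoTorsionCard_centralizer h2 h φ hc0 hP
  have hH1 {m} (hm : twoTorsionCard (centralizer θ γ F) ^ 2 = 4 * 2 ^ m) :
      H1IsElementaryTwo (Fbar ≃ₐ[F] Fbar) (stabilizer F γ Fbar) m :=
    hP.h1IsElementaryTwo_stabilizer hp (hτ.mem_stabilizer_iff hc0 (h.two_mul_ne_zero h2))
      (hcard ▸ hm)
  refine ⟨fun hT => ?_, fun hT => hH1 (by rw [hT.twoTorsionCard_eq h2 h]; norm_num),
    fun hT => hH1 (by rw [hT.twoTorsionCard_eq h2 h]; norm_num),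
    fun hT => hH1 (by rw [hT.twoTorsionCard_eq h2 h]; norm_num), fun hT => ?_⟩
  · have hlt : 2 < twoTorsionCard (torus τ) := by
      rw [← hcard]
      rcases hT with hT | hT | hT <;> rw [hT.twoTorsionCard_eq h2 h] <;> norm_num
    obtain ⟨z, x, D, hD, hχ⟩ := hP.toIsEigenframe.exists_charpoly_eq h2 hlt
    obtain ⟨ν, f, rfl, hν⟩ := exists_eq_mul_sq hp hϖ ξ h hD
    exact ⟨_, hν, hτ.stableClass_inter_T_nonempty h2 h hc hP hχ⟩
  · have h1 := (hH1 (by rw [hT.twoTorsionCard_eq h2 h]; norm_num)).eq_one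
    exact ⟨h1, Set.eq_singleton_iff_unique_mem.2 ⟨one_mem_frakD Fbar γ, fun x _ => h1 x⟩,
      hτ.stableClass_eq_rationalOrbit h2 h hc h1⟩

theorem mainTheorem6 {F E Fbar : Type u}
    -- `F` is a nonarchimedean local field of characteristic zero and odd residue characteristic
    [Field F] [ValuativeRel F] [TopologicalSpace F] [IsNonarchimedeanLocalField F] [CharZero F]
    (hp : ringChar 𝓀[F] ≠ 2)
    -- `E/F` is an unramified quadratic extension, `θ` generates its Galois group
    [Field E] [Algebra F E] (hE : Module.finrank F E = 2)
    (hunr : Algebra.FormallyUnramified 𝒪[F] (integralClosure 𝒪[F] E))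
    (θ : E ≃ₐ[F] E) (hθ : θ ≠ 1)
    [Field Fbar] [Algebra F Fbar] [IsAlgClosure F Fbar]
    -- `ϖ` is a uniformizer, `ξ` a unit of the valuation ring of `E` of trace zero
    (ϖ : 𝒪[F]) (hϖ : Irreducible ϖ)
    (ξ : (integralClosure 𝒪[F] E)ˣ) (hξ : Algebra.trace F E ((ξ : integralClosure 𝒪[F] E) : E) = 0)
    (γ : GL (Fin 3) E) (hγ : γ ∈ SymmSpace.symmPoints θ)
    (hreg : SymmSpace.IsRegularSemisimple γ) :
    (SymmSpace.IsTypeI θ γ ∨ SymmSpace.IsTypeII θ γ ∨ SymmSpace.IsTypeIII θ γ →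
      ∃ ν ∈ ({1, ((ξ : integralClosure 𝒪[F] E) : E) ^ 2, algebraMap F E ϖ,
          ((ξ : integralClosure 𝒪[F] E) : E) ^ 2 * algebraMap F E ϖ} : Set E),
        (SymmSpace.stableClass θ Fbar γ ∩ SymmSpace.T θ ν).Nonempty) ∧
    (SymmSpace.IsTypeI θ γ →
      SymmSpace.H1IsElementaryTwo (Fbar ≃ₐ[F] Fbar) (SymmSpace.stabilizer F γ Fbar) 2) ∧
    (SymmSpace.IsTypeII θ γ →
      SymmSpace.H1IsElementaryTwo (Fbar ≃ₐ[F] Fbar) (SymmSpace.stabilizer F γ Fbar) 4) ∧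
    (SymmSpace.IsTypeIII θ γ →
      SymmSpace.H1IsElementaryTwo (Fbar ≃ₐ[F] Fbar) (SymmSpace.stabilizer F γ Fbar) 2) ∧
    (SymmSpace.IsTypeIV θ γ →
      (∀ c : SymmSpace.H1 (Fbar ≃ₐ[F] Fbar) (SymmSpace.stabilizer F γ Fbar), c = 1) ∧
      SymmSpace.frakD (F := F) Fbar γ = {1} ∧
      SymmSpace.stableClass θ Fbar γ = SymmSpace.rationalOrbit θ γ) := by
  have : IsSepClosure F Fbar := .of_isAlgClosure_of_perfectField F Fbar
  exact mainTheorem6_general hp hE θ hθ ϖ hϖ ξ hξ γ hγ hreg
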